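/- Let $M$ be a smooth (Hausdorff, second countable) manifold of dimension $2n+1$, $\iota:Z\hookrightarrow M$ a closed embedded hypersurface with ideal $I_Z\subset C^\infty(M)$, and $k\ge 1$. If $k\ge 2$, fix a $(k-1)$-jet $j$ along $Z$ represented by a function vanishing transversely on $Z$; if $k=1$, let $j$ be the set of all functions vanishing on $Z$. Let $\mathcal A\to M$ be the $b^k$-tangent bundle, whose sections are the vector fields $X$ tangent to $Z$ with $X(f)\in I_Z^k$ for all $f\in j$. Let $\alpha\in\Omega^1(\mathcal A)$ be a $b^k$-contact form, i.e. $\alpha$ is nowhere zero and $d\alpha$ is nondegenerate on $\ker\alpha$ in all fibres of $\mathcal A$. A local defining function $z$ of $Z$ is called adapted if it represents $j$. The residue $u=\operatorname{Res}(\alpha)$ is the function on $Z$ given by $u=\alpha(z^k\partial_z)|_Z$ for adapted $z$; put $\Gamma=u^{-1}(0)$. Let $\sigma\in\Omega^1(\mathcal A)$ be a form that near each point of $Z$ equals $dz/z^k$ for some adapted $z$, and let $\beta\in\Omega^1(Z)$ be the form with $\alpha=u\sigma+\beta$ along $Z$, i.e. $\beta=\iota^*(\alpha-u\sigma)$. Then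 the smooth function $u$ is well defined, forms $\sigma$ exist, each $\sigma$ determines a unique smooth $\beta$, and the following hold. **(1)** The function $u$ vanishes transversely, so $\Gamma\subset Z$ is a hypersurface, and $\beta|_\Gamma$ is a contact form on $\Gamma$. The form $\omega=d(u^{-1}\beta)$ is symplectic on $Z\setminus\Gamma$, and with it each of the domains $\{u\ge 0\}$ and $\{u\le 0\}$, with boundary $\Gamma$, is an ideal Liouville domain: there is a defining function $v$ of the boundary such that $v\,u^{-1}\beta$ extends smoothly to the boundary and induces a contact form on it. Neither $\beta|_\Gamma$ nor $\omega$ depends on the choice of $\sigma$. **(2)** Let $(\Lambda,R)$ be the Jacobi pair of $\alpha$: $R$ is the Reeb field, and $\Lambda(\xi,\cdot)$ is the image in $TM$ of the element $X\in\ker\alpha$ with $d\alpha(X,\cdot)=\xi-\xi(R)\alpha$. Along $\Gamma$, the field $R$ is tangent to $\Gamma$, $\beta(R)=1$, and the vectors $\Lambda(\xi,\cdot)$ are exactly those of $T\Gamma\cap\ker\beta$; that is, $\beta|_\Gamma$ is the contact form that $(\Lambda,R)$ induces on $\Gamma$. On $Z\setminus\Gamma$, the vectors $\Lambda(\xi,\cdot)$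 are exactly those tangent to $Z$, and $\tau=d\beta+u^{-1}\beta\wedge du$ is the locally conformally symplectic form induced by $(\Lambda,R)$, that is, $\tau(\Lambda(\xi,\cdot),\cdot)=\xi|_{TZ}$. Moreover $\omega=u^{-1}\tau$. **(3)** Consider any $\mathbb R$-invariant codimension-one foliation $\mathcal F$ of $M\times\mathbb R$ with a Lie algebroid submersion $\Psi:\mathcal F\to\mathcal A$ over the projection $M\times\mathbb R\to M$, such that the components of $Z\times\mathbb R$ are leaves and all other leaves are transverse to the $\mathbb R$-direction (for example, any trivial regularisation of $\mathcal A$). Let $\alpha_{\rm reg}$ be the restriction of $\Psi^*\alpha$ to $Z\times\mathbb R$, and $s$ the coordinate on $\mathbb R$. Then $\alpha_{\rm reg}$ is a contact form, $\partial_s$ is a contact vector field transverse to $Z\times\{0\}$, and $\alpha_{\rm reg}=u'\,ds+\beta'$ with $u'=\alpha_{\rm reg}(\partial_s)|_{Z\times\{0\}}\in C^\infty(Z)$ and $\beta'=\alpha_{\rm reg}|_{Z\times\{0\}}\in\Omega^1(Z)$. The dividing set $\{u'=0\}$ of the convex hypersurface $Z\times\{0\}$ is $\Gamma$, and $\beta'|_\Gamma=\beta|_\Gamma$.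 With $\omega'=d(u'^{-1}\beta')$, the domains $\{u'\ge0\}$ and $\{u'\le0\}$ are ideal Liouville domains, and $\omega'=u'^{-1}\tau$ on $Z\setminus\Gamma$. There is a nowhere vanishing locally constant function $c$ on $Z$ such that $u=c\,u'$ and $\omega'=c\,\omega$. If, for an adapted function $z$ near $Z$, one has $\mathcal F=\ker(dz+z^k\,ds)$ and $\sigma=dz/z^k$ near $Z$, then $u'=-u$ and $\beta'=\beta$. -/

import Mathlib

open Set Topology
open scoped Manifold ContDiff

noncomputable section

namespace BContact

/-! ## Vector fields and differential forms on manifolds -/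

section Forms

variable {E : Type*} [NormedAddCommGroup E] [NormedSpace ℝ E] {H : Type*} [TopologicalSpace H]
  (I : ModelWithCorners ℝ E H) {M : Type*} [TopologicalSpace M] [ChartedSpace H M]
  [IsManifold I ∞ M]

/-- The vector field `X` on `M` is smooth. -/
def SmoothVF (X : Π p : M, TangentSpace I p) : Prop :=
  ContMDiff I I.tangent ∞ (fun p => (⟨p, X p⟩ : TangentBundle I M))

/-- The derivative `X f` of a function along a vector field. -/
def lieD (X : Π p : M, TangentSpace I p) (f : M → ℝ) : M → ℝ :=
  fun p => mvfderiv I f p (X p)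

/-- A (not necessarily smooth) differential 1-form on `M`. -/
abbrev OneForm (M : Type*) [TopologicalSpace M] [ChartedSpace H M] :=
  Π p : M, TangentSpace I p →L[ℝ] ℝ

/-- The 1-form `b` is smooth on the open set `U`: it takes smooth vector fields to functions that
are smooth on `U`. -/
def SmoothFormOn (b : OneForm I M) (U : Set M) : Prop :=
  ∀ X, SmoothVF I X → ContMDiffOn I 𝓘(ℝ, ℝ) ∞ (fun p => b p (X p)) U

/-- The exterior derivative of a 1-form, by the Koszul formula
`db(X, Y) = X(b(Y)) - Y(b(X)) - b([X, Y])`. -/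
def extD (b : OneForm I M) (X Y : Π p : M, TangentSpace I p) : M → ℝ := fun p =>
  lieD I X (fun q => b q (Y q)) p - lieD I Y (fun q => b q (X q)) p
    - b p (VectorField.mlieBracket I X Y p)

/-- The exterior derivative of a 2-form (given by its values on pairs of vector fields), by the
Koszul formula. -/
def extD₂ (τ : (Π p : M, TangentSpace I p) → (Π p : M, TangentSpace I p) → M → ℝ)
    (X Y W : Π p : M, TangentSpace I p) : M → ℝ := fun p =>
  lieD I X (τ Y W) p - lieD I Y (τ X W) p + lieD I W (τ X Y) p
    - τ (VectorField.mlieBracket I X Y) W p + τ (VectorField.mlieBracket I X W) Y p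
    - τ (VectorField.mlieBracket I Y W) X p

/-- The 2-form `τ` (given by its values on pairs of vector fields) is nondegenerate at `p`. -/
def NondegenerateAt (τ : (Π p : M, TangentSpace I p) → (Π p : M, TangentSpace I p) → M → ℝ)
    (p : M) : Prop :=
  ∀ X, SmoothVF I X → (∀ Y, SmoothVF I Y → τ X Y p = 0) → X p = 0

/-- `b` is a contact form on `M`: a smooth nowhere vanishing 1-form such that `db` is
nondegenerate on `ker b`. -/
def IsContactForm (b : OneForm I M) : Prop :=
  SmoothFormOn I b univ ∧ ∀ p : M, (∃ v, b p v ≠ 0) ∧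
    ∀ X, SmoothVF I X → b p (X p) = 0 →
      (∀ Y, SmoothVF I Y → b p (Y p) = 0 → extD I b X Y p = 0) → X p = 0

/-- Zero is a regular value of `v`, so that `S = {v = 0}` is a hypersurface with tangent spaces
`ker dv`, and the 1-form `b` restricts to a contact form on `S`: at all points of `S`, the
restriction of `b` to `TS` is nonzero, and that of `db` is nondegenerate on `TS ∩ ker b`. -/
def RestrictsToContactForm (v : M → ℝ) (b : OneForm I M) : Prop :=
  ∀ p : M, v p = 0 → mvfderiv I v p ≠ 0 ∧
    (∃ w, mvfderiv I v p w = 0 ∧ b p w ≠ 0) ∧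
    ∀ X, SmoothVF I X → mvfderiv I v p (X p) = 0 → b p (X p) = 0 →
      (∀ Y, SmoothVF I Y → mvfderiv I v p (Y p) = 0 → b p (Y p) = 0 → extD I b X Y p = 0) →
      X p = 0

/-- `F ⊆ M` is a domain with smooth boundary, and the 1-form `lam` on its interior makes it an
ideal Liouville domain: `d lam` is symplectic on the interior of `F`, and there is a defining
function `v` of the boundary such that `v • lam` extends to a smooth form on `F` that induces a
contact form on the boundary. (The values of `lam` outside of the interior are irrelevant. The
function `v` and the extension `b` of `v • lam` are taken to be smooth on all of `M`.) -/
def IsIdealLiouvilleDomain (F : Set M) (lam : OneForm I M) : Prop :=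
  SmoothFormOn I lam (interior F) ∧
  (∀ p ∈ interior F, NondegenerateAt I (extD I lam) p) ∧
  ∃ (v : M → ℝ) (b : OneForm I M), ContMDiff I 𝓘(ℝ, ℝ) ∞ v ∧ F = {p | 0 ≤ v p} ∧
    interior F = {p | 0 < v p} ∧ SmoothFormOn I b univ ∧
    (∀ p ∈ interior F, b p = v p • lam p) ∧ RestrictsToContactForm I v b

/-- The 2-form `τ` is locally conformally symplectic on the open set `U`: it is nondegenerate, and
`dτ = θ ∧ τ` for a closed 1-form `θ`. -/
def IsLocallyConformallySymplecticOn
    (τ : (Π p : M, TangentSpace I p) → (Π p : M, TangentSpace I p) → M → ℝ) (U : Set M) : Prop :=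
  (∀ X Y, SmoothVF I X → SmoothVF I Y → ContMDiffOn I 𝓘(ℝ, ℝ) ∞ (τ X Y) U) ∧
  (∀ p ∈ U, NondegenerateAt I τ p) ∧
  ∃ θ : OneForm I M, SmoothFormOn I θ U ∧
    (∀ X Y, SmoothVF I X → SmoothVF I Y → ∀ p ∈ U, extD I θ X Y p = 0) ∧
    ∀ X Y W, SmoothVF I X → SmoothVF I Y → SmoothVF I W → ∀ p ∈ U,
      extD₂ I τ X Y W p =
        θ p (X p) * τ Y W p - θ p (Y p) * τ X W p + θ p (W p) * τ X Y p

/-- The 1-form `u⁻¹ β`. -/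
def quotForm (u : M → ℝ) (β : OneForm I M) : OneForm I M := fun p => (u p)⁻¹ • β p

/-- The 2-form `dβ + u⁻¹ β ∧ du`. -/
def conformalForm (u : M → ℝ) (β : OneForm I M) (X Y : Π p : M, TangentSpace I p) : M → ℝ :=
  fun p => extD I β X Y p + (u p)⁻¹ * (β p (X p) * lieD I Y u p - β p (Y p) * lieD I X u p)

end Forms

/-! ## Convex hypersurfaces -/

section Convex

variable {E : Type*} [NormedAddCommGroup E] [NormedSpace ℝ E] {H : Type*} [TopologicalSpace H]
  (I : ModelWithCorners ℝ E H) {N : Type*} [TopologicalSpace N] [ChartedSpace H N]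
  [IsManifold I ∞ N]
  {E' : Type*} [NormedAddCommGroup E'] [NormedSpace ℝ E'] {H' : Type*} [TopologicalSpace H']
  (J : ModelWithCorners ℝ E' H') {S : Type*} [TopologicalSpace S] [ChartedSpace H' S]

/-- `X` is a contact vector field of `ker a`: the Lie derivative
`(L_X a)(Y) = X(a(Y)) - a([X, Y])` vanishes on `ker a`. -/
def IsContactVF (a : OneForm I N) (X : Π q : N, TangentSpace I q) : Prop :=
  SmoothVF I X ∧ ∀ Y, SmoothVF I Y → ∀ q, a q (Y q) = 0 →
    lieD I X (fun p => a p (Y p)) q - a q (VectorField.mlieBracket I X Y q) = 0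

/-- The vector field `X` is transverse to the hypersurface `e : S → N`. -/
def IsTransverseTo (e : S → N) (X : Π q : N, TangentSpace I q) : Prop :=
  ∀ x, X (e x) ∉ Set.range (mfderiv J I e x)

/-- The function `a(X)` on the hypersurface `e : S → N`. -/
def convexFunction (a : OneForm I N) (X : Π q : N, TangentSpace I q) (e : S → N) : S → ℝ :=
  fun x => a (e x) (X (e x))

/-- The dividing set of a convex hypersurface `e : S → N` with transverse contact vector field
`X`. -/
def convexDividingSet (a : OneForm I N) (X : Π q : N, TangentSpace I q) (e : S → N) : Set S :=
  {x | a (e x) (X (e x)) = 0}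

/-- The pullback of a 1-form. -/
def pullbackForm (a : OneForm I N) (e : S → N) : OneForm J S :=
  fun x => (a (e x)).comp (mfderiv J I e x)

end Convex

/-! ## The `b^k`-tangent bundle and its forms -/

section BK

variable {E : Type*} [NormedAddCommGroup E] [NormedSpace ℝ E] {H : Type*} [TopologicalSpace H]
  (I : ModelWithCorners ℝ E H) {M : Type*} [TopologicalSpace M] [ChartedSpace H M]
  [IsManifold I ∞ M]
  {E' : Type*} [NormedAddCommGroup E'] [NormedSpace ℝ E'] {H' : Type*} [TopologicalSpace H']
  (J : ModelWithCorners ℝ E' H') {Z : Type*} [TopologicalSpace Z] [ChartedSpace H' Z]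
  [IsManifold J ∞ Z]

/-- The ideal `I_Z` of smooth functions that vanish on the hypersurface `ι : Z → M`. -/
def vanishingIdeal (ι : Z → M) : Ideal C^∞⟮I, M; ℝ⟯ where
  carrier := {f | ∀ x, f (ι x) = 0}
  add_mem' := fun {f g} hf hg x => by simp [hf x, hg x]
  zero_mem' := fun x => by simp
  smul_mem' := fun c f hf x => by simp [hf x]

/-- The function `f₀` represents a jet along `Z` as needed to define a `b^k`-tangent bundle: it
vanishes on `Z` and, unless `k = 1` (in which case the jet carries no information), it does so
transversely. -/
def IsJetRepresentative (ι : Z → M) (k : ℕ) (f₀ : C^∞⟮I, M; ℝ⟯) : Prop :=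
  f₀ ∈ vanishingIdeal I ι ∧ (2 ≤ k → ∀ x, mvfderiv I f₀ (ι x) ≠ 0)

/-- The functions that represent the same `(k-1)`-jet along `Z` as `f₀`, that is, that agree with
`f₀` modulo `I_Z^k`. For `k = 1`, these are all smooth functions that vanish on `Z`. -/
def jet (ι : Z → M) (k : ℕ) (f₀ : C^∞⟮I, M; ℝ⟯) : Set C^∞⟮I, M; ℝ⟯ :=
  {f | f - f₀ ∈ vanishingIdeal I ι ^ k}

/-- The function `X f` belongs to the ideal `K`. -/
def DerivMem (X : Π p : M, TangentSpace I p) (f : C^∞⟮I, M; ℝ⟯) (K : Ideal C^∞⟮I, M; ℝ⟯) : Prop :=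
  ∃ g ∈ K, ∀ p, g p = lieD I X f p

/-- `X` is a section of the `b^k`-tangent bundle: a smooth vector field that is tangent to `Z` and
satisfies `X f ∈ I_Z^k` for all `f` in the jet. (For `k = 1` this is the module of vector fields
tangent to `Z`. The anchor is the inclusion into all vector fields, and the bracket is the Lie
bracket.) -/
def IsBkSection (ι : Z → M) (k : ℕ) (f₀ : C^∞⟮I, M; ℝ⟯) (X : Π p : M, TangentSpace I p) : Prop :=
  SmoothVF I X ∧ (∀ f ∈ vanishingIdeal I ι, DerivMem I X f (vanishingIdeal I ι)) ∧
    ∀ f ∈ jet I ι k f₀, DerivMem I X f (vanishingIdeal I ι ^ k)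

/-- A smooth 1-form on the `b^k`-tangent bundle: a `C^∞(M)`-linear map from its sections to
`C^∞(M)`. (The values of `toFun` on other vector fields are irrelevant.) -/
structure BkForm (ι : Z → M) (k : ℕ) (f₀ : C^∞⟮I, M; ℝ⟯) where
  toFun : (Π p : M, TangentSpace I p) → M → ℝ
  smooth : ∀ X, IsBkSection I ι k f₀ X → ContMDiff I 𝓘(ℝ, ℝ) ∞ (toFun X)
  map_add : ∀ X Y, IsBkSection I ι k f₀ X → IsBkSection I ι k f₀ Y →
    toFun (fun p => X p + Y p) = fun p => toFun X p + toFun Y p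
  map_smul : ∀ (f : M → ℝ) (X), ContMDiff I 𝓘(ℝ, ℝ) ∞ f → IsBkSection I ι k f₀ X →
    toFun (fun p => f p • X p) = fun p => f p * toFun X p

variable {I} {ι : Z → M} {k : ℕ} {f₀ : C^∞⟮I, M; ℝ⟯}

/-- The Lie algebroid differential of a 1-form, by the Koszul formula. -/
def BkForm.d (α : BkForm I ι k f₀) (X Y : Π p : M, TangentSpace I p) : M → ℝ := fun p =>
  lieD I X (α.toFun Y) p - lieD I Y (α.toFun X) p - α.toFun (VectorField.mlieBracket I X Y) p

variable (ι k f₀) in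
/-- The section `X` vanishes at `p` as a section of the vector bundle whose sections are the
`b^k`-vector fields: all 1-forms vanish on it at `p`. (On `Z` this is more than the vanishing of
the vector `X p`.) -/
def VanishesAt (X : Π p : M, TangentSpace I p) (p : M) : Prop :=
  ∀ η : BkForm I ι k f₀, η.toFun X p = 0

/-- `α` is a `b^k`-contact form: it is nowhere vanishing, and `dα` is nondegenerate on `ker α`,
at all points of `M` and with respect to the fibres of the `b^k`-tangent bundle. -/
def BkForm.IsContact (α : BkForm I ι k f₀) : Prop :=
  ∀ p : M, (∃ X, IsBkSection I ι k f₀ X ∧ α.toFun X p ≠ 0) ∧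
    ∀ X, IsBkSection I ι k f₀ X → α.toFun X p = 0 →
      (∀ Y, IsBkSection I ι k f₀ Y → α.toFun Y p = 0 → α.d X Y p = 0) →
      VanishesAt ι k f₀ X p

/-- `u = Res(α)`: at each point of `Z`, `u` is the value of `α` on `z^k ∂_z`, that is, on a
section `X` that vanishes there as a tangent vector and satisfies `X z = z^k` near that point, for
a local defining function `z` of `Z` that represents the jet. -/
def IsResidue (α : BkForm I ι k f₀) (u : Z → ℝ) : Prop :=
  ∀ x : Z, ∀ z ∈ jet I ι k f₀, mvfderiv I z (ι x) ≠ 0 → ∀ X, IsBkSection I ι k f₀ X →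
    X (ι x) = 0 → (∀ᶠ p in 𝓝 (ι x), lieD I X z p = z p ^ k) → u x = α.toFun X (ι x)

/-- The `b^k`-form `σ` is equal to `dz / z^k` near each point of `Z`, for a local defining function
`z` of `Z` that represents the jet. (For `k = 1` this includes `σ = d log |z|` for a distance
function `|z|` to `Z`, which exists even if `Z` is not coorientable.) -/
def IsLogForm (σ : BkForm I ι k f₀) : Prop :=
  ∀ x : Z, ∃ z ∈ jet I ι k f₀, mvfderiv I z (ι x) ≠ 0 ∧ ∃ U ∈ 𝓝 (ι x),
    ∀ X, IsBkSection I ι k f₀ X → ∀ p ∈ U, lieD I X z p = z p ^ k * σ.toFun X p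

/-- `β = ι^*(α - u σ)`, so that `α = u σ + β` along `Z`: the equation
`α(X) = u σ(X) + β(X)` holds on `Z` for all sections `X` of the `b^k`-tangent bundle; the
restriction of `X` to `Z` is tangent to `Z`. -/
def IsTangentialPart (α σ : BkForm I ι k f₀) (u : Z → ℝ) (β : OneForm J Z) : Prop :=
  ∀ X, IsBkSection I ι k f₀ X → ∀ (x : Z) (w : TangentSpace J x),
    mfderiv J I ι x w = X (ι x) → α.toFun X (ι x) = u x * σ.toFun X (ι x) + β x w

/-! ### The Jacobi pair of a contact form -/

/-- `R` is a section that agrees at `p` with the Reeb vector field of `α`. -/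
def IsReebAt (α : BkForm I ι k f₀) (p : M) (R : Π p : M, TangentSpace I p) : Prop :=
  IsBkSection I ι k f₀ R ∧ α.toFun R p = 1 ∧ ∀ Y, IsBkSection I ι k f₀ Y → α.d R Y p = 0

/-- The tangent vector `v` is `Λ(ξ, ·)`, where `(Λ, R)` is the Jacobi pair on `M` associated with
the contact form `α`. At the level of the `b^k`-tangent bundle, `Λ(ξ, ·)` is the unique element `X`
of `ker α` with `dα(X, ·) = ξ - ξ(R) α`. -/
def IsJacobiSharp (α : BkForm I ι k f₀) (p : M) (ξ : TangentSpace I p →L[ℝ] ℝ)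
    (v : TangentSpace I p) : Prop :=
  ∃ R X, IsReebAt α p R ∧ IsBkSection I ι k f₀ X ∧ α.toFun X p = 0 ∧
    (∀ Y, IsBkSection I ι k f₀ Y → α.d X Y p = ξ (Y p) - ξ (R p) * α.toFun Y p) ∧ X p = v

/-- The hypersurface `Γ = {u = 0}` of `Z` is tangent to the odd-dimensional leaves of the Jacobi
pair `(Λ, R)` of `α`, and `β` restricts to the contact form which this pair induces on them: at
all points of `Γ`, the vector `R` is tangent to `Γ` with `β(R) = 1`, and the vectors `Λ(ξ, ·)` are
those in `TΓ ∩ ker β`. -/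
def InducesJacobiContactForm (α : BkForm I ι k f₀) (u : Z → ℝ) (β : OneForm J Z) : Prop :=
  ∀ x : Z, u x = 0 →
    (∃ R, IsReebAt α (ι x) R) ∧ (∀ ξ, ∃ v, IsJacobiSharp α (ι x) ξ v) ∧
    (∀ R, IsReebAt α (ι x) R →
      ∃ r, mfderiv J I ι x r = R (ι x) ∧ mvfderiv J u x r = 0 ∧ β x r = 1) ∧
    {v | ∃ ξ, IsJacobiSharp α (ι x) ξ v} =
      mfderiv J I ι x '' {w | mvfderiv J u x w = 0 ∧ β x w = 0}

/-- The open set `{u ≠ 0}` of `Z` consists of even-dimensional leaves of the Jacobi pair `(Λ, R)`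
of `α`, and `τ` is the locally conformally symplectic form which this pair induces on them: at all
points of `{u ≠ 0}`, the vectors `Λ(ξ, ·)` are the ones tangent to `Z`, and
`τ(Λ(ξ, ·), ·) = ξ`. -/
def IsJacobiConformalForm (α : BkForm I ι k f₀) (u : Z → ℝ)
    (τ : (Π x : Z, TangentSpace J x) → (Π x : Z, TangentSpace J x) → Z → ℝ) : Prop :=
  IsLocallyConformallySymplecticOn J τ {x | u x ≠ 0} ∧
  ∀ x : Z, u x ≠ 0 →
    (∃ R, IsReebAt α (ι x) R) ∧ (∀ ξ, ∃ v, IsJacobiSharp α (ι x) ξ v) ∧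
    {v | ∃ ξ, IsJacobiSharp α (ι x) ξ v} = Set.range (mfderiv J I ι x) ∧
    ∀ ξ W Y, SmoothVF J W → SmoothVF J Y → IsJacobiSharp α (ι x) ξ (mfderiv J I ι x (W x)) →
      τ W Y x = ξ (mfderiv J I ι x (Y x))

/-! ### Regularisations -/

/-- The coordinate vector field `∂_s` on `M × ℝ`. -/
def vertVF (I : ModelWithCorners ℝ E H) (q : M × ℝ) : TangentSpace (I.prod 𝓘(ℝ, ℝ)) q :=
  mfderiv 𝓘(ℝ, ℝ) (I.prod 𝓘(ℝ, ℝ)) (fun s : ℝ => (q.1, s)) q.2 (1 : ℝ)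

variable (I ι k f₀) in
/-- An `ℝ`-invariant codimension-one foliation `𝓕` of `M × ℝ` together with a Lie algebroid
submersion `Ψ` from `𝓕` to the `b^k`-tangent bundle over the projection `M × ℝ → M`, such that the
components of `Z × ℝ` are leaves and the other leaves are transverse to the `ℝ`-direction. As `Ψ`
is a fibrewise isomorphism, it is given by its inverse, which lifts sections of the `b^k`-tangent
bundle to sections of `𝓕`, and `𝓕` at `q` consists of the values at `q` of the lifts.
Trivial regularisations are of this kind; that all leaves outside of `Z × ℝ` are diffeomorphic
to components of `M ∖ Z` is not required. -/
structure Regularisation where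
  lift : (Π p : M, TangentSpace I p) → Π q : M × ℝ, TangentSpace (I.prod 𝓘(ℝ, ℝ)) q
  smooth : ∀ X, IsBkSection I ι k f₀ X → SmoothVF (I.prod 𝓘(ℝ, ℝ)) (lift X)
  map_add : ∀ X Y, IsBkSection I ι k f₀ X → IsBkSection I ι k f₀ Y →
    lift (fun p => X p + Y p) = fun q => lift X q + lift Y q
  map_smul : ∀ (f : M → ℝ) (X), ContMDiff I 𝓘(ℝ, ℝ) ∞ f → IsBkSection I ι k f₀ X →
    lift (fun p => f p • X p) = fun q => f q.1 • lift X q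
  anchor : ∀ X, IsBkSection I ι k f₀ X → ∀ q : M × ℝ,
    mfderiv (I.prod 𝓘(ℝ, ℝ)) I Prod.fst q (lift X q) = X q.1
  bracket : ∀ X Y, IsBkSection I ι k f₀ X → IsBkSection I ι k f₀ Y →
    lift (VectorField.mlieBracket I X Y) =
      VectorField.mlieBracket (I.prod 𝓘(ℝ, ℝ)) (lift X) (lift Y)
  injective : ∀ X, IsBkSection I ι k f₀ X → ∀ q : M × ℝ, lift X q = 0 → VanishesAt ι k f₀ X q.1
  invariant : ∀ (t : ℝ) (q : M × ℝ),
    mfderiv (I.prod 𝓘(ℝ, ℝ)) (I.prod 𝓘(ℝ, ℝ)) (fun r : M × ℝ => (r.1, r.2 + t)) q ''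
        {v | ∃ X, IsBkSection I ι k f₀ X ∧ lift X q = v} =
      {v | ∃ X, IsBkSection I ι k f₀ X ∧ lift X (q.1, q.2 + t) = v}
  central : ∀ (x : Z) (s : ℝ), {v | ∃ X, IsBkSection I ι k f₀ X ∧ lift X (ι x, s) = v} =
    Set.range (mfderiv (J.prod 𝓘(ℝ, ℝ)) (I.prod 𝓘(ℝ, ℝ))
      (fun r : Z × ℝ => (ι r.1, r.2)) (x, s))
  transverse : ∀ q : M × ℝ, q.1 ∉ Set.range ι →
    ¬ ∃ X, IsBkSection I ι k f₀ X ∧ lift X q = vertVF I q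

variable {J}

/-- `a` is the restriction to the central leaf `Z × ℝ` of the foliated form
`α_reg = Ψ^* α` on the regularisation. -/
def Regularisation.IsInducedForm (Φ : Regularisation I J ι k f₀) (α : BkForm I ι k f₀)
    (a : OneForm (J.prod 𝓘(ℝ, ℝ)) (Z × ℝ)) : Prop :=
  ∀ X, IsBkSection I ι k f₀ X → ∀ (r : Z × ℝ) (w : TangentSpace (J.prod 𝓘(ℝ, ℝ)) r),
    mfderiv (J.prod 𝓘(ℝ, ℝ)) (I.prod 𝓘(ℝ, ℝ)) (fun r : Z × ℝ => (ι r.1, r.2)) r w =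
      Φ.lift X (ι r.1, r.2) → a r w = α.toFun X (ι r.1)

/-- Near `Z × ℝ`, the foliation is `ker(dz + z^k ds)`, for a function `z` that represents the jet
and cuts out `Z` transversely, and `σ` is `dz / z^k` there. -/
def Regularisation.IsStandard (Φ : Regularisation I J ι k f₀) (σ : BkForm I ι k f₀) : Prop :=
  ∃ z ∈ jet I ι k f₀, (∀ x, mvfderiv I z (ι x) ≠ 0) ∧ ∃ U, IsOpen U ∧ Set.range ι ⊆ U ∧
    ∀ X, IsBkSection I ι k f₀ X → ∀ p ∈ U, lieD I X z p = z p ^ k * σ.toFun X p ∧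
      ∀ s : ℝ, lieD I X z p +
        z p ^ k * mvfderiv (I.prod 𝓘(ℝ, ℝ)) (Prod.snd : M × ℝ → ℝ) (p, s) (Φ.lift X (p, s)) = 0

end BK

end BContact

end

open Set Topology
open scoped Manifold ContDiff

set_option linter.unusedSectionVars false

noncomputable section

/-! Everything happens along `Z`, where the fibre of the `b^k`-tangent bundle at `x` is identified
with `ℝ × T_x Z` by `X ↦ (σ(X), w)`, with `w` the tangent vector of `Z` that the anchor gives
(`exists_section`, `tensor_eq_zero_of_isLogForm`). In this splitting `α = u σ + β`. Since `σ` is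
closed along `Z` (`d_isLogForm`), `dα = du ∧ σ + dβ` (`d_eq`). The contact condition along `Z`
therefore says precisely that the invariant form `u ds + β` on `Z × ℝ` is a contact form. This is
the notion `IsContactPair` of linear algebra, and `IsContactPairOn` globally.

Parts (1) and (2) are then pointwise linear algebra. Where `u = 0`, the vector `(1, 0)` lies in the
kernel of the 1-form, which forces `du ≠ 0` on `ker β` and makes `β` contact on `ker du`. Where `u ≠
0`, the kernel is the graph of `-u⁻¹ β` over `TZ`, and the 2-form on it is `τ = dβ + u⁻¹ β ∧ du = u
d(u⁻¹ β)`. The Reeb vector and the vectors `Λ(ξ, ·)` solve linear equations in `ℝ × T_x Z`.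

Independence of choices and part (3) are one and the same change of splitting. Another closed form
along `Z` is `c σ + γ` with `c` locally constant and `γ` closed (`closed_parts`). If `c` has no
zeros, rewriting `α` in terms of it gives `u' = u / c` and `β' = β - u' γ`, so that `u'⁻¹ β' = c u⁻¹
β - γ` and `d(u'⁻¹ β') = c d(u⁻¹ β)`. For a second log form, `c = 1` (`apply_kernel_section`, which
also makes the residue well defined). For a regularisation, the form is the restriction of `ds` to
the foliation: it does not depend on `s` by invariance and transversality (`dsnd_lift`), is closed
because lifting preserves brackets (`d_verticalForm`), and has `c ≠ 0` because lifting is injective.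

The analytic input is Hadamard's lemma in a slice chart: functions in `I_Z^k` are divisible by `z^k`
with smooth quotient. It shows that `dz / z^k` is a smooth form, and that tensors at a point of `Z`
depend only on the pair `(σ(X), w)`. -/

namespace BContact

/-! ### Functions, vector fields, frames and Lie brackets on a manifold. -/

section VectorFields

variable {E : Type*} [NormedAddCommGroup E] [NormedSpace ℝ E] {H : Type*} [TopologicalSpace H]
  {I : ModelWithCorners ℝ E H} {M : Type*} [TopologicalSpace M] [ChartedSpace H M]
  {p : M} {f g : M → ℝ} {X Y W : Π p : M, TangentSpace I p}

variable (I) in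
/-- The real function `f` on `M` is smooth. -/
abbrev SmoothFn (f : M → ℝ) : Prop := ContMDiff I 𝓘(ℝ, ℝ) ∞ f

theorem SmoothFn.mdiff (hf : SmoothFn I f) (p : M) : MDifferentiableAt I 𝓘(ℝ, ℝ) f p :=
  (hf p).mdifferentiableAt (by simp)

theorem mvfderiv_congr (h : f =ᶠ[𝓝 p] g) : mvfderiv I f p = mvfderiv I g p := by
  ext v
  simp only [mvfderiv, h.mfderiv_eq]
  rfl

theorem lieD_congr (h : f =ᶠ[𝓝 p] g) : lieD I X f p = lieD I X g p := by
  simp only [lieD, mvfderiv, h.mfderiv_eq]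
  rfl

theorem lieD_add_left : lieD I (fun q => X q + Y q) f p = lieD I X f p + lieD I Y f p := by
  simp [lieD]

theorem lieD_sub_left : lieD I (fun q => X q - Y q) f p = lieD I X f p - lieD I Y f p := by
  simp [lieD]

theorem lieD_smul_left : lieD I (fun q => g q • X q) f p = g p * lieD I X f p := by
  simp [lieD]

theorem lieD_add (hf : MDifferentiableAt I 𝓘(ℝ, ℝ) f p) (hg : MDifferentiableAt I 𝓘(ℝ, ℝ) g p) :
    lieD I X (fun q => f q + g q) p = lieD I X f p + lieD I X g p := by
  simp [lieD, mvfderiv_fun_add hf hg]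

theorem lieD_sub (hf : MDifferentiableAt I 𝓘(ℝ, ℝ) f p) (hg : MDifferentiableAt I 𝓘(ℝ, ℝ) g p) :
    lieD I X (fun q => f q - g q) p = lieD I X f p - lieD I X g p := by
  simp [lieD, mvfderiv_fun_sub hf hg]

theorem lieD_neg : lieD I X (fun q => - f q) p = - lieD I X f p := by
  simp [lieD, mvfderiv_fun_neg]

theorem lieD_const (c : ℝ) : lieD I X (fun _ => c) p = 0 := by
  simp [lieD, mvfderiv_const]

theorem lieD_mul (hf : MDifferentiableAt I 𝓘(ℝ, ℝ) f p) (hg : MDifferentiableAt I 𝓘(ℝ, ℝ) g p) :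
    lieD I X (fun q => f q * g q) p = f p * lieD I X g p + g p * lieD I X f p := by
  simp [lieD, mvfderiv_fun_mul hf hg]

theorem lieD_pow (hf : MDifferentiableAt I 𝓘(ℝ, ℝ) f p) (n : ℕ) :
    lieD I X (fun q => f q ^ n) p = n * f p ^ (n - 1) * lieD I X f p := by
  induction n with
  | zero => simp [lieD_const]
  | succ n ih =>
    have hn : MDifferentiableAt I 𝓘(ℝ, ℝ) (fun q => f q ^ n) p := by
      have := (hf.pow n)
      exact this
    simp only [pow_succ]
    rw [lieD_mul hn hf, ih]
    rcases n with _ | n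
    · simp
    · simp only [Nat.add_sub_cancel, pow_succ]
      push_cast
      ring

variable [IsManifold I ∞ M]

theorem SmoothVF.mdiff (hX : SmoothVF I X) (p : M) :
    MDifferentiableAt I I.tangent (fun p => (⟨p, X p⟩ : TangentBundle I M)) p :=
  (hX p).mdifferentiableAt (by simp)

theorem SmoothVF.add (hX : SmoothVF I X) (hY : SmoothVF I Y) :
    SmoothVF I (fun p => X p + Y p) :=
  ContMDiff.add_section hX hY

theorem SmoothVF.sub (hX : SmoothVF I X) (hY : SmoothVF I Y) :
    SmoothVF I (fun p => X p - Y p) :=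
  ContMDiff.sub_section hX hY

theorem SmoothVF.smul (hf : SmoothFn I f) (hX : SmoothVF I X) :
    SmoothVF I (fun p => f p • X p) :=
  ContMDiff.smul_section hf hX

theorem SmoothVF.zero : SmoothVF I (fun p : M => (0 : TangentSpace I p)) :=
  Bundle.contMDiff_zeroSection ℝ (TangentSpace I : M → Type _)

theorem SmoothVF.lieD (hX : SmoothVF I X) (hf : SmoothFn I f) : SmoothFn I (lieD I X f) := by
  have h := ContMDiff.contMDiff_tangentMap (m := ∞) hf (by simp)
  have h2 := (contMDiff_snd_tangentBundle_modelSpace (n := ∞) ℝ 𝓘(ℝ, ℝ)).comp (h.comp hX)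
  exact h2

theorem SmoothVF.mlieBracket [CompleteSpace E] (hX : SmoothVF I X) (hY : SmoothVF I Y) :
    SmoothVF I (VectorField.mlieBracket I X Y) := by
  have h1 : IsManifold I (((⊤ : ℕ∞) : ℕ∞ω) + 1) M := by simpa
  have h2 : IsManifold I (minSmoothness ℝ 2) M := by
    rw [minSmoothness_of_isRCLikeNormedField]; infer_instance
  exact ContDiff.mlieBracket_vectorField (m := ⊤) (n := ⊤) hX hY (by simp)

variable [FiniteDimensional ℝ E] [T2Space M]

theorem exists_cutoff {U : Set M} (hU : U ∈ 𝓝 p) :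
    ∃ χ : M → ℝ, SmoothFn I χ ∧ (∀ᶠ q in 𝓝 p, χ q = 1) ∧ tsupport χ ⊆ U := by
  obtain ⟨f, -, hf⟩ := (SmoothBumpFunction.nhds_basis_tsupport (I := I) p).mem_iff.1 hU
  exact ⟨f, f.contMDiff, f.eventuallyEq_one, hf⟩

/-- Turns germs into global functions: multiplication by a cutoff extends by zero. Forms and modules
of fields here only see globally smooth data, so local constructions pass through this lemma or its
analogue for fields. -/
theorem exists_smoothFn_eventuallyEq (hf : ∀ᶠ q in 𝓝 p, ContMDiffAt I 𝓘(ℝ, ℝ) ∞ f q) :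
    ∃ F : M → ℝ, SmoothFn I F ∧ ∀ᶠ q in 𝓝 p, F q = f q := by
  obtain ⟨χ, hχ, h1, hs⟩ := exists_cutoff (I := I) hf
  refine ⟨fun q => χ q * f q, contMDiff_of_tsupport fun q hq => ?_, ?_⟩
  · have : q ∈ tsupport χ := closure_mono (fun q hq => by
      simp only [Function.mem_support] at *; exact left_ne_zero_of_mul hq) hq
    exact (hχ q).mul (hs this)
  · filter_upwards [h1] with q hq
    simp [hq]

theorem SmoothVF.cutoff {χ : M → ℝ} (hχ : SmoothFn I χ) (hX : ∀ q ∈ tsupport χ,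
    ContMDiffAt I I.tangent ∞ (fun p => (⟨p, X p⟩ : TangentBundle I M)) q) :
    SmoothVF I (fun p => χ p • X p) := by
  intro q
  by_cases hq : q ∈ tsupport χ
  · exact ContMDiffAt.smul_section (hχ q) (hX q hq)
  · have hz : ∀ᶠ q' in 𝓝 q, χ q' = 0 := by
      filter_upwards [(isClosed_tsupport χ).isOpen_compl.mem_nhds hq] with q' hq'
      exact image_eq_zero_of_notMem_tsupport hq'
    refine ((SmoothVF.zero (I := I) (M := M)) q).congr_of_eventuallyEq ?_
    filter_upwards [hz] with q' hq'
    rw [hq', zero_smul]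

theorem exists_smoothVF_eventuallyEq (hX : ∀ᶠ q in 𝓝 p,
    ContMDiffAt I I.tangent ∞ (fun p => (⟨p, X p⟩ : TangentBundle I M)) q) :
    ∃ V : Π p : M, TangentSpace I p, SmoothVF I V ∧ ∀ᶠ q in 𝓝 p, V q = X q := by
  obtain ⟨χ, hχ, h1, hs⟩ := exists_cutoff (I := I) hX
  refine ⟨fun q => χ q • X q, SmoothVF.cutoff hχ hs, ?_⟩
  filter_upwards [h1] with q hq
  simp [hq]

/-- Every covector is the differential of a smooth function. -/
theorem exists_smoothFn_mvfderiv_eq (ξ : TangentSpace I p →L[ℝ] ℝ) :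
    ∃ f : M → ℝ, SmoothFn I f ∧ mvfderiv I f p = ξ := by
  obtain ⟨B, hB⟩ := isInvertible_mfderiv_extChartAt (I := I) (mem_extChartAt_source (I := I) p)
  let B' : TangentSpace I p ≃L[ℝ] E := B
  let L : E →L[ℝ] ℝ := ξ.comp (B'.symm : E →L[ℝ] TangentSpace I p)
  obtain ⟨F, hF, hFe⟩ := exists_smoothFn_eventuallyEq (I := I) (p := p)
    (f := fun q => L (extChartAt I p q)) (by
      filter_upwards [extChartAt_source_mem_nhds (I := I) p] with q hq
      have h1 : ContMDiffAt I 𝓘(ℝ, E) ∞ (extChartAt I p) q :=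
        contMDiffAt_extChartAt' (by simpa using hq)
      exact (ContinuousLinearMap.contMDiff (n := ∞) L).contMDiffAt.comp q h1)
  refine ⟨F, hF, ?_⟩
  have h1 : MDifferentiableAt I 𝓘(ℝ, E) (extChartAt I p) p :=
    (contMDiffAt_extChartAt (n := ∞)).mdifferentiableAt (by simp)
  have h2 : HasMFDerivAt I 𝓘(ℝ, ℝ) F p (L.comp (mfderiv I 𝓘(ℝ, E) (extChartAt I p) p)) := by
    refine HasMFDerivAt.congr_of_eventuallyEq ?_ hFe
    exact (L.hasMFDerivAt (x := extChartAt I p p)).comp p h1.hasMFDerivAt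
  ext v
  have h3 : mvfderiv I F p v = L (mfderiv I 𝓘(ℝ, E) (extChartAt I p) p v) := by
    simp only [mvfderiv]
    rw [h2.mfderiv]
    rfl
  rw [h3, ← hB]
  exact congrArg ξ (B'.symm_apply_apply v)

/-- Every tangent vector is the value of a smooth vector field. -/
theorem exists_smoothVF_apply_eq (v : TangentSpace I p) :
    ∃ V : Π p : M, TangentSpace I p, SmoothVF I V ∧ V p = v := by
  obtain ⟨s, hs, hd⟩ := FiberBundle.exists_contMDiffOn_extend (k := ∞) I E
    (V := (TangentSpace I : M → Type _)) v
  obtain ⟨V, hV, he⟩ := exists_smoothVF_eventuallyEq (I := I) (p := p)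
    (X := FiberBundle.extend E v) (by
      filter_upwards [eventually_mem_nhds_iff.2 hs] with q hq
      exact hd.contMDiffAt hq)
  exact ⟨V, hV, by rw [he.self_of_nhds]; simp⟩

/-- Near every point, the tangent bundle has a frame of smooth vector fields. -/
theorem exists_frame (p : M) : ∃ (m : ℕ) (V : Fin m → Π p : M, TangentSpace I p),
    (∀ i, SmoothVF I (V i)) ∧ (∀ᶠ q in 𝓝 p, LinearIndependent ℝ (fun i => V i q)) ∧
    ∀ X : Π p : M, TangentSpace I p, ∃ c : Fin m → M → ℝ,
      (∀ᶠ q in 𝓝 p, X q = ∑ i, c i q • V i q) ∧ (X p = 0 → ∀ i, c i p = 0) ∧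
      (SmoothVF I X → ∀ i, SmoothFn I (c i)) := by
  let t := trivializationAt E (TangentSpace I : M → Type _) p
  have hp : p ∈ t.baseSet := FiberBundle.mem_baseSet_trivializationAt E _ p
  have hnb : t.baseSet ∈ 𝓝 p := t.open_baseSet.mem_nhds hp
  let b := Module.finBasis ℝ E
  have hs : ∀ i, ∃ V : Π p : M, TangentSpace I p, SmoothVF I V ∧
      ∀ᶠ q in 𝓝 p, V q = t.localFrame b i q := fun i =>
    exists_smoothVF_eventuallyEq (by
      filter_upwards [hnb] with q hq
      exact contMDiffAt_localFrame_of_mem ∞ t b i hq)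
  choose V hV hVe using hs
  have hVe' : ∀ᶠ q in 𝓝 p, ∀ i, V i q = t.localFrame b i q := Filter.eventually_all.2 hVe
  refine ⟨_, V, hV, ?_, fun X => ?_⟩
  · filter_upwards [hVe', hnb] with q hq hqb
    simp only [hq]
    exact (t.isLocalFrameOn_localFrame_baseSet I 1 b).linearIndependent hqb
  -- The expansion is also needed for fields not yet known to be smooth: `exists_restriction`
  -- deduces smoothness from it. For these the raw coefficients are used, without a cutoff.
  · by_cases hX : SmoothVF I X
    · have hc : ∀ i, ∃ F : M → ℝ, SmoothFn I F ∧
          ∀ᶠ q in 𝓝 p, F q = t.localFrameCoeff I b i q (X q) := fun i =>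
        exists_smoothFn_eventuallyEq (by
          filter_upwards [hnb] with q hq
          exact contMDiffAt_localFrameCoeff b hq (hX q) i)
      choose c hc hce using hc
      have hce' := Filter.eventually_all.2 hce
      refine ⟨c, ?_, fun h0 i => ?_, fun _ => hc⟩
      · filter_upwards [hVe', hce', hnb] with q h1 h2 h3
        simp only [h1, h2]
        exact Bundle.Trivialization.eq_sum_localFrameCoeff_smul (I := I) (b := b) h3
      · rw [(hce i).self_of_nhds, h0, map_zero]
    · refine ⟨fun i q => t.localFrameCoeff I b i q (X q), ?_, fun h0 i => ?_,
        fun h => absurd h hX⟩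
      · filter_upwards [hVe', hnb] with q h1 h3
        simp only [h1]
        exact Bundle.Trivialization.eq_sum_localFrameCoeff_smul (I := I) (b := b) h3
      · simp only [h0, map_zero]

/-- A field which locally is a combination of smooth vector fields with smooth coefficients is
smooth. -/
theorem smoothVF_of_lincomb {X : Π p : M, TangentSpace I p}
    (h : ∀ p, ∃ (m : ℕ) (V : Fin m → Π p : M, TangentSpace I p) (c : Fin m → M → ℝ),
      (∀ i, SmoothVF I (V i)) ∧ (∀ i, ∀ᶠ q in 𝓝 p, ContMDiffAt I 𝓘(ℝ, ℝ) ∞ (c i) q) ∧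
      ∀ᶠ q in 𝓝 p, X q = ∑ i, c i q • V i q) : SmoothVF I X := by
  intro p
  obtain ⟨m, V, c, hV, hc, he⟩ := h p
  have h1 : ContMDiffAt I I.tangent ∞
      (fun q => (⟨q, ∑ i, c i q • V i q⟩ : TangentBundle I M)) p := by
    refine ContMDiffAt.sum_section fun i _ => ?_
    exact ContMDiffAt.smul_section (hc i).self_of_nhds (hV i p)
  refine h1.congr_of_eventuallyEq ?_
  filter_upwards [he] with q hq
  rw [hq]

/-- The solution of a regular system of linear equations with smooth coefficients is smooth. -/
theorem contMDiffAt_of_linear_system {m : ℕ} {A : Fin m → Fin m → M → ℝ} {b c : Fin m → M → ℝ}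
    (hA : ∀ i j, SmoothFn I (A i j)) (hb : ∀ i, SmoothFn I (b i))
    (hdet : (Matrix.of fun i j => A i j p).det ≠ 0)
    (h : ∀ᶠ q in 𝓝 p, ∀ i, ∑ j, A i j q * c j q = b i q) (j : Fin m) :
    ∀ᶠ q in 𝓝 p, ContMDiffAt I 𝓘(ℝ, ℝ) ∞ (c j) q := by
  have hdet' : ∀ B : Fin m → Fin m → M → ℝ, (∀ i j, SmoothFn I (B i j)) →
      SmoothFn I (fun q => (Matrix.of fun i j => B i j q).det) := by
    intro B hB
    simp only [Matrix.det_apply, Units.smul_def, zsmul_eq_mul, Matrix.of_apply]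
    exact contMDiff_finsetSum fun σ _ => contMDiff_const.mul
      (contMDiff_finsetProd fun i _ => hB _ _)
  have hD := hdet' A hA
  have hN := hdet' (fun i l => if l = j then b i else A i l) (by
    intro i l
    split_ifs
    exacts [hb i, hA i l])
  have hne : ∀ᶠ q in 𝓝 p, (Matrix.of fun i j => A i j q).det ≠ 0 :=
    hD.continuous.continuousAt.eventually_ne hdet
  filter_upwards [hne.eventually_nhds, h.eventually_nhds] with q hq hq'
  -- Cramer's rule: `c j` is the determinant with column `j` replaced by `b`, divided by the
  -- determinant of `A`.
  refine ((hN q).mul ((hD q).inv₀ hq.self_of_nhds)).congr_of_eventuallyEq ?_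
  filter_upwards [hq, hq'] with r hr hr'
  have hv : (Matrix.of fun i j => A i j r).mulVec (fun l => c l r) = fun i => b i r := by
    ext i
    exact hr' i
  have h2 : (Matrix.of fun i j => A i j r).cramer (fun i => b i r) j =
      (Matrix.of fun i j => A i j r).det * c j r := by
    rw [Matrix.cramer_eq_adjugate_mulVec, ← hv, Matrix.mulVec_mulVec, Matrix.adjugate_mul]
    simp [Matrix.smul_mulVec]
  have h3 : (Matrix.of fun i l => (if l = j then b i else A i l) r).det =
      (Matrix.of fun i j => A i j r).det * c j r := by
    rw [← h2, Matrix.cramer_apply]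
    congr 1
    ext i l
    simp only [Matrix.of_apply, Matrix.updateCol_apply]
    split_ifs <;> rfl
  simp only [Pi.mul_apply]
  rw [h3]
  field_simp

variable [CompleteSpace E] [I.Boundaryless]

/-- The Lie bracket of vector fields acts on functions as a commutator. -/
theorem lieD_mlieBracket (hX : SmoothVF I X) (hY : SmoothVF I Y) (hf : SmoothFn I f) (p : M) :
    lieD I (VectorField.mlieBracket I X Y) f p =
      lieD I X (lieD I Y f) p - lieD I Y (lieD I X f) p := by
  set φ := extChartAt I p with hφ
  set y := φ p with hy
  let F : E → ℝ := f ∘ φ.symm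
  let V (Z : Π p : M, TangentSpace I p) : E → E :=
    VectorField.mpullbackWithin 𝓘(ℝ, E) I φ.symm Z (range I)
  have hnb : φ.target ∈ 𝓝 y := extChartAt_target_mem_nhds (I := I) p
  have key : ∀ (g : M → ℝ), SmoothFn I g → ∀ Z : Π p : M, TangentSpace I p, ∀ z ∈ φ.target,
      fderiv ℝ (g ∘ φ.symm) z (V Z z) = lieD I Z g (φ.symm z) := by
    intro g hg Z z hz
    have hinv := isInvertible_mfderivWithin_extChartAt_symm (I := I) hz
    have hd : MDifferentiableWithinAt 𝓘(ℝ, E) I φ.symm (range I) z :=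
      (contMDiffWithinAt_extChartAt_symm_range (n := ∞) p hz).mdifferentiableWithinAt (by simp)
    have h1 := mfderivWithin_comp z (I := 𝓘(ℝ, E)) (I' := I) (I'' := 𝓘(ℝ, ℝ)) (s := range I)
      (u := univ) ((hg.mdiff (φ.symm z)).mdifferentiableWithinAt) hd (subset_univ _)
      (I.uniqueMDiffOn z (by rw [I.range_eq_univ]; trivial))
    obtain ⟨B, hB⟩ := hinv
    simp only [lieD, V, VectorField.mpullbackWithin_apply]
    rw [← hB]
    rw [← hB, mfderivWithin_univ, I.range_eq_univ, mfderivWithin_univ, mfderiv_eq_fderiv] at h1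
    have h2 : fderiv ℝ (g ∘ φ.symm) z = (mfderiv I 𝓘(ℝ, ℝ) g (φ.symm z)).comp
      (B : TangentSpace 𝓘(ℝ, E) z →L[ℝ] TangentSpace I (φ.symm z)) := h1
    rw [h2, ContinuousLinearMap.inverse_equiv]
    change mfderiv I 𝓘(ℝ, ℝ) g (φ.symm z) (B (B.symm _)) = _
    rw [B.apply_symm_apply]
    rfl
  have hFs : ∀ (g : M → ℝ), SmoothFn I g → ContDiffAt ℝ ∞ (g ∘ φ.symm) y := by
    intro g hg
    have h1 : ContMDiffWithinAt 𝓘(ℝ, E) I ∞ φ.symm (range I) y :=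
      contMDiffWithinAt_extChartAt_symm_range p (mem_extChartAt_target p)
    rw [I.range_eq_univ, contMDiffWithinAt_univ] at h1
    exact (ContMDiffAt.comp y (hg _) h1).contDiffAt
  have hV : ∀ Z : Π p : M, TangentSpace I p, SmoothVF I Z → DifferentiableAt ℝ (V Z) y := by
    intro Z hZ
    have := (hZ.mdiff p).mdifferentiableWithinAt (s := univ)
    have h1 := this.differentiableWithinAt_mpullbackWithin_vectorField
    rw [preimage_univ, univ_inter, I.range_eq_univ] at h1
    simp only [V, I.range_eq_univ]
    exact h1.differentiableAt Filter.univ_mem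
  have hVp : ∀ Z : Π p : M, TangentSpace I p, ∀ g, SmoothFn I g →
      fderiv ℝ (g ∘ φ.symm) y (V Z y) = lieD I Z g p := by
    intro Z g hg
    rw [key g hg Z y (mem_extChartAt_target p)]
    simp [hy, hφ]
  -- In the chart, an iterated derivative is a Hessian term plus a term with the derivative of the
  -- inner field. In the commutator the Hessian terms cancel by symmetry, and the rest is the
  -- bracket of the fields in the chart.
  have hLL : ∀ Z Z' : Π p : M, TangentSpace I p, SmoothVF I Z → SmoothVF I Z' →
      lieD I Z (lieD I Z' f) p = fderiv ℝ (fderiv ℝ F) y (V Z y) (V Z' y) +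
        fderiv ℝ F y (fderiv ℝ (V Z') y (V Z y)) := by
    intro Z Z' hZ hZ'
    rw [← hVp Z _ (hZ'.lieD hf)]
    have h1 : (lieD I Z' f ∘ φ.symm) =ᶠ[𝓝 y] fun z => fderiv ℝ F z (V Z' z) := by
      filter_upwards [hnb] with z hz
      exact (key f hf Z' z hz).symm
    rw [h1.fderiv_eq]
    have h2 : DifferentiableAt ℝ (fderiv ℝ F) y :=
      ((hFs f hf).fderiv_right (m := 1) (by norm_cast)).differentiableAt (by simp)
    rw [fderiv_clm_apply h2 (hV Z' hZ')]
    simp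
    ring
  have hsymm : IsSymmSndFDerivAt ℝ F y := (hFs f hf).isSymmSndFDerivAt (by
    rw [minSmoothness_of_isRCLikeNormedField]; exact WithTop.coe_le_coe.2 le_top)
  rw [hLL X Y hX hY, hLL Y X hY hX, hsymm (V X y) (V Y y)]
  have hd : MDifferentiableAt I 𝓘(ℝ, E) φ p :=
    (contMDiffAt_extChartAt (n := ∞)).mdifferentiableAt (by simp)
  have hinv := isInvertible_mfderiv_extChartAt (I := I) (mem_extChartAt_source (I := I) p)
  have hfd : ∀ v : TangentSpace I p, mvfderiv I f p v = fderiv ℝ F y (mfderiv I 𝓘(ℝ, E) φ p v) := by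
    intro v
    have h1 : f =ᶠ[𝓝 p] F ∘ φ := by
      filter_upwards [extChartAt_source_mem_nhds (I := I) p] with q hq
      simp only [F, Function.comp_apply, hφ]
      rw [(extChartAt I p).left_inv hq]
    have h2 : MDifferentiableAt 𝓘(ℝ, E) 𝓘(ℝ, ℝ) F (φ p) :=
      ((hFs f hf).differentiableAt (by simp)).mdifferentiableAt
    have h3 : mvfderiv I f p v = mvfderiv I (F ∘ φ) p v := lieD_congr (X := fun _ => v) h1
    rw [h3, mvfderiv_comp_apply p h2 hd]
    simp only [mvfderiv, mfderiv_eq_fderiv]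
    rfl
  simp only [lieD]
  rw [← VectorField.mlieBracketWithin_univ, VectorField.mlieBracketWithin_apply, hfd]
  obtain ⟨B, hB⟩ := hinv
  rw [← hB, ContinuousLinearMap.inverse_equiv]
  have h4 : ∀ w, B (B.symm w) = w := B.apply_symm_apply
  trans fderiv ℝ F y (VectorField.lieBracket ℝ (V X) (V Y) y)
  · congr 1
    refine (h4 _).trans ?_
    rw [preimage_univ, univ_inter]
    exact (congrArg (fun s => VectorField.lieBracketWithin ℝ (V X) (V Y) s y)
      I.range_eq_univ).trans (congrFun VectorField.lieBracketWithin_univ y)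
  · rw [VectorField.lieBracket, map_sub]
    ring

end VectorFields

/-! ### Tensoriality: maps that are linear over smooth functions are local or pointwise. -/

section Tensors

variable {E : Type*} [NormedAddCommGroup E] [NormedSpace ℝ E] {H : Type*} [TopologicalSpace H]
  {I : ModelWithCorners ℝ E H} {M : Type*} [TopologicalSpace M] [ChartedSpace H M]
  {p : M} {f g : M → ℝ} {X Y W : Π p : M, TangentSpace I p}
  {P : (Π p : M, TangentSpace I p) → Prop} {Φ : (Π p : M, TangentSpace I p) → ℝ}

/-- The vector fields with the property `P` form a module over the smooth functions. -/
structure IsVFModule (P : (Π p : M, TangentSpace I p) → Prop) : Prop where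
  zero : P fun _ => 0
  add : ∀ {X Y}, P X → P Y → P fun q => X q + Y q
  smul : ∀ {f X}, SmoothFn I f → P X → P fun q => f q • X q

/-- `Φ` is linear over the smooth functions, which act on `ℝ` by evaluation at `p`. -/
structure IsTensorialAt (P : (Π p : M, TangentSpace I p) → Prop)
    (Φ : (Π p : M, TangentSpace I p) → ℝ) (p : M) : Prop where
  add : ∀ {X Y}, P X → P Y → Φ (fun q => X q + Y q) = Φ X + Φ Y
  smul : ∀ {f X}, SmoothFn I f → P X → Φ (fun q => f q • X q) = f p * Φ X

theorem IsVFModule.neg (hP : IsVFModule P) (hX : P X) : P fun q => - X q := by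
  simpa using hP.smul (f := fun _ => -1) contMDiff_const hX

theorem IsVFModule.sub (hP : IsVFModule P) (hX : P X) (hY : P Y) : P fun q => X q - Y q := by
  simpa [sub_eq_add_neg] using hP.add hX (hP.neg hY)

theorem IsVFModule.sum (hP : IsVFModule P) {ι : Type*} (s : Finset ι)
    {V : ι → Π p : M, TangentSpace I p} (hV : ∀ i ∈ s, P (V i)) : P fun q => ∑ i ∈ s, V i q := by
  classical
  induction s using Finset.induction_on with
  | empty => simpa using hP.zero
  | insert a s ha ih =>
    simp only [Finset.sum_insert ha]
    exact hP.add (hV a (by simp)) (ih fun i hi => hV i (by simp [hi]))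

theorem IsTensorialAt.zero (hΦ : IsTensorialAt P Φ p) (hP : IsVFModule P) :
    Φ (fun _ => 0) = 0 := by
  simpa using hΦ.smul (f := fun _ => 0) contMDiff_const hP.zero

theorem IsTensorialAt.neg (hΦ : IsTensorialAt P Φ p) (hX : P X) :
    Φ (fun q => - X q) = - Φ X := by
  simpa using hΦ.smul (f := fun _ => -1) contMDiff_const hX

theorem IsTensorialAt.sub (hΦ : IsTensorialAt P Φ p) (hP : IsVFModule P) (hX : P X) (hY : P Y) :
    Φ (fun q => X q - Y q) = Φ X - Φ Y := by
  simpa [sub_eq_add_neg, hΦ.neg hY] using hΦ.add hX (hP.neg hY)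

theorem IsTensorialAt.sum (hΦ : IsTensorialAt P Φ p) (hP : IsVFModule P) {ι : Type*}
    (s : Finset ι) {V : ι → Π p : M, TangentSpace I p} (hV : ∀ i ∈ s, P (V i)) :
    Φ (fun q => ∑ i ∈ s, V i q) = ∑ i ∈ s, Φ (V i) := by
  classical
  induction s using Finset.induction_on with
  | empty => simpa using hΦ.zero hP
  | insert a s ha ih =>
    simp only [Finset.sum_insert ha]
    rw [hΦ.add (hV a (by simp)) (hP.sum s fun i hi => hV i (by simp [hi])),
      ih fun i hi => hV i (by simp [hi])]

variable [IsManifold I ∞ M]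

theorem isVFModule_smoothVF : IsVFModule (SmoothVF I (M := M)) where
  zero := SmoothVF.zero
  add := SmoothVF.add
  smul := SmoothVF.smul

variable [FiniteDimensional ℝ E] [T2Space M]

/-- For a cutoff `χ` supported where `X` vanishes, `X = (1 - χ) X`, and `1 - χ` vanishes at `p`. -/
theorem IsTensorialAt.eq_zero_of_eventually (hΦ : IsTensorialAt P Φ p) (hX : P X)
    (h : ∀ᶠ q in 𝓝 p, X q = 0) : Φ X = 0 := by
  obtain ⟨χ, hχ, h1, hs⟩ := exists_cutoff (I := I) h
  have h2 : X = fun q => (1 - χ q) • X q := by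
    funext q
    by_cases hq : q ∈ tsupport χ
    · rw [show X q = 0 from hs hq, smul_zero]
    · rw [image_eq_zero_of_notMem_tsupport hq, sub_zero, one_smul]
  rw [h2, hΦ.smul (f := fun q => 1 - χ q) (contMDiff_const.sub hχ) hX, h1.self_of_nhds]
  simp

theorem IsTensorialAt.congr_of_eventually (hΦ : IsTensorialAt P Φ p) (hP : IsVFModule P)
    (hX : P X) (hY : P Y) (h : ∀ᶠ q in 𝓝 p, X q = Y q) : Φ X = Φ Y := by
  rw [← sub_eq_zero, ← hΦ.sub hP hX hY]
  refine hΦ.eq_zero_of_eventually (hP.sub hX hY) ?_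
  filter_upwards [h] with q hq
  rw [hq, sub_self]

/-- Stated for an arbitrary module of fields because it serves twice: for all smooth fields, where a
frame always exists, and for `b^k`-sections, where the generators `V` must themselves be sections.
-/
theorem IsTensorialAt.eq_zero_of_lincomb (hΦ : IsTensorialAt P Φ p) (hP : IsVFModule P)
    (hX : P X) {m : ℕ} {V : Fin m → Π p : M, TangentSpace I p} (hV : ∀ i, P (V i))
    {c : Fin m → M → ℝ} (hc : ∀ i, SmoothFn I (c i)) (h0 : ∀ i, c i p = 0)
    (h : ∀ᶠ q in 𝓝 p, X q = ∑ i, c i q • V i q) : Φ X = 0 := by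
  rw [hΦ.congr_of_eventually hP hX (hP.sum _ fun i _ => hP.smul (hc i) (hV i)) h,
    hΦ.sum hP _ fun i _ => hP.smul (hc i) (hV i)]
  refine Finset.sum_eq_zero fun i _ => ?_
  rw [hΦ.smul (hc i) (hV i), h0 i, zero_mul]

theorem IsTensorialAt.eq_zero (hΦ : IsTensorialAt (SmoothVF I) Φ p) (hX : SmoothVF I X)
    (h : X p = 0) : Φ X = 0 := by
  obtain ⟨m, V, hV, -, hc⟩ := exists_frame (I := I) p
  obtain ⟨c, h1, h2, h3⟩ := hc X
  exact hΦ.eq_zero_of_lincomb isVFModule_smoothVF hX hV (h3 hX) (h2 h) h1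

theorem IsTensorialAt.congr (hΦ : IsTensorialAt (SmoothVF I) Φ p) (hX : SmoothVF I X)
    (hY : SmoothVF I Y) (h : X p = Y p) : Φ X = Φ Y := by
  rw [← sub_eq_zero, ← hΦ.sub isVFModule_smoothVF hX hY]
  exact hΦ.eq_zero (hX.sub hY) (by simp [h])

/-- A bilinear form on the tangent space which represents a tensor. -/
theorem exists_bilin_of_tensorial {τ : (Π p : M, TangentSpace I p) → (Π p : M, TangentSpace I p) → ℝ}
    (h1 : ∀ Y, SmoothVF I Y → IsTensorialAt (SmoothVF I) (fun X => τ X Y) p)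
    (h2 : ∀ X, SmoothVF I X → IsTensorialAt (SmoothVF I) (τ X) p) :
    ∃ B : TangentSpace I p →ₗ[ℝ] TangentSpace I p →ₗ[ℝ] ℝ,
      ∀ X Y, SmoothVF I X → SmoothVF I Y → τ X Y = B (X p) (Y p) := by
  choose V hV hVp using fun v => exists_smoothVF_apply_eq (I := I) (p := p) v
  have hc : ∀ X Y X' Y', SmoothVF I X → SmoothVF I Y → SmoothVF I X' → SmoothVF I Y' →
      X p = X' p → Y p = Y' p → τ X Y = τ X' Y' := by
    intro X Y X' Y' hX hY hX' hY' e1 e2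
    rw [(h2 X hX).congr hY hY' e2]
    exact (h1 Y' hY').congr hX hX' e1
  refine ⟨LinearMap.mk₂ ℝ (fun v w => τ (V v) (V w)) ?_ ?_ ?_ ?_, ?_⟩
  · intro v v' w
    rw [← (h1 _ (hV w)).add (hV v) (hV v')]
    exact hc _ _ _ _ (hV _) (hV _) ((hV _).add (hV _)) (hV _) (by simp [hVp]) rfl
  · intro a v w
    rw [smul_eq_mul, ← (h1 _ (hV w)).smul (f := fun _ => a) contMDiff_const (hV v)]
    exact hc _ _ _ _ (hV _) (hV _) (SmoothVF.smul contMDiff_const (hV _)) (hV _)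
      (by simp [hVp]) rfl
  · intro v w w'
    rw [← (h2 _ (hV v)).add (hV w) (hV w')]
    exact hc _ _ _ _ (hV _) (hV _) (hV _) ((hV _).add (hV _)) rfl (by simp [hVp])
  · intro a v w
    rw [smul_eq_mul, ← (h2 _ (hV v)).smul (f := fun _ => a) contMDiff_const (hV w)]
    exact hc _ _ _ _ (hV _) (hV _) (hV _) (SmoothVF.smul contMDiff_const (hV _)) rfl
      (by simp [hVp])
  · intro X Y hX hY
    simp only [LinearMap.mk₂_apply]
    exact hc _ _ _ _ hX hY (hV _) (hV _) (hVp _).symm (hVp _).symm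

/-- Tangent vectors are determined by the derivatives of the smooth functions. -/
theorem tangent_eq_of_forall_mvfderiv {v w : TangentSpace I p}
    (h : ∀ f : M → ℝ, SmoothFn I f → mvfderiv I f p v = mvfderiv I f p w) : v = w := by
  by_contra hne
  obtain ⟨ξ, hξ⟩ := SeparatingDual.exists_separating_of_ne (R := ℝ) (V := E) hne
  obtain ⟨f, hf, hfξ⟩ := exists_smoothFn_mvfderiv_eq (I := I) (p := p) ξ
  have := h f hf
  rw [hfξ] at this
  exact hξ this

end Tensors

/-! ### The exterior derivative of 1-forms. -/

section ExteriorDerivative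

variable {E : Type*} [NormedAddCommGroup E] [NormedSpace ℝ E] {H : Type*} [TopologicalSpace H]
  {I : ModelWithCorners ℝ E H} {M : Type*} [TopologicalSpace M] [ChartedSpace H M]
  [IsManifold I ∞ M]
  {p : M} {f g : M → ℝ} {X Y W : Π p : M, TangentSpace I p} {b b' : OneForm I M}

theorem SmoothFormOn.apply (hb : SmoothFormOn I b univ) (hX : SmoothVF I X) :
    SmoothFn I (fun q => b q (X q)) :=
  contMDiffOn_univ.1 (hb X hX)

theorem SmoothFormOn.smul {U : Set M} (hf : ContMDiffOn I 𝓘(ℝ, ℝ) ∞ f U)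
    (hb : SmoothFormOn I b univ) : SmoothFormOn I (fun q => f q • b q) U := fun _ hX =>
  ContMDiffOn.mul hf (hb.apply hX).contMDiffOn

theorem SmoothFormOn.sub {U : Set M} (hb : SmoothFormOn I b U)
    (hb' : SmoothFormOn I b' U) : SmoothFormOn I (fun q => b q - b' q) U := fun X hX =>
  ContMDiffOn.sub (hb X hX) (hb' X hX)

theorem smoothFormOn_mvfderiv (hf : SmoothFn I f) {U : Set M} : SmoothFormOn I (mvfderiv I f) U :=
  fun _ hX => (hX.lieD hf).contMDiffOn

theorem extD_swap : extD I b X Y p = - extD I b Y X p := by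
  simp only [extD]
  rw [VectorField.mlieBracket_swap_apply, map_neg]
  ring

theorem extD_smul (hf : MDifferentiableAt I 𝓘(ℝ, ℝ) f p) (hb : SmoothFormOn I b univ)
    (hX : SmoothVF I X) (hY : SmoothVF I Y) :
    extD I (fun q => f q • b q) X Y p =
      f p * extD I b X Y p + (lieD I X f p * b p (Y p) - lieD I Y f p * b p (X p)) := by
  have h1 := lieD_mul (X := X) hf ((hb.apply hY).mdiff p)
  have h2 := lieD_mul (X := Y) hf ((hb.apply hX).mdiff p)
  simp only [extD, smul_apply, smul_eq_mul]
  rw [h1, h2]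
  ring

theorem extD_sub (hb : SmoothFormOn I b univ) (hb' : SmoothFormOn I b' univ)
    (hX : SmoothVF I X) (hY : SmoothVF I Y) :
    extD I (fun q => b q - b' q) X Y p = extD I b X Y p - extD I b' X Y p := by
  have h1 := lieD_sub (X := X) ((hb.apply hY).mdiff p) ((hb'.apply hY).mdiff p)
  have h2 := lieD_sub (X := Y) ((hb.apply hX).mdiff p) ((hb'.apply hX).mdiff p)
  simp only [extD, sub_apply]
  rw [h1, h2]
  ring

variable [CompleteSpace E]

/-- The derivative of `f` in `Y(f b(X))` cancels against the one in `[f X, Y] = f [X, Y] - (Y f) X`.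
-/
theorem isTensorialAt_extD_left (hb : SmoothFormOn I b univ) :
    IsTensorialAt (SmoothVF I) (fun X => extD I b X Y p) p where
  add {X X'} hX hX' := by
    have h1 := lieD_add (X := Y) ((hb.apply hX).mdiff p) ((hb.apply hX').mdiff p)
    have h2 := VectorField.mlieBracket_add_left (W := Y) (hX.mdiff p) (hX'.mdiff p)
    have h3 : VectorField.mlieBracket I (fun q => X q + X' q) Y p = _ := h2
    simp only [extD, map_add]
    rw [lieD_add_left, h1, h3, map_add]
    ring
  smul {f X} hf hX := by
    have h1 := lieD_mul (X := Y) (hf.mdiff p) ((hb.apply hX).mdiff p)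
    have h2 := VectorField.mlieBracket_smul_left (W := Y) (hf.mdiff p) (hX.mdiff p)
    have h3 : VectorField.mlieBracket I (fun q => f q • X q) Y p = _ := h2
    simp only [extD, map_smul, smul_eq_mul]
    rw [lieD_smul_left, h1, h3, map_add, map_smul, map_smul]
    simp only [lieD, smul_eq_mul]
    ring

theorem isTensorialAt_extD_right (hb : SmoothFormOn I b univ) :
    IsTensorialAt (SmoothVF I) (fun Y => extD I b X Y p) p where
  add {Y Y'} hY hY' := by
    rw [extD_swap, (isTensorialAt_extD_left hb).add hY hY', extD_swap (X := Y),
      extD_swap (X := Y')]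
    ring
  smul {f Y} hf hY := by
    rw [extD_swap, (isTensorialAt_extD_left hb).smul hf hY, extD_swap (X := Y)]
    ring

/-- The exterior derivative of a smooth 1-form at a point, as a bilinear form. -/
theorem exists_extD_bilin [FiniteDimensional ℝ E] [T2Space M] (hb : SmoothFormOn I b univ)
    (p : M) : ∃ B : TangentSpace I p →ₗ[ℝ] TangentSpace I p →ₗ[ℝ] ℝ,
      (∀ X Y, SmoothVF I X → SmoothVF I Y → extD I b X Y p = B (X p) (Y p)) ∧
      ∀ v w, B v w = - B w v := by
  obtain ⟨B, hB⟩ := exists_bilin_of_tensorial (τ := fun X Y => extD I b X Y p)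
    (fun Y _ => isTensorialAt_extD_left hb) (fun X _ => isTensorialAt_extD_right hb)
  refine ⟨B, hB, fun v w => ?_⟩
  obtain ⟨V, hV, rfl⟩ := exists_smoothVF_apply_eq (I := I) v
  obtain ⟨W, hW, rfl⟩ := exists_smoothVF_apply_eq (I := I) w
  rw [← hB V W hV hW, ← hB W V hW hV, extD_swap]

theorem smoothFn_extD (hb : SmoothFormOn I b univ) (hX : SmoothVF I X) (hY : SmoothVF I Y) :
    SmoothFn I (extD I b X Y) :=
  ((hX.lieD (hb.apply hY)).sub (hY.lieD (hb.apply hX))).sub (hb.apply (hX.mlieBracket hY))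

variable [FiniteDimensional ℝ E] [T2Space M] [I.Boundaryless]

theorem extD_mvfderiv (hf : SmoothFn I f) (hX : SmoothVF I X) (hY : SmoothVF I Y) :
    extD I (mvfderiv I f) X Y p = 0 := by
  have := lieD_mlieBracket hX hY hf p
  change lieD I X (lieD I Y f) p - lieD I Y (lieD I X f) p -
    lieD I (VectorField.mlieBracket I X Y) f p = 0
  linarith

/-- Second derivatives combine to brackets by `lieD_mlieBracket`, and the double brackets that
remain cancel by the Jacobi identity. -/
theorem extD₂_extD (hb : SmoothFormOn I b univ) (hX : SmoothVF I X) (hY : SmoothVF I Y)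
    (hW : SmoothVF I W) : extD₂ I (extD I b) X Y W p = 0 := by
  have hs : ∀ {X Y Z : Π p : M, TangentSpace I p}, SmoothVF I X → SmoothVF I Y → SmoothVF I Z →
      lieD I X (extD I b Y Z) p = lieD I X (lieD I Y (fun q => b q (Z q))) p -
        lieD I X (lieD I Z (fun q => b q (Y q))) p -
        lieD I X (fun q => b q (VectorField.mlieBracket I Y Z q)) p := by
    intro X Y Z hX hY hZ
    have h1 := (hY.lieD (hb.apply hZ)).mdiff p
    have h2 := (hZ.lieD (hb.apply hY)).mdiff p
    have h3 := (hb.apply (hY.mlieBracket hZ)).mdiff p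
    have h4 := lieD_sub (X := X) (h1.sub h2) h3
    have h5 := lieD_sub (X := X) h1 h2
    exact h4.trans (by rw [← h5]; rfl)
  simp only [extD₂]
  rw [hs hX hY hW, hs hY hX hW, hs hW hX hY]
  have e1 := lieD_mlieBracket hX hY (hb.apply hW) p
  have e2 := lieD_mlieBracket hX hW (hb.apply hY) p
  have e3 := lieD_mlieBracket hY hW (hb.apply hX) p
  have j : b p (VectorField.mlieBracket I X (VectorField.mlieBracket I Y W) p) = _ :=
    congrArg (b p) (by
      have : IsManifold I (minSmoothness ℝ 3) M := by
        rw [minSmoothness_of_isRCLikeNormedField]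
        exact IsManifold.of_le (n := ∞) (WithTop.coe_le_coe.2 le_top)
      have h2 : minSmoothness ℝ 2 ≤ (∞ : ℕ∞ω) := by
        rw [minSmoothness_of_isRCLikeNormedField]; exact WithTop.coe_le_coe.2 le_top
      exact VectorField.leibniz_identity_mlieBracket_apply ((hX p).of_le h2) ((hY p).of_le h2)
        ((hW p).of_le h2))
  rw [map_add] at j
  have s1 := congrArg (b p) (VectorField.mlieBracket_swap_apply (I := I)
    (V := VectorField.mlieBracket I X W) (W := Y) (x := p))
  have s2 := congrArg (b p) (VectorField.mlieBracket_swap_apply (I := I)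
    (V := VectorField.mlieBracket I Y W) (W := X) (x := p))
  rw [map_neg] at s1 s2
  simp only [extD]
  linarith

end ExteriorDerivative

/-! ### Linear algebra of contact forms -/

section LinearAlgebra

variable {V : Type*} [AddCommGroup V] [Module ℝ V] {u : ℝ} {b μ : V →ₗ[ℝ] ℝ}
  {B : V →ₗ[ℝ] V →ₗ[ℝ] ℝ}

/-- The 1-form `u dt + b` and the 2-form `μ ∧ dt + B` on `ℝ × V` satisfy the contact condition. -/
structure IsContactPair (u : ℝ) (b μ : V →ₗ[ℝ] ℝ) (B : V →ₗ[ℝ] V →ₗ[ℝ] ℝ) : Prop where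
  alt : ∀ v w, B v w = - B w v
  ne_zero : u = 0 → ∃ w, b w ≠ 0
  nondeg : ∀ h w, u * h + b w = 0 →
    (∀ h' w', u * h' + b w' = 0 → μ w * h' - μ w' * h + B w w' = 0) → h = 0 ∧ w = 0

theorem exists_proportional {b μ : V →ₗ[ℝ] ℝ} (h : ∀ w, b w = 0 → μ w = 0) :
    ∃ c : ℝ, ∀ w, μ w = c * b w := by
  by_cases hb : ∃ w, b w ≠ 0
  · obtain ⟨w₀, hw₀⟩ := hb
    refine ⟨μ w₀ / b w₀, fun w => ?_⟩
    have := h (w - (b w / b w₀) • w₀) (by simp; field_simp; ring)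
    simp at this
    field_simp
    field_simp at this
    linarith
  · push Not at hb
    exact ⟨0, fun w => by rw [h w (hb w)]; simp⟩

/-- A functional which is known on `ker b ∩ ker μ` is known on `ker b` up to a multiple of `μ`. -/
theorem exists_multiplier {b μ l : V →ₗ[ℝ] ℝ} (h : ∀ w, μ w = 0 → b w = 0 → l w = 0) :
    ∃ c : ℝ, ∀ w, b w = 0 → l w = c * μ w := by
  obtain ⟨c, hc⟩ := exists_proportional (b := μ.comp (LinearMap.ker b).subtype)
    (μ := l.comp (LinearMap.ker b).subtype) (fun w hw => h w hw w.2)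
  exact ⟨c, fun w hw => hc ⟨w, hw⟩⟩

namespace IsContactPair

theorem self (h : IsContactPair u b μ B) (w : V) : B w w = 0 := by
  have := h.alt w w
  linarith

/-- Otherwise `(1, 0)`, which lies in the kernel of the 1-form since `u = 0`, would be orthogonal to
that whole kernel. This is the transversality of `u`, even along `ker β`. -/
theorem exists_ker_ne (h : IsContactPair u b μ B) (hu : u = 0) : ∃ w, b w = 0 ∧ μ w ≠ 0 := by
  by_contra hn
  push Not at hn
  have := h.nondeg 1 0 (by simp [hu]) (fun h' w' hw' => by
    simp [hn w' (by simpa [hu] using hw')])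
  exact one_ne_zero this.1

theorem exists_ne (h : IsContactPair u b μ B) (hu : u = 0) : ∃ w, μ w = 0 ∧ b w ≠ 0 := by
  obtain ⟨w₁, hw₁, hw₁'⟩ := h.exists_ker_ne hu
  obtain ⟨w₂, hw₂⟩ := h.ne_zero hu
  refine ⟨w₂ - (μ w₂ / μ w₁) • w₁, by simp; field_simp; ring, by simpa [hw₁] using hw₂⟩

/-- The functional `B w` is a multiple `c μ` of `μ` on `ker b`. The vector `(c, w)` is then
orthogonal to the kernel of the 1-form, hence zero. -/
theorem contact (h : IsContactPair u b μ B) (hu : u = 0) {w : V} (hμ : μ w = 0) (hb : b w = 0)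
    (hB : ∀ w', μ w' = 0 → b w' = 0 → B w w' = 0) : w = 0 := by
  obtain ⟨c, hc⟩ := exists_multiplier (l := B w) hB
  refine (h.nondeg c w (by simp [hu, hb]) fun h' w' hw' => ?_).2
  rw [hc w' (by simpa [hu] using hw'), hμ]
  ring

/-- For `u ≠ 0` the kernel of the 1-form is the graph `h = -u⁻¹ b(w)`, and the 2-form restricted to
it is `B + u⁻¹ b ∧ μ`. -/
theorem symplectic (h : IsContactPair u b μ B) (hu : u ≠ 0) {w : V}
    (hw : ∀ w', B w w' + u⁻¹ * (b w * μ w' - b w' * μ w) = 0) : w = 0 := by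
  refine (h.nondeg (- u⁻¹ * b w) w (by field_simp; ring) fun h' w' hw' => ?_).2
  have h1 : h' = - u⁻¹ * b w' := by field_simp; linarith
  rw [← hw w', h1]
  ring

/-- Changing the splitting of the fibre. -/
theorem change_splitting (h : IsContactPair u b μ B) {c : ℝ} (hc : c ≠ 0) (γ : V →ₗ[ℝ] ℝ)
    {u' : ℝ} {b' μ' : V →ₗ[ℝ] ℝ} {B' : V →ₗ[ℝ] V →ₗ[ℝ] ℝ} (hu' : u = c * u')
    (hb' : ∀ w, b' w = b w - u' * γ w) (hμ' : ∀ w, μ w = c * μ' w)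
    (hB' : ∀ v w, B' v w = B v w - (μ' v * γ w - μ' w * γ v)) :
    IsContactPair u' b' μ' B' where
  alt v w := by rw [hB', hB', h.alt]; ring
  ne_zero hu := by
    obtain ⟨w, hw⟩ := h.ne_zero (by simp [hu', hu])
    exact ⟨w, by simpa [hb', hu] using hw⟩
  nondeg t w ht hw := by
    -- The new coordinate is `s = c h + γ w`. Inverting this gives the substitution under which the
    -- two 1-forms, and then the two 2-forms, correspond.
    have h1 : ∀ s w, u * ((s - γ w) / c) + b w = u' * s + b' w := by
      intro s w
      rw [hb', hu']
      field_simp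
      ring
    have := h.nondeg ((t - γ w) / c) w (by rw [h1, ht]) (fun h' w' hw' => by
      have h3 := h1 (c * h' + γ w') w'
      have h4 : (c * h' + γ w' - γ w') / c = h' := by field_simp; ring
      rw [h4] at h3
      rw [← hw (c * h' + γ w') w' (by rw [← h3, hw']), hB', hμ', hμ']
      field_simp
      ring)
    obtain ⟨h2, rfl⟩ := this
    refine ⟨?_, rfl⟩
    field_simp at h2
    simpa using h2

variable [FiniteDimensional ℝ V]

/-- The fibrewise nondegeneracy of the 2-form on the kernel of the 1-form gives representations of
functionals. -/
theorem exists_repr (h : IsContactPair u b μ B) (l : ℝ × V →ₗ[ℝ] ℝ) :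
    ∃ t w, u * t + b w = 0 ∧
      ∀ h' w', u * h' + b w' = 0 → μ w * h' - μ w' * t + B w w' = l (h', w') := by
  let a : ℝ × V →ₗ[ℝ] ℝ := u • LinearMap.fst ℝ ℝ V + b.comp (LinearMap.snd ℝ ℝ V)
  let Ω : ℝ × V →ₗ[ℝ] ℝ × V →ₗ[ℝ] ℝ := LinearMap.mk₂ ℝ
    (fun x y => μ x.2 * y.1 - μ y.2 * x.1 + B x.2 y.2)
    (by intros; simp; ring) (by intros; simp; ring) (by intros; simp; ring)
    (by intros; simp; ring)
  let K := LinearMap.ker a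
  let Φ : K →ₗ[ℝ] Module.Dual ℝ K := K.subtype.dualMap.comp (Ω.comp K.subtype)
  have hΦ : ∀ x y : K, Φ x y = μ x.1.2 * y.1.1 - μ y.1.2 * x.1.1 + B x.1.2 y.1.2 := fun _ _ => rfl
  have hinj : Function.Injective Φ := by
    rw [← LinearMap.ker_eq_bot, LinearMap.ker_eq_bot']
    rintro ⟨⟨t, w⟩, hx⟩ h0
    have := h.nondeg t w hx (fun h' w' hw' => by
      have := congrArg (fun F => F ⟨(h', w'), hw'⟩) h0
      simpa [hΦ] using this)
    ext
    · exact this.1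
    · exact this.2
  -- An injective map from the kernel to its dual is onto for reasons of dimension.
  have hsurj : Function.Surjective Φ :=
    (LinearMap.injective_iff_surjective_of_finrank_eq_finrank
      (Subspace.dual_finrank_eq (K := ℝ) (V := K)).symm).1 hinj
  obtain ⟨⟨⟨t, w⟩, hx⟩, he⟩ := hsurj (l.comp K.subtype)
  refine ⟨t, w, hx, fun h' w' hw' => ?_⟩
  have := congrArg (fun F => F ⟨(h', w'), hw'⟩) he
  simpa [hΦ] using this

/-- From any vector on which the 1-form is 1, subtract the kernel vector that represents its
contraction with the 2-form. The result is orthogonal to the kernel, and to itself by antisymmetry,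
hence to everything. -/
theorem exists_reeb (h : IsContactPair u b μ B) :
    ∃ t r, u * t + b r = 1 ∧ ∀ h' w', μ r * h' - μ w' * t + B r w' = 0 := by
  obtain ⟨t₀, r₀, h0⟩ : ∃ t r, u * t + b r = 1 := by
    by_cases hu : u = 0
    · obtain ⟨w, hw⟩ := h.ne_zero hu
      exact ⟨0, (b w)⁻¹ • w, by simp; field_simp⟩
    · exact ⟨u⁻¹, 0, by simp; field_simp⟩
  obtain ⟨t₁, r₁, h1, h2⟩ := h.exists_repr
    (μ r₀ • LinearMap.fst ℝ ℝ V + (B r₀ - t₀ • μ).comp (LinearMap.snd ℝ ℝ V))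
  have hker : ∀ h' w', u * h' + b w' = 0 →
      μ (r₀ - r₁) * h' - μ w' * (t₀ - t₁) + B (r₀ - r₁) w' = 0 := by
    intro h' w' hw'
    have := h2 h' w' hw'
    simp at this ⊢
    linarith
  have h01 : u * (t₀ - t₁) + b (r₀ - r₁) = 1 := by simp; linarith
  refine ⟨t₀ - t₁, r₀ - r₁, h01, fun h' w' => ?_⟩
  set s := u * h' + b w' with hs
  -- Subtracting the Reeb component `s` of `(h', w')` leaves a vector of the kernel.
  have h3 := hker (h' - s * (t₀ - t₁)) (w' - s • (r₀ - r₁)) (by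
    rw [map_sub, map_smul, smul_eq_mul]
    linear_combination - hs.symm - s * h01)
  have h4 := h.self (r₀ - r₁)
  generalize hr : r₀ - r₁ = r at *
  generalize t₀ - t₁ = t at *
  simp only [map_sub, map_smul, smul_eq_mul] at h3
  rw [h4] at h3
  linear_combination h3

/-- Representing `ξ` on the kernel fixes `(s, w)`. The identity extends to all vectors by splitting
off their Reeb component, which accounts for the correction `ξ r`. -/
theorem exists_sharp (h : IsContactPair u b μ B) {t : ℝ} {r : V} (h1 : u * t + b r = 1)
    (h2 : ∀ h' w', μ r * h' - μ w' * t + B r w' = 0) (ξ : V →ₗ[ℝ] ℝ) :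
    ∃ s w, u * s + b w = 0 ∧
      ∀ h' w', μ w * h' - μ w' * s + B w w' = ξ w' - ξ r * (u * h' + b w') := by
  obtain ⟨s, w, h3, h4⟩ := h.exists_repr (ξ.comp (LinearMap.snd ℝ ℝ V))
  refine ⟨s, w, h3, fun h' w' => ?_⟩
  set a := u * h' + b w' with ha
  have h5 := h4 (h' - a * t) (w' - a • r) (by
    rw [map_sub, map_smul, smul_eq_mul]
    linear_combination - ha.symm - a * h1)
  have h6 := h2 s w
  have h7 := h.alt r w
  simp only [map_sub, map_smul, smul_eq_mul, LinearMap.comp_apply, LinearMap.snd_apply] at h5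
  linear_combination h5 - a * h6 + a * h7

end IsContactPair

end LinearAlgebra

/-! ### Hadamard's lemma. -/

section Hadamard

variable {F : Type*} [NormedAddCommGroup F] [NormedSpace ℝ F]

-- The integral is the value at `0` of the convolution of the indicator of `(0, 1]` with `y ↦ χ(-y)
-- G x (-y)`. Smooth dependence on `x` thus follows from that of convolutions with parameters, for
-- which the bump function `χ` supplies the compact support.
open MeasureTheory in
theorem contDiff_integral_zero_one {G : F → ℝ → ℝ} (hG : ContDiff ℝ ∞ (fun q : F × ℝ => G q.1 q.2)) :
    ContDiff ℝ ∞ (fun x => ∫ t in (0 : ℝ)..1, G x t) := by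
  -- The inner radius only has to cover `(0, 1]`, so that `χ` does not affect the integral.
  let χ : ContDiffBump (0 : ℝ) := ⟨2, 3, by norm_num, by norm_num⟩
  let g : F → ℝ → ℝ := fun x y => χ (-y) * G x (-y)
  have hg : ContDiff ℝ ∞ (fun q : F × ℝ => g q.1 q.2) := by
    refine ((χ.contDiff (n := ⊤)).comp (contDiff_snd.neg)).mul ?_
    exact hG.comp (contDiff_fst.prodMk contDiff_snd.neg)
  have h := contDiffOn_convolution_right_with_param (𝕜 := ℝ) (n := ⊤)
    (ContinuousLinearMap.mul ℝ ℝ) (f := (Set.Ioc (0 : ℝ) 1).indicator fun _ => (1 : ℝ))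
    (μ := volume) (g := g) (s := (univ : Set F)) (k := Metric.closedBall (0 : ℝ) 3) isOpen_univ
    (isCompact_closedBall _ _) (by
      intro p x _ hx
      have : χ (-x) = 0 := χ.zero_of_le_dist (by
        rw [Metric.mem_closedBall, dist_zero_right, not_le] at hx
        rw [dist_zero_right, norm_neg]
        exact hx.le)
      simp [g, this])
    ((locallyIntegrable_const (1 : ℝ)).indicator measurableSet_Ioc) hg.contDiffOn
  rw [univ_prod_univ, contDiffOn_univ] at h
  have h2 := h.comp (contDiff_id.prodMk (contDiff_const (c := (0 : ℝ))))
  convert h2 using 1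
  funext x
  simp only [Function.comp_apply, id, convolution, ContinuousLinearMap.mul_apply', zero_sub, g,
    neg_neg]
  rw [intervalIntegral.integral_of_le zero_le_one, ← integral_indicator measurableSet_Ioc]
  refine integral_congr_ae (ae_of_all _ fun t => ?_)
  by_cases ht : t ∈ Set.Ioc (0 : ℝ) 1
  · have : χ t = 1 := χ.one_of_mem_closedBall (by
      simp only [Metric.mem_closedBall, dist_zero_right, Real.norm_eq_abs]
      change |t| ≤ 2
      rw [abs_of_pos ht.1]; linarith [ht.2])
    simp [ht, this]
  · simp [ht]

/-- Hadamard's lemma: a smooth function that vanishes for `t = 0` is divisible by `t`. -/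
theorem exists_contDiff_eq_mul {g : F × ℝ → ℝ} (hg : ContDiff ℝ ∞ g) (h0 : ∀ x, g (x, 0) = 0) :
    ∃ h : F × ℝ → ℝ, ContDiff ℝ ∞ h ∧ ∀ q, g q = q.2 * h q := by
  -- The quotient is `∫₀¹ ∂ₜg(x, s t) ds`, from integrating the derivative of `s ↦ g(x, s t)`.
  let G : F × ℝ → ℝ → ℝ := fun q s => fderiv ℝ g (q.1, s * q.2) (0, 1)
  refine ⟨fun q => ∫ s in (0 : ℝ)..1, G q s, contDiff_integral_zero_one ?_, fun q => ?_⟩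
  · have h1 : ContDiff ℝ ∞ (fderiv ℝ g) := hg.fderiv_right (by simp)
    have h2 : ContDiff ℝ ∞ (fun r : (F × ℝ) × ℝ => ((r.1.1, r.2 * r.1.2) : F × ℝ)) := by fun_prop
    exact (h1.comp h2).clm_apply contDiff_const
  · have hd : ∀ s : ℝ, HasDerivAt (fun s : ℝ => g (q.1, s * q.2)) (q.2 * G q s) s := by
      intro s
      have h1 : HasDerivAt (fun s : ℝ => ((q.1, s * q.2) : F × ℝ)) ((0 : F), q.2) s := by
        have := (hasDerivAt_id s).mul_const q.2
        simpa using (hasDerivAt_const s q.1).prodMk this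
      have h2 := ((hg.differentiable (by simp)) (q.1, s * q.2)).hasFDerivAt.comp_hasDerivAt s h1
      have h3 : ((0 : F), q.2) = q.2 • ((0 : F), (1 : ℝ)) := by simp
      rw [h3, map_smul, smul_eq_mul] at h2
      exact h2
    have hc : Continuous fun s : ℝ => q.2 * G q s := by
      have h1 : ContDiff ℝ ∞ (fderiv ℝ g) := hg.fderiv_right (by simp)
      have : Continuous (fun s : ℝ => fderiv ℝ g (q.1, s * q.2)) :=
        h1.continuous.comp (by fun_prop)
      exact continuous_const.mul (this.clm_apply continuous_const)
    have := intervalIntegral.integral_eq_sub_of_hasDerivAt (fun s _ => hd s)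
      (hc.intervalIntegrable 0 1)
    rw [intervalIntegral.integral_const_mul] at this
    rw [this]
    simp [h0]

end Hadamard

/-! ### Slice charts of hypersurfaces, local equations and divisibility. -/

section Slice

open Manifold

variable {E : Type*} [NormedAddCommGroup E] [NormedSpace ℝ E] {H : Type*} [TopologicalSpace H]
  {I : ModelWithCorners ℝ E H} {M : Type*} [TopologicalSpace M] [ChartedSpace H M]
  {E' : Type*} [NormedAddCommGroup E'] [NormedSpace ℝ E'] {H' : Type*} [TopologicalSpace H']
  {J : ModelWithCorners ℝ E' H'} {Z : Type*} [TopologicalSpace Z] [ChartedSpace H' Z]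
  {ι : Z → M}

/-- A slice chart of a hypersurface: the hypersurface is given by the vanishing of the last
coordinate, and there is a local retraction. -/
theorem exists_slice_chart [FiniteDimensional ℝ E] [FiniteDimensional ℝ E']
    [I.Boundaryless] [J.Boundaryless]
    (hdim : Module.finrank ℝ E = Module.finrank ℝ E' + 1)
    (hι : IsSmoothEmbedding J I ∞ ι) (x : Z) :
    ∃ (Ψ : M → E' × ℝ) (Θ : E' × ℝ → M) (S : Set M) (T : Set (E' × ℝ)), IsOpen S ∧ ι x ∈ S ∧
      IsOpen T ∧ ContMDiffOn I 𝓘(ℝ, E' × ℝ) ∞ Ψ S ∧ ContMDiffOn 𝓘(ℝ, E' × ℝ) I ∞ Θ T ∧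
      (∀ q ∈ S, Ψ q ∈ T ∧ Θ (Ψ q) = q) ∧ (∀ r ∈ T, Θ r ∈ S ∧ Ψ (Θ r) = r) ∧
      (∀ q ∈ S, (Ψ q).2 = 0 ↔ q ∈ range ι) ∧
      ∃ ρ : M → Z, MDifferentiableAt I J ρ (ι x) ∧ ∀ᶠ y in 𝓝 x, ρ (ι y) = y := by
  have h := hι.isImmersion.isImmersionAt x
  let φ := h.domChart.extend J
  let ψ := h.codChart.extend I
  let F := h.complement
  let e₀ := h.equiv
  have hFfin : FiniteDimensional ℝ F := by
    refine FiniteDimensional.of_injective (e₀.toLinearMap.comp (LinearMap.inr ℝ E' F)) ?_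
    exact e₀.injective.comp LinearMap.inr_injective
  have hF1 : Module.finrank ℝ F = Module.finrank ℝ ℝ := by
    have h1 : Module.finrank ℝ (E' × F) = Module.finrank ℝ E := e₀.toLinearEquiv.finrank_eq
    have h2 : Module.finrank ℝ (E' × F) = _ := Module.finrank_prod
    have h3 : Module.finrank ℝ ℝ = 1 := Module.finrank_self ℝ
    omega
  let eF : F ≃L[ℝ] ℝ := ContinuousLinearEquiv.ofFinrankEq hF1
  let e : (E' × ℝ) ≃L[ℝ] E := ((ContinuousLinearEquiv.refl ℝ E').prodCongr eF.symm).trans e₀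
  have he0 : ∀ v : E', e (v, 0) = e₀ (v, 0) := fun v => by
    change e₀ (v, eF.symm 0) = _
    rw [map_zero]
  -- Here `ι` must be an embedding and not only an immersion: within `O` the image of `ι` comes from
  -- the domain chart alone, so no other sheet of `Z` returns near `ι x`.
  obtain ⟨O, hO, hOφ⟩ := hι.isEmbedding.isOpen_iff.1 h.domChart.open_source
  have hψo : IsOpen ψ.source := OpenPartialHomeomorph.isOpen_extend_source _
  have hψt : IsOpen ψ.target := OpenPartialHomeomorph.isOpen_extend_target _
  have hφt : IsOpen φ.target := OpenPartialHomeomorph.isOpen_extend_target _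
  have hψs : ψ.source = h.codChart.source := OpenPartialHomeomorph.extend_source _
  have hφs : φ.source = h.domChart.source := OpenPartialHomeomorph.extend_source _
  have hψd : ContMDiffOn I 𝓘(ℝ, E) ∞ ψ ψ.source := by
    rw [hψs]; exact OpenPartialHomeomorph.contMDiffOn_extend h.codChart_mem_maximalAtlas
  have hψd' : ContMDiffOn 𝓘(ℝ, E) I ∞ ψ.symm ψ.target := by
    have := contMDiffOn_extend_symm h.codChart_mem_maximalAtlas
    rwa [← OpenPartialHomeomorph.extend_target'] at this
  have hφd' : ContMDiffOn 𝓘(ℝ, E') J ∞ φ.symm φ.target := by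
    have := contMDiffOn_extend_symm h.domChart_mem_maximalAtlas
    rwa [← OpenPartialHomeomorph.extend_target'] at this
  have hw : ∀ y ∈ φ.source, e.symm (ψ (ι y)) = (φ y, 0) := by
    intro y hy
    have := h.writtenInCharts (φ.map_source hy)
    simp only [Function.comp_apply] at this
    change ψ (ι (φ.symm (φ y))) = e₀ (φ y, 0) at this
    rw [φ.left_inv hy] at this
    rw [this, ← he0, e.symm_apply_apply]
  have hmaps : ∀ y ∈ φ.source, ι y ∈ ψ.source := fun y hy => by
    rw [hψs]; rw [hφs] at hy; exact h.source_subset_preimage_source hy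
  let Ψ : M → E' × ℝ := fun q => e.symm (ψ q)
  let Θ : E' × ℝ → M := fun r => ψ.symm (e r)
  have hΨd : ContMDiffOn I 𝓘(ℝ, E' × ℝ) ∞ Ψ ψ.source :=
    (e.symm.contDiff (n := ∞)).contMDiff.comp_contMDiffOn hψd
  have hΘd : ContMDiffOn 𝓘(ℝ, E' × ℝ) I ∞ Θ (e ⁻¹' ψ.target) :=
    hψd'.comp (e.contDiff (n := ∞)).contMDiff.contMDiffOn (subset_refl _)
  have hxφ : x ∈ φ.source := by rw [hφs]; exact h.mem_domChart_source
  have hS1 : IsOpen (ψ.source ∩ Ψ ⁻¹' (φ.target ×ˢ univ)) :=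
    hΨd.continuousOn.isOpen_inter_preimage hψo (hφt.prod isOpen_univ)
  let S : Set M := ψ.source ∩ Ψ ⁻¹' (φ.target ×ˢ univ) ∩ O
  have hS : IsOpen S := hS1.inter hO
  let T : Set (E' × ℝ) := e ⁻¹' ψ.target ∩ Θ ⁻¹' S
  have hT : IsOpen T := hΘd.continuousOn.isOpen_inter_preimage (hψt.preimage e.continuous) hS
  have hΘΨ : ∀ q ∈ ψ.source, Θ (Ψ q) = q := fun q hq => by
    simp only [Θ, Ψ, e.apply_symm_apply]; exact ψ.left_inv hq
  have hxS : ι x ∈ S := by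
    refine ⟨⟨hmaps x hxφ, ?_⟩, ?_⟩
    · simp only [mem_preimage, Ψ]
      rw [hw x hxφ]
      exact ⟨φ.map_source hxφ, trivial⟩
    · change x ∈ ι ⁻¹' O
      rw [hOφ, ← hφs]; exact hxφ
  refine ⟨Ψ, Θ, S, T, hS, hxS, hT, hΨd.mono fun q hq => hq.1.1, hΘd.mono fun r hr => hr.1, ?_, ?_,
    ?_, ?_⟩
  · intro q hq
    refine ⟨⟨?_, ?_⟩, hΘΨ q hq.1.1⟩
    · simp only [mem_preimage, Ψ, e.apply_symm_apply]
      exact ψ.map_source hq.1.1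
    · rw [mem_preimage, hΘΨ q hq.1.1]
      exact hq
  · intro r hr
    refine ⟨hr.2, ?_⟩
    simp only [Θ, Ψ]
    rw [ψ.right_inv hr.1, e.symm_apply_apply]
  · intro q hq
    constructor
    · intro h0
      have hu : (Ψ q).1 ∈ φ.target := hq.1.2.1
      refine ⟨φ.symm (Ψ q).1, ?_⟩
      have hy := φ.map_target hu
      have h1 := hw _ hy
      rw [φ.right_inv hu] at h1
      have h2 : ((Ψ q).1, (0 : ℝ)) = Ψ q := by rw [← h0]
      rw [h2] at h1
      refine ψ.injOn (hmaps _ hy) hq.1.1 (e.symm.injective h1)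
    · rintro ⟨y, rfl⟩
      have hy : y ∈ φ.source := by
        rw [hφs, ← hOφ]; exact hq.2
      simp only [Ψ]
      rw [hw y hy]
  · refine ⟨fun q => φ.symm (Ψ q).1, ?_, ?_⟩
    · have h1 : ContMDiffAt 𝓘(ℝ, E') J ∞ φ.symm (Ψ (ι x)).1 :=
        hφd'.contMDiffAt (hφt.mem_nhds hxS.1.2.1)
      have h2 : ContMDiffAt I 𝓘(ℝ, E') ∞ (fun q => (Ψ q).1) (ι x) :=
        (contDiff_fst (n := ∞)).contMDiff.contMDiffAt.comp (ι x)
          (hΨd.contMDiffAt (hψo.mem_nhds hxS.1.1))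
      exact (h1.comp (ι x) h2).mdifferentiableAt (by simp)
    · have : φ.source ∈ 𝓝 x := by
        rw [hφs]; exact h.domChart.open_source.mem_nhds h.mem_domChart_source
      filter_upwards [this] with y hy
      simp only [Ψ]
      rw [hw y hy]
      exact φ.left_inv hy

variable [FiniteDimensional ℝ E] [FiniteDimensional ℝ E'] [I.Boundaryless] [J.Boundaryless]
  [IsManifold I ∞ M] [T2Space M]

/-- The local retraction of the slice chart has a differential that is a left inverse. -/
theorem mfderiv_injective_of_isSmoothEmbedding
    (hdim : Module.finrank ℝ E = Module.finrank ℝ E' + 1)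
    (hι : IsSmoothEmbedding J I ∞ ι) (x : Z) : Function.Injective (mfderiv J I ι x) := by
  obtain ⟨-, -, -, -, -, -, -, -, -, -, -, -, ρ, hρ, he⟩ := exists_slice_chart hdim hι x
  have h1 : MDifferentiableAt J I ι x := (hι.contMDiff x).mdifferentiableAt (by simp)
  have h2 := mfderiv_comp x hρ h1
  have h3 : (ρ ∘ ι) =ᶠ[𝓝 x] id := he
  rw [h3.mfderiv_eq, mfderiv_id] at h2
  intro v w hvw
  have hv : v = (mfderiv I J ρ (ι x)) (mfderiv J I ι x v) := DFunLike.congr_fun h2 v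
  have hw : w = (mfderiv I J ρ (ι x)) (mfderiv J I ι x w) := DFunLike.congr_fun h2 w
  rw [hv, hw, hvw]

/-- There is a smooth function that vanishes on a hypersurface, and transversely so at a given
point. -/
theorem exists_transverse_function (hdim : Module.finrank ℝ E = Module.finrank ℝ E' + 1)
    (hι : IsSmoothEmbedding J I ∞ ι) (x : Z) : ∃ z : M → ℝ, SmoothFn I z ∧ (∀ y, z (ι y) = 0) ∧
      mvfderiv I z (ι x) ≠ 0 := by
  obtain ⟨Ψ, Θ, S, T, hS, hxS, hT, hΨ, hΘ, h1, h2, h3, -⟩ := exists_slice_chart hdim hι x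
  obtain ⟨χ, hχ, hχ1, hχs⟩ := exists_cutoff (I := I) (hS.mem_nhds hxS)
  have ht : ∀ q ∈ S, ContMDiffAt I 𝓘(ℝ, ℝ) ∞ (fun q => (Ψ q).2) q := fun q hq =>
    (contDiff_snd (n := ∞)).contMDiff.contMDiffAt.comp q (hΨ.contMDiffAt (hS.mem_nhds hq))
  have hz : SmoothFn I (fun q => χ q * (Ψ q).2) := by
    refine contMDiff_of_tsupport fun q hq => (hχ q).mul (ht q (hχs ?_))
    exact closure_mono (fun q hq => by
      simp only [Function.mem_support] at *; exact left_ne_zero_of_mul hq) hq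
  refine ⟨_, hz, fun y => ?_, fun h0 => ?_⟩
  · by_cases hy : ι y ∈ S
    · rw [(h3 _ hy).2 ⟨y, rfl⟩, mul_zero]
    · rw [image_eq_zero_of_notMem_tsupport fun h => hy (hχs h), zero_mul]
  · have hxT := (h1 _ hxS).1
    have hΘd : MDifferentiableAt 𝓘(ℝ, E' × ℝ) I Θ (Ψ (ι x)) :=
      (hΘ.contMDiffAt (hT.mem_nhds hxT)).mdifferentiableAt (by simp)
    have hzd := hz.mdiff (Θ (Ψ (ι x)))
    have hc := mvfderiv_comp (Ψ (ι x)) hzd hΘd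
    have h0' : mvfderiv I (fun q => χ q * (Ψ q).2) (Θ (Ψ (ι x))) = 0 := by
      rw [(h1 _ hxS).2]; exact h0
    rw [h0'] at hc
    -- In slice coordinates the function is the last coordinate, whose differential is nonzero.
    have he : ((fun q => χ q * (Ψ q).2) ∘ Θ) =ᶠ[𝓝 (Ψ (ι x))] fun r => r.2 := by
      have hcont : ContinuousAt Θ (Ψ (ι x)) := hΘd.continuousAt
      have hχ1' : ∀ᶠ q in 𝓝 (Θ (Ψ (ι x))), χ q = 1 := by rw [(h1 _ hxS).2]; exact hχ1
      filter_upwards [hT.mem_nhds hxT, hcont.eventually hχ1'] with r hr hr'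
      simp only [Function.comp_apply]
      rw [hr', (h2 r hr).2, one_mul]
    have h5 : mvfderiv 𝓘(ℝ, E' × ℝ) (fun r : E' × ℝ => r.2) (Ψ (ι x)) ((0 : E'), (1 : ℝ)) = 0 := by
      refine (DFunLike.congr_fun (mvfderiv_congr he) _).symm.trans ?_
      rw [hc]
      rfl
    have h6 : mvfderiv 𝓘(ℝ, E' × ℝ) (fun r : E' × ℝ => r.2) (Ψ (ι x)) ((0 : E'), (1 : ℝ)) =
        fderiv ℝ (fun r : E' × ℝ => r.2) (Ψ (ι x)) ((0 : E'), (1 : ℝ)) := by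
      simp only [mvfderiv, mfderiv_eq_fderiv]
      rfl
    rw [h6, fderiv_snd] at h5
    exact one_ne_zero h5

/-- A smooth function that vanishes on a hypersurface is locally divisible by every function
that does so transversely. -/
theorem exists_eq_mul_of_vanishing (hdim : Module.finrank ℝ E = Module.finrank ℝ E' + 1)
    (hι : IsSmoothEmbedding J I ∞ ι) (x : Z) {z : M → ℝ} (hz : SmoothFn I z)
    (hz0 : ∀ y, z (ι y) = 0) (hdz : mvfderiv I z (ι x) ≠ 0) :
    (∀ᶠ q in 𝓝 (ι x), z q = 0 → q ∈ range ι) ∧ ∀ g : M → ℝ, SmoothFn I g → (∀ y, g (ι y) = 0) →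
      ∃ h : M → ℝ, SmoothFn I h ∧ ∀ᶠ q in 𝓝 (ι x), g q = z q * h q := by
  obtain ⟨Ψ, Θ, S, T, hS, hxS, hT, hΨ, hΘ, h1, h2, h3, -⟩ := exists_slice_chart hdim hι x
  -- Divisibility by the slice coordinate, from Hadamard's lemma for `g` cut off in the chart. It
  -- passes to `z` because `z` is that coordinate times a factor `z₁` which is nonzero at `ι x`:
  -- otherwise `dz` would vanish there.
  have key : ∀ g : M → ℝ, SmoothFn I g → (∀ y, g (ι y) = 0) →
      ∃ h : M → ℝ, SmoothFn I h ∧ ∀ᶠ q in 𝓝 (ι x), g q = (Ψ q).2 * h q := by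
    intro g hg hg0
    obtain ⟨χ, hχ, hχ1, hχs⟩ := exists_cutoff (I := 𝓘(ℝ, E' × ℝ)) (hT.mem_nhds (h1 _ hxS).1)
    have hG : ContDiff ℝ ∞ (fun r => χ r * g (Θ r)) := by
      rw [← contMDiff_iff_contDiff]
      refine contMDiff_of_tsupport fun r hr => (hχ r).mul ?_
      have hr' : r ∈ tsupport χ := closure_mono (fun q hq => by
        simp only [Function.mem_support] at *; exact left_ne_zero_of_mul hq) hr
      exact (hg _).comp r (hΘ.contMDiffAt (hT.mem_nhds (hχs hr')))
    obtain ⟨h, hh, hhe⟩ := exists_contDiff_eq_mul hG (fun u => by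
      by_cases hu : (u, (0 : ℝ)) ∈ T
      · have := (h3 _ (h2 _ hu).1).1 (by rw [(h2 _ hu).2])
        obtain ⟨y, hy⟩ := this
        rw [← hy, hg0, mul_zero]
      · rw [image_eq_zero_of_notMem_tsupport fun h => hu (hχs h), zero_mul])
    obtain ⟨h', hh', he'⟩ := exists_smoothFn_eventuallyEq (I := I) (p := ι x)
      (f := fun q => h (Ψ q)) (by
        filter_upwards [hS.mem_nhds hxS] with q hq
        exact hh.contMDiff.contMDiffAt.comp q (hΨ.contMDiffAt (hS.mem_nhds hq)))
    refine ⟨h', hh', ?_⟩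
    have hcont : ContinuousAt Ψ (ι x) := (hΨ.contMDiffAt (hS.mem_nhds hxS)).continuousAt
    filter_upwards [he', hS.mem_nhds hxS, hcont.eventually hχ1] with q e1 e2 e3
    rw [e1, ← hhe, e3, (h1 q e2).2, one_mul]
  obtain ⟨z₁, hz₁, hze⟩ := key z hz hz0
  have hne : z₁ (ι x) ≠ 0 := by
    intro h0
    apply hdz
    have ht0 : (Ψ (ι x)).2 = 0 := (h3 _ hxS).2 ⟨x, rfl⟩
    have htd : MDifferentiableAt I 𝓘(ℝ, ℝ) (fun q => (Ψ q).2) (ι x) :=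
      ((contDiff_snd (n := ∞)).contMDiff.contMDiffAt.comp (ι x)
        (hΨ.contMDiffAt (hS.mem_nhds hxS))).mdifferentiableAt (by simp)
    rw [mvfderiv_congr hze, mvfderiv_fun_mul htd (hz₁.mdiff _), h0, ht0, zero_smul, zero_smul,
      add_zero]
  have hne' : ∀ᶠ q in 𝓝 (ι x), z₁ q ≠ 0 := hz₁.continuous.continuousAt.eventually_ne hne
  refine ⟨?_, fun g hg hg0 => ?_⟩
  · filter_upwards [hze, hne', hS.mem_nhds hxS] with q e1 e2 e3 e4
    rw [e4] at e1
    exact (h3 q e3).1 (by simpa [e2] using e1.symm)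
  · obtain ⟨h, hh, hhe⟩ := key g hg hg0
    obtain ⟨k, hk, hke⟩ := exists_smoothFn_eventuallyEq (I := I) (p := ι x)
      (f := fun q => h q * (z₁ q)⁻¹) (by
        filter_upwards [hne'] with q hq
        exact (hh q).mul ((hz₁ q).inv₀ hq))
    refine ⟨k, hk, ?_⟩
    filter_upwards [hhe, hke, hze, hne'] with q e1 e2 e3 e4
    rw [e1, e2, e3]
    field_simp

/-- The tangent spaces of a hypersurface are the kernels of the differentials of its local
equations. -/
theorem mem_range_mfderiv_of_mvfderiv_eq_zero
    (hdim : Module.finrank ℝ E = Module.finrank ℝ E' + 1)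
    (hι : IsSmoothEmbedding J I ∞ ι) (x : Z) {z : M → ℝ} (hz : SmoothFn I z)
    (hz0 : ∀ y, z (ι y) = 0) (hdz : mvfderiv I z (ι x) ≠ 0) {v : TangentSpace I (ι x)}
    (hv : mvfderiv I z (ι x) v = 0) : ∃ w, mfderiv J I ι x w = v := by
  let L : E' →ₗ[ℝ] E := (mfderiv J I ι x).toLinearMap
  let D : E →ₗ[ℝ] ℝ := (mvfderiv I z (ι x)).toLinearMap
  have hle : LinearMap.range L ≤ LinearMap.ker D := by
    rintro _ ⟨w, rfl⟩
    have h1 : MDifferentiableAt J I ι x := (hι.contMDiff x).mdifferentiableAt (by simp)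
    have h2 := mvfderiv_comp_apply x (hz.mdiff _) h1 w
    have h3 : z ∘ ι = fun _ => 0 := funext hz0
    rw [h3, mvfderiv_const] at h2
    exact h2.symm
  have hL : Module.finrank ℝ (LinearMap.range L) = Module.finrank ℝ E' :=
    LinearMap.finrank_range_of_inj (mfderiv_injective_of_isSmoothEmbedding hdim hι x)
  have hD : Module.finrank ℝ (LinearMap.range D) + Module.finrank ℝ (LinearMap.ker D) =
      Module.finrank ℝ E := LinearMap.finrank_range_add_finrank_ker D
  have hD1 : Module.finrank ℝ (LinearMap.range D) = 1 := by
    rw [LinearMap.range_eq_top.2 (LinearMap.surjective_of_ne_zero ?_), finrank_top,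
      Module.finrank_self]
    intro h
    exact hdz (by ext v; exact DFunLike.congr_fun h v)
  -- The tangent space of `Z` lies in the kernel of `dz`, and both have codimension one.
  have := Submodule.eq_of_le_of_finrank_eq hle (by omega)
  have hv' : (v : E) ∈ LinearMap.range L := by rw [this]; exact hv
  exact hv'

end Slice

/-! ### Sections of the `b^k`-tangent bundle. -/

section BkSections

open Manifold

variable {E : Type*} [NormedAddCommGroup E] [NormedSpace ℝ E] {H : Type*} [TopologicalSpace H]
  {I : ModelWithCorners ℝ E H} {M : Type*} [TopologicalSpace M] [ChartedSpace H M]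
  {E' : Type*} [NormedAddCommGroup E'] [NormedSpace ℝ E'] {H' : Type*} [TopologicalSpace H']
  {J : ModelWithCorners ℝ E' H'} {Z : Type*} [TopologicalSpace Z] [ChartedSpace H' Z]
  {ι : Z → M} {k : ℕ} {f₀ : C^∞⟮I, M; ℝ⟯}

variable (I J ι k f₀) in
/-- The standing assumptions on a hypersurface and a jet along it. -/
structure IsHypersurfaceWithJet : Prop where
  finrank_eq : Module.finrank ℝ E = Module.finrank ℝ E' + 1
  emb : IsSmoothEmbedding J I ∞ ι
  pos : 1 ≤ k
  rep : IsJetRepresentative I ι k f₀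

section Ideal

variable {p : M} {f g : C^∞⟮I, M; ℝ⟯} {X Y : Π p : M, TangentSpace I p}

theorem smoothFn_coe (f : C^∞⟮I, M; ℝ⟯) : SmoothFn I f := f.contMDiff

theorem lieD_coe_add : lieD I X (f + g : C^∞⟮I, M; ℝ⟯) p = lieD I X f p + lieD I X g p :=
  lieD_add ((smoothFn_coe f).mdiff p) ((smoothFn_coe g).mdiff p)

theorem lieD_coe_mul :
    lieD I X (f * g : C^∞⟮I, M; ℝ⟯) p = f p * lieD I X g p + g p * lieD I X f p :=
  lieD_mul ((smoothFn_coe f).mdiff p) ((smoothFn_coe g).mdiff p)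

variable {K : Ideal C^∞⟮I, M; ℝ⟯}

theorem DerivMem.add_left (hX : DerivMem I X f K) (hY : DerivMem I Y f K) :
    DerivMem I (fun q => X q + Y q) f K := by
  obtain ⟨a, ha, ha'⟩ := hX
  obtain ⟨b, hb, hb'⟩ := hY
  refine ⟨a + b, K.add_mem ha hb, fun p => ?_⟩
  rw [lieD_add_left, ← ha', ← hb']
  rfl

theorem DerivMem.smul_left {c : M → ℝ} (hc : SmoothFn I c) (hX : DerivMem I X f K) :
    DerivMem I (fun q => c q • X q) f K := by
  obtain ⟨a, ha, ha'⟩ := hX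
  refine ⟨⟨c, hc⟩ * a, K.mul_mem_left _ ha, fun p => ?_⟩
  rw [lieD_smul_left, ← ha']
  rfl

theorem DerivMem.zero_left : DerivMem I (fun _ => 0) f K :=
  ⟨0, K.zero_mem, fun p => by simp [lieD]⟩

theorem DerivMem.add (hf : DerivMem I X f K) (hg : DerivMem I X g K) :
    DerivMem I X (f + g) K := by
  obtain ⟨a, ha, ha'⟩ := hf
  obtain ⟨b, hb, hb'⟩ := hg
  refine ⟨a + b, K.add_mem ha hb, fun p => ?_⟩
  rw [lieD_coe_add, ← ha', ← hb']
  rfl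

/-- A derivation that preserves an ideal preserves its powers. -/
theorem DerivMem.pow [IsManifold I ∞ M] (hX : SmoothVF I X) (h : ∀ f ∈ K, DerivMem I X f K)
    (m : ℕ) : ∀ f ∈ K ^ m, DerivMem I X f (K ^ m) := by
  induction m with
  | zero =>
    intro f _
    exact ⟨⟨lieD I X f, hX.lieD (smoothFn_coe f)⟩, by rw [pow_zero, Ideal.one_eq_top]; trivial,
      fun p => rfl⟩
  | succ m ih =>
    intro f hf
    rw [pow_succ] at hf
    induction hf using Submodule.mul_induction_on' with
    | mem_mul_mem a ha b hb =>
      obtain ⟨a', ha', ha''⟩ := ih a ha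
      obtain ⟨b', hb', hb''⟩ := h b hb
      refine ⟨a * b' + a' * b, ?_, fun p => ?_⟩
      · rw [pow_succ]
        exact Ideal.add_mem _ (Ideal.mul_mem_mul ha hb') (Ideal.mul_mem_mul ha' hb)
      · rw [lieD_coe_mul, ← ha'', ← hb'']
        change a p * b' p + a' p * b p = _
        ring
    | add a ha b hb h1 h2 => exact h1.add h2

theorem isVFModule_isBkSection [IsManifold I ∞ M] : IsVFModule (IsBkSection I ι k f₀) where
  zero := ⟨SmoothVF.zero, fun _ _ => DerivMem.zero_left, fun _ _ => DerivMem.zero_left⟩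
  add hX hY := ⟨hX.1.add hY.1, fun f hf => (hX.2.1 f hf).add_left (hY.2.1 f hf),
    fun f hf => (hX.2.2 f hf).add_left (hY.2.2 f hf)⟩
  smul hc hX := ⟨SmoothVF.smul hc hX.1, fun f hf => (hX.2.1 f hf).smul_left hc,
    fun f hf => (hX.2.2 f hf).smul_left hc⟩

/-- If `X` and `Y` preserve an ideal and map `f` into it, so does their commutator. This is applied
to `I_Z`, and to `I_Z^k`, which sections preserve by the Leibniz rule (`DerivMem.pow`). -/
theorem IsBkSection.mlieBracket [IsManifold I ∞ M] [FiniteDimensional ℝ E] [CompleteSpace E]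
    [T2Space M] [I.Boundaryless] (hX : IsBkSection I ι k f₀ X)
    (hY : IsBkSection I ι k f₀ Y) : IsBkSection I ι k f₀ (VectorField.mlieBracket I X Y) := by
  have key : ∀ (K : Ideal C^∞⟮I, M; ℝ⟯) (f : C^∞⟮I, M; ℝ⟯), DerivMem I X f K → DerivMem I Y f K →
      (∀ g ∈ K, DerivMem I X g K) → (∀ g ∈ K, DerivMem I Y g K) →
      DerivMem I (VectorField.mlieBracket I X Y) f K := by
    rintro K f ⟨a, ha, ha'⟩ ⟨b, hb, hb'⟩ h1 h2
    obtain ⟨c, hc, hc'⟩ := h1 b hb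
    obtain ⟨d, hd, hd'⟩ := h2 a ha
    refine ⟨c - d, K.sub_mem hc hd, fun p => ?_⟩
    rw [lieD_mlieBracket hX.1 hY.1 (smoothFn_coe f), ← funext ha', ← funext hb', ← hc', ← hd']
    rfl
  refine ⟨hX.1.mlieBracket hY.1, fun f hf => key _ f (hX.2.1 f hf) (hY.2.1 f hf) hX.2.1 hY.2.1,
    fun f hf => key _ f (hX.2.2 f hf) (hY.2.2 f hf) (DerivMem.pow hX.1 hX.2.1 k)
      (DerivMem.pow hY.1 hY.2.1 k)⟩

/-- A criterion for sections of the `b^k`-tangent bundle. -/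
theorem isBkSection_of_derivMem [IsManifold I ∞ M] (hX : SmoothVF I X)
    (h : ∀ f ∈ vanishingIdeal I ι, ∀ y, lieD I X f (ι y) = 0) {z : C^∞⟮I, M; ℝ⟯}
    (hz : z ∈ jet I ι k f₀) (hXz : DerivMem I X z (vanishingIdeal I ι ^ k)) :
    IsBkSection I ι k f₀ X := by
  have h1 : ∀ f ∈ vanishingIdeal I ι, DerivMem I X f (vanishingIdeal I ι) := fun f hf =>
    ⟨⟨lieD I X f, hX.lieD (smoothFn_coe f)⟩, h f hf, fun p => rfl⟩
  refine ⟨hX, h1, fun f hf => ?_⟩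
  -- One representative `z` of the jet suffices: any other one differs from it by an element of
  -- `I_Z^k`, and `X` preserves `I_Z^k`.
  have h2 : f - z ∈ vanishingIdeal I ι ^ k := by
    have := Ideal.sub_mem _ hf hz
    simpa using this
  have := (DerivMem.pow hX h1 k _ h2).add hXz
  simpa using this

theorem IsBkSection.lieD_eq_zero [IsManifold I ∞ M] (hX : IsBkSection I ι k f₀ X)
    (hf : f ∈ vanishingIdeal I ι) (y : Z) : lieD I X f (ι y) = 0 := by
  obtain ⟨g, hg, hg'⟩ := hX.2.1 f hf
  rw [← hg', hg y]

end Ideal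

variable [IsManifold I ∞ M] [FiniteDimensional ℝ E] [FiniteDimensional ℝ E'] [CompleteSpace E]
    [T2Space M] [I.Boundaryless] [J.Boundaryless] [IsManifold J ∞ Z]

namespace IsHypersurfaceWithJet

variable (D : IsHypersurfaceWithJet I J ι k f₀) {x : Z} {X Y : Π p : M, TangentSpace I p}
  {z : C^∞⟮I, M; ℝ⟯}
include D

theorem jet_subset (hz : z ∈ jet I ι k f₀) : z ∈ vanishingIdeal I ι := by
  have h1 := Ideal.pow_le_self (I := vanishingIdeal I ι) (n := k) (by have := D.pos; omega) hz
  simpa using Ideal.add_mem _ h1 D.rep.1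

theorem exists_adapted (x : Z) : ∃ z ∈ jet I ι k f₀, mvfderiv I z (ι x) ≠ 0 := by
  by_cases hk : 2 ≤ k
  · exact ⟨f₀, by simp [jet], D.rep.2 hk x⟩
  · obtain rfl : k = 1 := by have := D.pos; omega
    obtain ⟨z, hz, hz0, hzd⟩ := exists_transverse_function D.finrank_eq D.emb x
    refine ⟨⟨z, hz⟩, ?_, hzd⟩
    change (⟨z, hz⟩ - f₀ : C^∞⟮I, M; ℝ⟯) ∈ vanishingIdeal I ι ^ 1
    rw [pow_one]
    exact Ideal.sub_mem _ (show (⟨z, hz⟩ : C^∞⟮I, M; ℝ⟯) ∈ vanishingIdeal I ι from hz0) D.rep.1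

theorem exists_eq_pow_mul (hz : z ∈ vanishingIdeal I ι) (hzx : mvfderiv I z (ι x) ≠ 0) (m : ℕ) :
    ∀ g ∈ vanishingIdeal I ι ^ m,
      ∃ h : M → ℝ, SmoothFn I h ∧ ∀ᶠ q in 𝓝 (ι x), g q = z q ^ m * h q := by
  induction m with
  | zero => exact fun g _ => ⟨g, smoothFn_coe g, by simp⟩
  | succ m ih =>
    intro g hg
    rw [pow_succ] at hg
    induction hg using Submodule.mul_induction_on' with
    | mem_mul_mem a ha b hb =>
      obtain ⟨h, hh, he⟩ := ih a ha
      obtain ⟨h', hh', he'⟩ := (exists_eq_mul_of_vanishing D.finrank_eq D.emb x (smoothFn_coe z)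
        hz hzx).2 b (smoothFn_coe b) hb
      refine ⟨fun q => h q * h' q, hh.mul hh', ?_⟩
      filter_upwards [he, he'] with q e1 e2
      change a q * b q = _
      rw [e1, e2]
      ring
    | add a ha b hb h1 h2 =>
      obtain ⟨h, hh, he⟩ := h1
      obtain ⟨h', hh', he'⟩ := h2
      refine ⟨fun q => h q + h' q, hh.add hh', ?_⟩
      filter_upwards [he, he'] with q e1 e2
      change a q + b q = _
      rw [e1, e2]
      ring

theorem mfderiv_injective (x : Z) : Function.Injective (mfderiv J I ι x) :=
  mfderiv_injective_of_isSmoothEmbedding D.finrank_eq D.emb x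

theorem mdiff_emb (x : Z) : MDifferentiableAt J I ι x :=
  (D.emb.contMDiff x).mdifferentiableAt (by simp)

theorem mvfderiv_comp_emb {f : M → ℝ} (hf : SmoothFn I f) (w : TangentSpace J x) :
    mvfderiv J (f ∘ ι) x w = mvfderiv I f (ι x) (mfderiv J I ι x w) :=
  mvfderiv_comp_apply x (hf.mdiff _) (D.mdiff_emb x) w

theorem mvfderiv_mfderiv_eq_zero {f : M → ℝ} (hf : SmoothFn I f) (hf0 : ∀ y, f (ι y) = 0)
    (w : TangentSpace J x) : mvfderiv I f (ι x) (mfderiv J I ι x w) = 0 := by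
  rw [← D.mvfderiv_comp_emb hf]
  have h3 : f ∘ ι = fun _ => 0 := funext hf0
  rw [h3, mvfderiv_const]
  rfl

theorem exists_mfderiv_eq (hX : IsBkSection I ι k f₀ X) (x : Z) :
    ∃ w, mfderiv J I ι x w = X (ι x) := by
  obtain ⟨z, hz, hz0, hzd⟩ := exists_transverse_function D.finrank_eq D.emb x
  exact mem_range_mfderiv_of_mvfderiv_eq_zero D.finrank_eq D.emb x hz hz0 hzd
    (hX.lieD_eq_zero (f := ⟨z, hz⟩) hz0 x)

-- The field `V` serves as `∂_z` near `p`, so that `z^k ∂_z` and the projection along `∂_z` become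
-- available without adapted coordinates.
omit D in
theorem exists_dual_field {z : M → ℝ} (hz : SmoothFn I z) {p : M} (hzp : mvfderiv I z p ≠ 0) :
    ∃ V : Π p : M, TangentSpace I p, SmoothVF I V ∧ ∀ᶠ q in 𝓝 p, lieD I V z q = 1 := by
  obtain ⟨v, hv⟩ : ∃ v, mvfderiv I z p v ≠ 0 := by
    by_contra h
    push Not at h
    exact hzp (by ext v; simpa using h v)
  obtain ⟨V, hV, rfl⟩ := exists_smoothVF_apply_eq (I := I) v
  have hne : ∀ᶠ q in 𝓝 p, lieD I V z q ≠ 0 :=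
    (hV.lieD hz).continuous.continuousAt.eventually_ne hv
  obtain ⟨c, hc, hce⟩ := exists_smoothFn_eventuallyEq (I := I) (p := p)
    (f := fun q => (lieD I V z q)⁻¹) (by
      filter_upwards [hne] with q hq
      exact ((hV.lieD hz) q).inv₀ hq)
  refine ⟨fun q => c q • V q, SmoothVF.smul hc hV, ?_⟩
  filter_upwards [hne, hce] with q h1 h2
  rw [lieD_smul_left, h2, inv_mul_cancel₀ h1]

/-- The section `z^k ∂_z`. -/
theorem isBkSection_pow_smul (hz : z ∈ jet I ι k f₀) {V : Π p : M, TangentSpace I p}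
    (hV : SmoothVF I V) : IsBkSection I ι k f₀ (fun q => z q ^ k • V q) := by
  have hzI := D.jet_subset hz
  have hpow : ∀ (m : ℕ) (q : M), (z ^ m : C^∞⟮I, M; ℝ⟯) q = z q ^ m := by
    intro m q
    induction m with
    | zero => rfl
    | succ m ih =>
      rw [pow_succ, pow_succ, ← ih]
      rfl
  refine isBkSection_of_derivMem (SmoothVF.smul (f := fun q => z q ^ k)
    ((smoothFn_coe z).pow k) hV) (fun f hf y => ?_) hz
    ⟨z ^ k * ⟨lieD I V z, hV.lieD (smoothFn_coe z)⟩,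
      Ideal.mul_mem_right _ _ (Ideal.pow_mem_pow hzI k), fun p => ?_⟩
  · rw [lieD_smul_left, hzI y, zero_pow (by have := D.pos; omega), zero_mul]
  · rw [lieD_smul_left, ← hpow]
    rfl

/-- The projection of a vector field to a section that is tangent to the level sets of `z`. -/
theorem exists_tangent_section (hz : z ∈ jet I ι k f₀) {V : Π p : M, TangentSpace I p}
    (hV : SmoothVF I V) (hVz : ∀ᶠ q in 𝓝 (ι x), lieD I V z q = 1) (hX : SmoothVF I X) :
    ∃ Y, IsBkSection I ι k f₀ Y ∧ ∀ᶠ q in 𝓝 (ι x), Y q = X q - lieD I X z q • V q := by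
  obtain ⟨χ, hχ, hχ1, hχs⟩ := exists_cutoff (I := I) hVz
  have hzs := smoothFn_coe z
  let Y : Π p : M, TangentSpace I p := fun q => χ q • (X q - lieD I X z q • V q)
  have hY : SmoothVF I Y := SmoothVF.smul hχ (hX.sub (SmoothVF.smul (hX.lieD hzs) hV))
  -- The cutoff is supported where `V z = 1`, so this holds on all of `M`. For the same reason `dz ≠
  -- 0` at the points of `Z` in the support, which makes `Y` tangent to `Z` there.
  have hYz : ∀ q, lieD I Y z q = 0 := by
    intro q
    have h1 : lieD I Y z q = χ q * (lieD I X z q - lieD I X z q * lieD I V z q) := by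
      simp only [Y]
      rw [lieD_smul_left, lieD_sub_left, lieD_smul_left (g := lieD I X z)]
    rw [h1]
    by_cases hq : q ∈ tsupport χ
    · rw [show lieD I V z q = 1 from hχs hq]
      ring
    · rw [image_eq_zero_of_notMem_tsupport hq, zero_mul]
  refine ⟨Y, isBkSection_of_derivMem hY (fun f hf y => ?_) hz
    ⟨0, Ideal.zero_mem _, fun q => (hYz q).symm⟩, ?_⟩
  · by_cases hq : ι y ∈ tsupport χ
    · have hne : mvfderiv I z (ι y) ≠ 0 := by
        intro h0
        have : lieD I V z (ι y) = 1 := hχs hq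
        simp [lieD, h0] at this
      obtain ⟨w, hw⟩ := mem_range_mfderiv_of_mvfderiv_eq_zero D.finrank_eq D.emb y hzs
        (D.jet_subset hz) hne (hYz (ι y))
      simp only [lieD]
      rw [← hw]
      exact D.mvfderiv_mfderiv_eq_zero (smoothFn_coe f) hf w
    · simp only [Y]
      rw [lieD_smul_left, image_eq_zero_of_notMem_tsupport hq, zero_mul]
  · filter_upwards [hχ1] with q hq
    simp only [Y, hq, one_smul]

/-- Every vector tangent to the hypersurface extends to a section. -/
theorem exists_section_eq (w : TangentSpace J x) :
    ∃ X, IsBkSection I ι k f₀ X ∧ X (ι x) = mfderiv J I ι x w := by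
  obtain ⟨z, hz, hzx⟩ := D.exists_adapted x
  obtain ⟨V, hV, hVz⟩ := exists_dual_field (smoothFn_coe z) hzx
  obtain ⟨X, hX, hXx⟩ := exists_smoothVF_apply_eq (I := I) (mfderiv J I ι x w)
  obtain ⟨Y, hY, hYe⟩ := D.exists_tangent_section hz hV hVz hX
  refine ⟨Y, hY, ?_⟩
  have h0 : lieD I X z (ι x) = 0 := by
    simp only [lieD]
    rw [hXx]
    exact D.mvfderiv_mfderiv_eq_zero (smoothFn_coe z) (D.jet_subset hz) w
  rw [hYe.self_of_nhds, h0, zero_smul, sub_zero, hXx]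

/-- The section `z^k ∂_z` which spans the kernel of the anchor. -/
theorem exists_kernel_section (hz : z ∈ jet I ι k f₀) (hzx : mvfderiv I z (ι x) ≠ 0) :
    ∃ X, IsBkSection I ι k f₀ X ∧ (∀ y, X (ι y) = 0) ∧
      ∀ᶠ q in 𝓝 (ι x), lieD I X z q = z q ^ k := by
  obtain ⟨V, hV, hVz⟩ := exists_dual_field (smoothFn_coe z) hzx
  refine ⟨_, D.isBkSection_pow_smul hz hV, fun y => ?_, ?_⟩
  · rw [D.jet_subset hz y, zero_pow (by have := D.pos; omega), zero_smul]
  · filter_upwards [hVz] with q hq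
    rw [lieD_smul_left (g := fun q => z q ^ k), hq, mul_one]

/-- Tensors vanish on sections that vanish at a point of the hypersurface, as sections of the
`b^k`-tangent bundle. -/
theorem tensor_eq_zero {Φ : (Π p : M, TangentSpace I p) → ℝ}
    (hΦ : IsTensorialAt (IsBkSection I ι k f₀) Φ (ι x)) (hX : IsBkSection I ι k f₀ X)
    (hX0 : X (ι x) = 0) (hz : z ∈ jet I ι k f₀) (hzx : mvfderiv I z (ι x) ≠ 0) {h : M → ℝ}
    (hh : SmoothFn I h) (hXz : ∀ᶠ q in 𝓝 (ι x), lieD I X z q = z q ^ k * h q)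
    (hh0 : h (ι x) = 0) : Φ X = 0 := by
  have hP := isVFModule_isBkSection (I := I) (ι := ι) (k := k) (f₀ := f₀)
  obtain ⟨V, hV, hVz⟩ := exists_dual_field (smoothFn_coe z) hzx
  have hE := D.isBkSection_pow_smul hz hV
  obtain ⟨m, Vf, hVf, -, hfr⟩ := exists_frame (I := I) (ι x)
  choose Vt hVt hVte using fun i => D.exists_tangent_section hz hV hVz (hVf i)
  -- Near `ι x`, the difference `X - h z^k V` is tangent to the level sets of `z`, and it vanishes
  -- at `ι x` as a tangent vector. It is thus a combination of projected frame fields, which are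
  -- sections, with coefficients that vanish at `ι x`. The subtracted term contributes nothing since
  -- `h` vanishes there.
  have hY := hP.sub hX (hP.smul hh hE)
  obtain ⟨c, hc, hc0, hcs⟩ := hfr (fun q => X q - h q • (z q ^ k • V q))
  have hΦY := hΦ.eq_zero_of_lincomb hP hY hVt (hcs hY.1)
    (hc0 (by rw [hX0, hh0, zero_smul, sub_zero])) (by
      filter_upwards [hc, hXz, hVz, Filter.eventually_all.2 hVte] with q e1 e2 e3 e4
      -- The combination annihilates `z`, so replacing each frame field by its projection does not
      -- change it.
      have e5 : ∑ i, c i q * lieD I (Vf i) z q = 0 := by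
        have := congrArg (mvfderiv I z q) e1
        simp only [map_sub, map_smul, map_sum, smul_eq_mul] at this
        simp only [lieD] at e2 e3 ⊢
        rw [← this, e2, e3]
        ring
      rw [e1]
      simp only [e4, smul_sub, Finset.sum_sub_distrib, smul_smul]
      rw [← Finset.sum_smul, e5, zero_smul, sub_zero])
  rw [hΦ.sub hP hX (hP.smul hh hE), hΦ.smul hh hE, hh0] at hΦY
  linarith

theorem exists_lieD_eq (hX : IsBkSection I ι k f₀ X) (hz : z ∈ jet I ι k f₀)
    (hzx : mvfderiv I z (ι x) ≠ 0) :
    ∃ h : M → ℝ, SmoothFn I h ∧ ∀ᶠ q in 𝓝 (ι x), lieD I X z q = z q ^ k * h q := by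
  obtain ⟨g, hg, hg'⟩ := hX.2.2 z hz
  obtain ⟨h, hh, he⟩ := D.exists_eq_pow_mul (D.jet_subset hz) hzx k g hg
  exact ⟨h, hh, by filter_upwards [he] with q hq; rw [← hg', hq]⟩

theorem dense_compl_range : Dense (range ι)ᶜ := by
  rw [← interior_eq_empty_iff_dense_compl, Set.eq_empty_iff_forall_notMem]
  intro p hp
  obtain ⟨x, rfl⟩ := interior_subset hp
  obtain ⟨z, hz, hz0, hzd⟩ := exists_transverse_function D.finrank_eq D.emb x
  apply hzd
  have h2 : z =ᶠ[𝓝 (ι x)] fun _ => 0 := by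
    filter_upwards [mem_interior_iff_mem_nhds.1 hp] with q hq
    obtain ⟨y, rfl⟩ := hq
    exact hz0 y
  rw [mvfderiv_congr h2, mvfderiv_const]

end IsHypersurfaceWithJet

/-- A factor that vanishes transversely can be cancelled. -/
theorem eq_of_pow_mul_eventually_eq {p : M} {z a b : M → ℝ} (hz : mvfderiv I z p ≠ 0)
    (ha : ContinuousAt a p) (hb : ContinuousAt b p) (m : ℕ)
    (h : ∀ᶠ q in 𝓝 p, z q ^ m * a q = z q ^ m * b q) : a p = b p := by
  by_contra hne
  apply hz
  have h1 : ∀ᶠ q in 𝓝 p, a q - b q ≠ 0 := (ha.sub hb).eventually_ne (sub_ne_zero.2 hne)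
  have h2 : z =ᶠ[𝓝 p] fun _ => 0 := by
    filter_upwards [h1, h] with q e1 e2
    have : z q ^ m * (a q - b q) = 0 := by rw [mul_sub, e2, sub_self]
    exact eq_zero_of_pow_eq_zero ((mul_eq_zero.1 this).resolve_right e1)
  rw [mvfderiv_congr h2, mvfderiv_const]

end BkSections

/-! ### Existence of the forms `dz / z^k`. -/

section LogForm

open Manifold

variable {E : Type*} [NormedAddCommGroup E] [NormedSpace ℝ E] {H : Type*} [TopologicalSpace H]
  {I : ModelWithCorners ℝ E H} {M : Type*} [TopologicalSpace M] [ChartedSpace H M]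
  {E' : Type*} [NormedAddCommGroup E'] [NormedSpace ℝ E'] {H' : Type*} [TopologicalSpace H']
  {J : ModelWithCorners ℝ E' H'} {Z : Type*} [TopologicalSpace Z] [ChartedSpace H' Z]
  {ι : Z → M} {k : ℕ} {f₀ : C^∞⟮I, M; ℝ⟯}
  [IsManifold I ∞ M] [FiniteDimensional ℝ E] [FiniteDimensional ℝ E'] [CompleteSpace E]
  [T2Space M] [I.Boundaryless] [J.Boundaryless] [IsManifold J ∞ Z]

/-- Continuous functions are determined by their products with a function that is nonzero on a
dense set. -/
theorem eq_of_mul_eventually_eq {p : M} {b f g : M → ℝ} (hd : Dense {q | b q ≠ 0})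
    (hf : ContinuousAt f p) (hg : ContinuousAt g p) (h : ∀ᶠ q in 𝓝 p, b q * f q = b q * g q) :
    f p = g p := by
  by_contra hne
  have h1 : ∀ᶠ q in 𝓝 p, f q - g q ≠ 0 := (hf.sub hg).eventually_ne (sub_ne_zero.2 hne)
  obtain ⟨q, hq, hq'⟩ := hd.inter_nhds_nonempty (h1.and h)
  exact hq'.1 (sub_eq_zero.2 (mul_left_cancel₀ hq hq'.2))

/-- The form `A / b`, where `A` is locally divisible by `b`. -/
theorem exists_bkForm_quotient {A : (Π p : M, TangentSpace I p) → M → ℝ} {b : M → ℝ}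
    (hd : Dense {q | b q ≠ 0})
    (hadd : ∀ X Y p, A (fun q => X q + Y q) p = A X p + A Y p)
    (hsmul : ∀ (f : M → ℝ) X p, A (fun q => f q • X q) p = f p * A X p)
    (hloc : ∀ X, IsBkSection I ι k f₀ X → ∀ p, ∃ h : M → ℝ, SmoothFn I h ∧
      ∀ᶠ q in 𝓝 p, A X q = b q * h q) :
    ∃ σ : BkForm I ι k f₀, ∀ X, IsBkSection I ι k f₀ X → ∀ p, A X p = b p * σ.toFun X p := by
  have hdiv : ∀ X, ∃ h : M → ℝ, IsBkSection I ι k f₀ X →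
      SmoothFn I h ∧ ∀ p, A X p = b p * h p := by
    intro X
    by_cases hX : IsBkSection I ι k f₀ X
    · choose h hh he using hloc X hX
      -- Local quotients by `b` agree on overlaps by density of `{b ≠ 0}`, so they glue along the
      -- diagonal.
      have hloc' : ∀ p, ∀ᶠ q in 𝓝 p, h q q = h p q := by
        intro p
        filter_upwards [(he p).eventually_nhds] with q hq
        refine eq_of_mul_eventually_eq hd (hh q).continuous.continuousAt
          (hh p).continuous.continuousAt ?_
        filter_upwards [hq, he q] with r e1 e2
        rw [← e1, ← e2]
      refine ⟨fun p => h p p, fun _ => ⟨fun p => ?_, fun p => (he p).self_of_nhds⟩⟩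
      exact (hh p p).congr_of_eventuallyEq (hloc' p)
    · exact ⟨0, fun h => absurd h hX⟩
  choose h hh using hdiv
  have hP := isVFModule_isBkSection (I := I) (ι := ι) (k := k) (f₀ := f₀)
  have huniq : ∀ {f g : M → ℝ}, SmoothFn I f → SmoothFn I g → (∀ q, b q * f q = b q * g q) →
      f = g := fun hf hg he => funext fun p => eq_of_mul_eventually_eq hd
    hf.continuous.continuousAt hg.continuous.continuousAt (.of_forall he)
  refine ⟨⟨h, fun X hX => (hh X hX).1, fun X Y hX hY => ?_, fun f X hf hX => ?_⟩,
    fun X hX => (hh X hX).2⟩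
  · refine huniq (hh _ (hP.add hX hY)).1 ((hh X hX).1.add (hh Y hY).1) fun q => ?_
    rw [← (hh _ (hP.add hX hY)).2, hadd, (hh X hX).2, (hh Y hY).2, mul_add]
  · refine huniq (hh _ (hP.smul hf hX)).1 (ContMDiff.mul hf (hh X hX).1) fun q => ?_
    rw [← (hh _ (hP.smul hf hX)).2, hsmul, (hh X hX).2]
    ring

theorem exists_smoothFn_eq_mul {p : M} {A b : M → ℝ} (hA : SmoothFn I A) (hb : SmoothFn I b)
    (hp : b p ≠ 0) : ∃ h : M → ℝ, SmoothFn I h ∧ ∀ᶠ q in 𝓝 p, A q = b q * h q := by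
  have hne := hb.continuous.continuousAt.eventually_ne hp
  obtain ⟨h, hh, he⟩ := exists_smoothFn_eventuallyEq (I := I) (p := p) (f := fun q => A q / b q)
    (by filter_upwards [hne] with q hq; exact (hA q).div₀ (hb q) hq)
  refine ⟨h, hh, ?_⟩
  filter_upwards [hne, he] with q h1 h2
  rw [h2]
  field_simp

namespace IsHypersurfaceWithJet

variable (D : IsHypersurfaceWithJet I J ι k f₀)
include D

/-- The forms `dz / z^k` exist if the jet is represented by a global function. -/
theorem exists_isLogForm_of_two_le [SigmaCompactSpace M] (hιc : IsClosed (range ι)) (hk : 2 ≤ k) :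
    ∃ σ : BkForm I ι k f₀, IsLogForm σ := by
  have hloc : ∀ x, ∀ᶠ q in 𝓝 (ι x), f₀ q = 0 → q ∈ range ι := fun x =>
    (exists_eq_mul_of_vanishing D.finrank_eq D.emb x (smoothFn_coe f₀) D.rep.1 (D.rep.2 hk x)).1
  have : LocallyCompactSpace H := I.locallyCompactSpace
  have : LocallyCompactSpace M := ChartedSpace.locallyCompactSpace H M
  obtain ⟨χ, hχ1, hχ0, -⟩ := exists_contMDiffMap_one_nhds_of_subset_interior (n := ⊤) I hιc
    (t := {q | f₀ q = 0 → q ∈ range ι}) (by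
      rintro _ ⟨x, rfl⟩
      exact mem_interior_iff_mem_nhds.2 (hloc x))
  have hχs : SmoothFn I χ := χ.contMDiff
  have hfs := smoothFn_coe f₀
  have hχx : ∀ x, ∀ᶠ q in 𝓝 (ι x), χ q = 1 := fun x =>
    hχ1.filter_mono (nhds_le_nhdsSet (mem_range_self x))
  -- The form will be `f₀^k df₀ / b`. Near `Z` one has `χ = 1`, and it equals `df₀ / f₀^k`. The
  -- function `f₀` may have zeros outside of `Z`; there `χ = 0` and the second square keeps `b`
  -- positive.
  let b : M → ℝ := fun q => f₀ q ^ (2 * k) + (1 - χ q) ^ 2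
  have hb : SmoothFn I b := (hfs.pow _).add ((contMDiff_const.sub hχs).pow 2)
  have hbne : ∀ q ∉ range ι, b q ≠ 0 := by
    intro q hq h0
    have h1 : 0 ≤ f₀ q ^ (2 * k) := (even_two_mul k).pow_nonneg _
    have h2 := sq_nonneg (1 - χ q)
    have h3 : (1 - χ q) ^ 2 = 0 := by simp only [b] at h0; linarith
    have h4 : f₀ q ^ (2 * k) = 0 := by simp only [b] at h0; linarith
    have h5 : f₀ q = 0 := eq_zero_of_pow_eq_zero h4
    have h6 : 1 - χ q = 0 := eq_zero_of_pow_eq_zero h3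
    have := hχ0 q fun h => hq (h h5)
    rw [this] at h6
    norm_num at h6
  have hjet : f₀ ∈ jet I ι k f₀ := by simp [jet]
  obtain ⟨σ, hσ⟩ := exists_bkForm_quotient (ι := ι) (k := k) (f₀ := f₀) (b := b)
    (A := fun X q => f₀ q ^ k * lieD I X f₀ q) (D.dense_compl_range.mono fun q hq => hbne q hq)
    (fun X Y p => by rw [lieD_add_left, mul_add])
    (fun f X p => by rw [lieD_smul_left]; ring)
    (fun X hX p => by
      by_cases hp : p ∈ range ι
      · obtain ⟨x, rfl⟩ := hp
        obtain ⟨h, hh, he⟩ := D.exists_lieD_eq hX hjet (D.rep.2 hk x)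
        refine ⟨h, hh, ?_⟩
        filter_upwards [he, hχx x] with q e1 e2
        simp only [b]
        rw [e1, e2]
        ring
      · exact exists_smoothFn_eq_mul ((hfs.pow k).mul (hX.1.lieD hfs)) hb (hbne p hp))
  refine ⟨σ, fun x => ⟨f₀, hjet, D.rep.2 hk x, _, Filter.inter_mem (hχx x) (hloc x),
    fun X hX p hp => ?_⟩⟩
  by_cases hp0 : f₀ p = 0
  · obtain ⟨y, rfl⟩ := hp.2 hp0
    rw [hX.lieD_eq_zero D.rep.1, D.rep.1 y, zero_pow (by omega), zero_mul]
  · have h1 := hσ X hX p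
    have h2 : χ p = 1 := hp.1
    simp only [b, h2] at h1
    apply mul_left_cancel₀ (pow_ne_zero k hp0)
    rw [h1]
    ring

/-- There is a function which near the hypersurface is the square of a local equation, up to
a positive factor. -/
theorem exists_square_function [SigmaCompactSpace M] (hιc : IsClosed (range ι)) :
    ∃ ρ : M → ℝ, SmoothFn I ρ ∧ (∀ q ∉ range ι, ρ q ≠ 0) ∧
      ∀ x, ∃ z : M → ℝ, SmoothFn I z ∧ (∀ y, z (ι y) = 0) ∧ mvfderiv I z (ι x) ≠ 0 ∧
        ∀ᶠ q in 𝓝 (ι x), ρ q = z q ^ 2 := by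
  have hcov : ∀ p : M, ∃ (U : Set M) (z : M → ℝ), IsOpen U ∧ p ∈ U ∧ SmoothFn I z ∧
      (∀ y, z (ι y) = 0) ∧ (∀ q ∈ U, z q = 0 → q ∈ range ι) ∧
      ∀ y, ι y ∈ U → mvfderiv I z (ι y) ≠ 0 := by
    intro p
    by_cases hp : p ∈ range ι
    · obtain ⟨x, rfl⟩ := hp
      obtain ⟨z, hz, hz0, hzd⟩ := exists_transverse_function D.finrank_eq D.emb x
      obtain ⟨V, hV, hVz⟩ := exists_dual_field hz hzd
      have h1 := (exists_eq_mul_of_vanishing D.finrank_eq D.emb x hz hz0 hzd).1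
      obtain ⟨U, hU, hUo, hxU⟩ := mem_nhds_iff.1 (h1.and hVz)
      refine ⟨U, z, hUo, hxU, hz, hz0, fun q hq => (hU hq).1, fun y hy h0 => ?_⟩
      have := (hU hy).2
      simp [lieD, h0] at this
    · obtain ⟨χ, hχ, hχ1, hχs⟩ := exists_cutoff (I := I) (hιc.isOpen_compl.mem_nhds hp)
      have h0 : ∀ y, χ (ι y) = 0 := fun y =>
        image_eq_zero_of_notMem_tsupport fun h => hχs h (mem_range_self y)
      obtain ⟨U, hU, hUo, hpU⟩ := mem_nhds_iff.1 hχ1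
      have hU1 : ∀ q ∈ U, χ q = 1 := fun q hq => hU hq
      refine ⟨U, χ, hUo, hpU, hχ, h0, fun q hq hq0 => ?_, fun y hy => ?_⟩
      · rw [hU1 q hq] at hq0
        norm_num at hq0
      · have := hU1 _ hy
        rw [h0] at this
        norm_num at this
  choose U z hUo hpU hz hz0 hzr hzd using hcov
  obtain ⟨φ, hφ⟩ := SmoothPartitionOfUnity.exists_isSubordinate I isClosed_univ U hUo
    (fun p _ => mem_iUnion.2 ⟨p, hpU p⟩)
  have hφU : ∀ i q, φ i q ≠ 0 → q ∈ U i := fun i q h => hφ i (subset_tsupport _ h)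
  have hφpos : ∀ q, ∃ i, 0 < φ i q := fun q => φ.exists_pos_of_mem (mem_univ q)
  -- Local equations of `Z` can be patched after squaring, since their signs no longer matter. No
  -- coorientation of `Z` is needed.
  let ρ : M → ℝ := fun q => ∑ᶠ i, φ i q • z i q ^ 2
  have hρ : SmoothFn I ρ := φ.contMDiff_finsum_smul fun i q _ => ((hz i).pow 2) q
  have hρsum : ∀ q (s : Finset M), φ.finsupport q ⊆ s → ρ q = ∑ i ∈ s, φ i q * z i q ^ 2 := by
    intro q s hs
    simp only [ρ]
    rw [← φ.sum_finsupport_smul_eq_finsum q (fun i q => z i q ^ 2)]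
    refine Finset.sum_subset hs fun i _ hi => ?_
    rw [φ.mem_finsupport, Function.mem_support, not_not] at hi
    rw [hi, zero_smul]
  refine ⟨ρ, hρ, fun q hq h0 => ?_, fun x => ?_⟩
  · obtain ⟨i, hi⟩ := hφpos q
    rw [hρsum q _ subset_rfl, Finset.sum_eq_zero_iff_of_nonneg
      (fun i _ => mul_nonneg (φ.nonneg i q) (sq_nonneg _))] at h0
    have := h0 i ((φ.mem_finsupport q).2 hi.ne')
    exact hq (hzr i q (hφU i q hi.ne')
      (eq_zero_of_pow_eq_zero ((mul_eq_zero.1 this).resolve_left hi.ne')))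
  · set w := z (ι x)
    have hwd : mvfderiv I w (ι x) ≠ 0 := hzd _ x (hpU _)
    have hh := (exists_eq_mul_of_vanishing D.finrank_eq D.emb x (hz _) (hz0 _) hwd).2
    choose h hhs hhe using fun i => hh (z i) (hz i) (hz0 i)
    set s := φ.fintsupport (ι x)
    -- With `z i = w * h i` near `ι x` one gets `ρ = w² g` and `g > 0`, so that `w √g` is the
    -- required local equation.
    let g : M → ℝ := fun q => ∑ i ∈ s, φ i q * h i q ^ 2
    have hg : SmoothFn I g := contMDiff_finsetSum fun i _ =>
      (φ i).contMDiff.mul ((hhs i).pow 2)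
    have hρg : ∀ᶠ q in 𝓝 (ι x), ρ q = w q ^ 2 * g q := by
      filter_upwards [φ.eventually_finsupport_subset (ι x),
        (Filter.eventually_all_finset s).2 fun i _ => hhe i] with q h1 h2
      rw [hρsum q s h1, Finset.mul_sum]
      refine Finset.sum_congr rfl fun i hi => ?_
      rw [h2 i hi]
      ring
    have hgpos : 0 < g (ι x) := by
      obtain ⟨i, hi⟩ := hφpos (ι x)
      refine Finset.sum_pos' (fun i _ => mul_nonneg (φ.nonneg i _) (sq_nonneg _))
        ⟨i, φ.finsupport_subset_fintsupport (ι x) ((φ.mem_finsupport _).2 hi.ne'),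
          mul_pos hi (sq_pos_of_ne_zero ?_)⟩
      intro h0
      apply hzd i x (hφU i _ hi.ne')
      have h2 : mvfderiv I (z i) (ι x) = mvfderiv I (fun q => w q * h i q) (ι x) :=
        mvfderiv_congr (hhe i)
      rw [h2]
      ext v
      obtain ⟨V, -, rfl⟩ := exists_smoothVF_apply_eq (I := I) v
      have h3 := lieD_mul (X := V) ((hz (ι x)).mdiff (ι x)) ((hhs i).mdiff (ι x))
      simp only [lieD] at h3
      rw [h3, h0, hz0 _ x]
      simp
    obtain ⟨F, hF, hFe⟩ := exists_smoothFn_eventuallyEq (I := I) (p := ι x)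
      (f := fun q => Real.sqrt (g q)) (by
        filter_upwards [hg.continuous.continuousAt.eventually (lt_mem_nhds hgpos)] with q hq
        exact (Real.contDiffAt_sqrt hq.ne').contMDiffAt.comp q (hg q))
    refine ⟨fun q => w q * F q, (hz _).mul hF, fun y => ?_, fun h0 => hwd ?_, ?_⟩
    · change w (ι y) * F (ι y) = 0
      rw [show w (ι y) = 0 from hz0 _ y, zero_mul]
    · ext v
      obtain ⟨V, -, rfl⟩ := exists_smoothVF_apply_eq (I := I) v
      have h3 := lieD_mul (X := V) ((hz (ι x)).mdiff (ι x)) (hF.mdiff (ι x))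
      have h4 : w (ι x) = 0 := hz0 _ x
      have h5 : F (ι x) ≠ 0 := by
        rw [hFe.self_of_nhds]
        exact (Real.sqrt_pos.2 hgpos).ne'
      simp only [lieD] at h3
      rw [h0] at h3
      change 0 = _ at h3
      rw [show z (ι x) (ι x) = 0 from h4, zero_mul, zero_add] at h3
      simpa using (mul_eq_zero.1 h3.symm).resolve_left h5
    · filter_upwards [hρg, hFe, hg.continuous.continuousAt.eventually (lt_mem_nhds hgpos)]
        with q e1 e2 e3
      rw [e1, mul_pow, e2, Real.sq_sqrt e3.le]

/-- For `k ≥ 2` the representative `f₀` of the jet vanishes transversely along all of `Z`. For `k =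
1` there may be no such function, and `dρ / (2 ρ)`, which is `dz / z` where `ρ = z²`, takes its
place. -/
theorem exists_isLogForm [SigmaCompactSpace M] (hιc : IsClosed (range ι)) :
    ∃ σ : BkForm I ι k f₀, IsLogForm σ := by
  by_cases hk : 2 ≤ k
  · exact D.exists_isLogForm_of_two_le hιc hk
  obtain rfl : k = 1 := by have := D.pos; omega
  obtain ⟨ρ, hρ, hρ0, hρz⟩ := D.exists_square_function hιc
  have hjet : ∀ z : C^∞⟮I, M; ℝ⟯, (∀ y, z (ι y) = 0) → z ∈ jet I ι 1 f₀ := by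
    intro z hz
    change z - f₀ ∈ vanishingIdeal I ι ^ 1
    rw [pow_one]
    exact Ideal.sub_mem _ (show z ∈ vanishingIdeal I ι from hz) D.rep.1
  have hsq : ∀ {z : M → ℝ} {p : M} {X : Π p : M, TangentSpace I p}, SmoothFn I z →
      (∀ᶠ q in 𝓝 p, ρ q = z q ^ 2) → lieD I X ρ p = 2 * (z p * lieD I X z p) := by
    intro z p X hz he
    have h1 : lieD I X ρ p = lieD I X (fun q => z q ^ 2) p := lieD_congr he
    rw [h1, lieD_pow (hz.mdiff p) 2]
    norm_num
    ring
  obtain ⟨σ, hσ⟩ := exists_bkForm_quotient (ι := ι) (k := 1) (f₀ := f₀) (b := ρ)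
    (A := fun X q => 2⁻¹ * lieD I X ρ q) (D.dense_compl_range.mono fun q hq => hρ0 q hq)
    (fun X Y p => by rw [lieD_add_left, mul_add])
    (fun f X p => by rw [lieD_smul_left]; ring)
    (fun X hX p => by
      by_cases hp : p ∈ range ι
      · obtain ⟨x, rfl⟩ := hp
        obtain ⟨z, hz, hz0, hzd, he⟩ := hρz x
        obtain ⟨h, hh, he'⟩ := D.exists_lieD_eq hX (hjet ⟨z, hz⟩ hz0) hzd
        refine ⟨h, hh, ?_⟩
        filter_upwards [he.eventually_nhds, he'] with q e1 e2
        have e3 : lieD I X z q = z q ^ 1 * h q := e2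
        rw [hsq hz e1, e1.self_of_nhds, e3]
        ring
      · exact exists_smoothFn_eq_mul (contMDiff_const.mul (hX.1.lieD hρ)) hρ (hρ0 p hp))
  refine ⟨σ, fun x => ?_⟩
  obtain ⟨z, hz, hz0, hzd, he⟩ := hρz x
  have h1 := (exists_eq_mul_of_vanishing D.finrank_eq D.emb x hz hz0 hzd).1
  refine ⟨⟨z, hz⟩, hjet _ hz0, hzd, _, Filter.inter_mem he.eventually_nhds h1,
    fun X hX p hp => ?_⟩
  change lieD I X z p = z p ^ 1 * _
  by_cases hp0 : z p = 0
  · obtain ⟨y, rfl⟩ := hp.2 hp0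
    rw [hp0, pow_one, zero_mul]
    exact hX.lieD_eq_zero (f := ⟨z, hz⟩) hz0 y
  · have h2 := hσ X hX p
    have h3 : ∀ᶠ q in 𝓝 p, ρ q = z q ^ 2 := hp.1
    rw [hsq hz h3, h3.self_of_nhds] at h2
    apply mul_left_cancel₀ hp0
    linear_combination h2

end IsHypersurfaceWithJet

end LogForm

theorem exists_continuousLinearMap_eq {E : Type*} [NormedAddCommGroup E] [NormedSpace ℝ E]
    [FiniteDimensional ℝ E] {H : Type*} [TopologicalSpace H] {I : ModelWithCorners ℝ E H}
    {M : Type*} [TopologicalSpace M] [ChartedSpace H M] {p : M}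
    (f : TangentSpace I p →ₗ[ℝ] ℝ) : ∃ g : TangentSpace I p →L[ℝ] ℝ, ∀ v, g v = f v := by
  let F : E →ₗ[ℝ] ℝ := f
  let G : E →L[ℝ] ℝ := LinearMap.toContinuousLinearMap F
  exact ⟨G, fun _ => rfl⟩

/-! ### The splitting of forms and of their differentials along the hypersurface. -/

section Decomposition

open Manifold

variable {E : Type*} [NormedAddCommGroup E] [NormedSpace ℝ E] {H : Type*} [TopologicalSpace H]
  {I : ModelWithCorners ℝ E H} {M : Type*} [TopologicalSpace M] [ChartedSpace H M]
  {E' : Type*} [NormedAddCommGroup E'] [NormedSpace ℝ E'] {H' : Type*} [TopologicalSpace H']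
  {J : ModelWithCorners ℝ E' H'} {Z : Type*} [TopologicalSpace Z] [ChartedSpace H' Z]
  {ι : Z → M} {k : ℕ} {f₀ : C^∞⟮I, M; ℝ⟯}
  [IsManifold I ∞ M] [FiniteDimensional ℝ E] [FiniteDimensional ℝ E'] [CompleteSpace E]
  [T2Space M] [I.Boundaryless] [J.Boundaryless] [IsManifold J ∞ Z]
  {X Y : Π p : M, TangentSpace I p} {p : M}

theorem BkForm.isTensorialAt (η : BkForm I ι k f₀) (p : M) :
    IsTensorialAt (IsBkSection I ι k f₀) (fun X => η.toFun X p) p where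
  add hX hY := by rw [η.map_add _ _ hX hY]
  smul hf hX := by rw [η.map_smul _ _ hf hX]

/-- The Lie algebroid differential of a function. -/
def bkDifferential (ι : Z → M) (k : ℕ) (f₀ : C^∞⟮I, M; ℝ⟯) {f : M → ℝ} (hf : SmoothFn I f) :
    BkForm I ι k f₀ where
  toFun X := lieD I X f
  smooth _ hX := hX.1.lieD hf
  map_add _ _ _ _ := funext fun _ => lieD_add_left
  map_smul _ _ _ _ := funext fun _ => lieD_smul_left

/-- Every linearly independent family has a dual family. -/
theorem exists_dual_family {V : Type*} [AddCommGroup V] [Module ℝ V] {m : ℕ} {v : Fin m → V}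
    (hv : LinearIndependent ℝ v) :
    ∃ ξ : Fin m → V →ₗ[ℝ] ℝ, ∀ i j, ξ i (v j) = if i = j then 1 else 0 := by
  have hinj : LinearMap.ker (Fintype.linearCombination ℝ v) = ⊥ :=
    LinearMap.ker_eq_bot.2 (linearIndependent_iff_injective_fintypeLinearCombination.1 hv)
  obtain ⟨L, hL⟩ := LinearMap.exists_leftInverse_of_injective _ hinj
  refine ⟨fun i => (LinearMap.proj i).comp L, fun i j => ?_⟩
  have h1 : v j = Fintype.linearCombination ℝ v (Pi.single j 1) := by simp
  have h2 := LinearMap.congr_fun hL (Pi.single j 1)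
  rw [LinearMap.comp_apply, h1]
  rw [LinearMap.comp_apply] at h2
  rw [h2]
  simp [Pi.single_apply]

namespace IsHypersurfaceWithJet

variable (D : IsHypersurfaceWithJet I J ι k f₀) {x : Z} {σ : BkForm I ι k f₀} (hσ : IsLogForm σ)
include D

/-- Sections restrict to vector fields on the hypersurface. -/
theorem exists_restriction [T2Space Z] (hX : IsBkSection I ι k f₀ X) :
    ∃ X' : Π x : Z, TangentSpace J x, SmoothVF J X' ∧ ∀ x, mfderiv J I ι x (X' x) = X (ι x) := by
  choose X' hX' using D.exists_mfderiv_eq hX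
  refine ⟨X', smoothVF_of_lincomb fun x => ?_, hX'⟩
  obtain ⟨m, V, hV, hVi, hfr⟩ := exists_frame (I := J) x
  obtain ⟨c, hc, -, -⟩ := hfr X'
  refine ⟨m, V, c, hV, ?_, hc⟩
  -- Functions `f i` whose differentials at `ι x` are dual to the pushed-forward frame turn the
  -- smooth functions `X (f i)` on `Z` into a linear system for the coefficients of `X'`. Its matrix
  -- is the identity at `x`.
  obtain ⟨ξ, hξ⟩ := exists_dual_family (hVi.self_of_nhds.map'
    (mfderiv J I ι x).toLinearMap (LinearMap.ker_eq_bot.2 (D.mfderiv_injective x)))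
  choose ξ' hξ' using fun i => exists_continuousLinearMap_eq (I := I) (p := ι x) (ξ i)
  choose f hf hfξ using fun i => exists_smoothFn_mvfderiv_eq (I := I) (p := ι x) (ξ' i)
  have hfι : ∀ i, SmoothFn J (f i ∘ ι) := fun i => (hf i).comp D.emb.contMDiff
  have hL : ∀ i (W : Π x : Z, TangentSpace J x) y,
      lieD J W (f i ∘ ι) y = mvfderiv I (f i) (ι y) (mfderiv J I ι y (W y)) := fun i W y =>
    D.mvfderiv_comp_emb (hf i) _
  refine fun j => contMDiffAt_of_linear_system (A := fun i j => lieD J (V j) (f i ∘ ι))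
    (b := fun i => lieD I X (f i) ∘ ι) (c := c) (fun i j => (hV j).lieD (hfι i))
    (fun i => (hX.1.lieD (hf i)).comp D.emb.contMDiff) ?_ ?_ j
  · have h1 : (Matrix.of fun i j => lieD J (V j) (f i ∘ ι) x) = 1 := by
      ext i j
      rw [Matrix.of_apply, hL, hfξ, Matrix.one_apply, hξ']
      exact hξ i j
    rw [h1, Matrix.det_one]
    exact one_ne_zero
  · filter_upwards [hc] with y hy i
    have h1 : lieD I X (f i) (ι y) = lieD J X' (f i ∘ ι) y := by
      rw [hL, hX']
      rfl
    rw [Function.comp_apply, h1]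
    simp only [lieD]
    rw [hy, map_sum]
    exact Finset.sum_congr rfl fun j _ => by rw [map_smul, smul_eq_mul, mul_comm]

theorem lieD_comp_emb {X' : Π x : Z, TangentSpace J x}
    (hXX : ∀ x, mfderiv J I ι x (X' x) = X (ι x)) {f : M → ℝ} (hf : SmoothFn I f) (x : Z) :
    lieD I X f (ι x) = lieD J X' (f ∘ ι) x := by
  simp only [lieD]
  rw [D.mvfderiv_comp_emb hf, hXX]

/-- The restriction of sections to the hypersurface is compatible with the brackets. -/
theorem mfderiv_mlieBracket [T2Space Z] [CompleteSpace E'] {X' Y' : Π x : Z, TangentSpace J x}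
    (hX : SmoothVF I X) (hY : SmoothVF I Y) (hX' : SmoothVF J X')
    (hY' : SmoothVF J Y') (hXX : ∀ x, mfderiv J I ι x (X' x) = X (ι x))
    (hYY : ∀ x, mfderiv J I ι x (Y' x) = Y (ι x)) (x : Z) :
    mfderiv J I ι x (VectorField.mlieBracket J X' Y' x) = VectorField.mlieBracket I X Y (ι x) := by
  refine tangent_eq_of_forall_mvfderiv fun f hf => ?_
  rw [← D.mvfderiv_comp_emb hf]
  have h1 := lieD_mlieBracket hX hY hf (ι x)
  have h2 := lieD_mlieBracket hX' hY' (hf.comp D.emb.contMDiff) x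
  simp only [lieD_comp_emb D hXX (hY.lieD hf), lieD_comp_emb D hYY (hX.lieD hf)] at h1
  have h3 : lieD I Y f ∘ ι = lieD J Y' (f ∘ ι) := funext fun y => D.lieD_comp_emb hYY hf y
  have h4 : lieD I X f ∘ ι = lieD J X' (f ∘ ι) := funext fun y => D.lieD_comp_emb hXX hf y
  rw [h3, h4, ← h2] at h1
  exact h1.symm

include hσ

/-- Over `Z`, the value of `σ` and the anchor together detect the fibre of the `b^k`-tangent bundle:
the quotient of `X z` by `z^k` is `σ(X)`. -/
theorem tensor_eq_zero_of_isLogForm {Φ : (Π p : M, TangentSpace I p) → ℝ}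
    (hΦ : IsTensorialAt (IsBkSection I ι k f₀) Φ (ι x)) (hX : IsBkSection I ι k f₀ X)
    (hX0 : X (ι x) = 0) (h0 : σ.toFun X (ι x) = 0) : Φ X = 0 := by
  obtain ⟨z, hz, hzd, U, hU, h⟩ := hσ x
  exact D.tensor_eq_zero hΦ hX hX0 hz hzd (σ.smooth X hX)
    (Filter.eventually_of_mem hU fun p hp => h X hX p hp) h0

/-- A section `z^k ∂_z` which is normalised along the hypersurface. -/
theorem exists_unit_section (x : Z) : ∃ X, IsBkSection I ι k f₀ X ∧ (∀ y, X (ι y) = 0) ∧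
    ∀ᶠ y in 𝓝 x, σ.toFun X (ι y) = 1 := by
  obtain ⟨z, hz, hzd, U, hU, h⟩ := hσ x
  obtain ⟨V, hV, hVz⟩ := exists_dual_field (smoothFn_coe z) hzd
  obtain ⟨X, hX, hX0, hXz⟩ := D.exists_kernel_section hz hzd
  have hcont : Continuous ι := D.emb.contMDiff.continuous
  refine ⟨X, hX, hX0, hcont.continuousAt.eventually (p := fun q => σ.toFun X q = 1) ?_⟩
  filter_upwards [hVz, hXz.eventually_nhds, eventually_mem_nhds_iff.2 hU] with q e1 e2 e3
  refine eq_of_pow_mul_eventually_eq (I := I) (z := z) (p := q) (b := fun _ => 1) (fun h0 => ?_)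
    (σ.smooth X hX).continuous.continuousAt continuousAt_const k ?_
  · simp [lieD, h0] at e1
  · filter_upwards [e2, e3] with r h1 h2
    rw [← h X hX r h2, h1, mul_one]

/-- Along the hypersurface, the fibre of the `b^k`-tangent bundle is `ℝ × TZ`. -/
theorem exists_section (x : Z) (t : ℝ) (w : TangentSpace J x) :
    ∃ X, IsBkSection I ι k f₀ X ∧ X (ι x) = mfderiv J I ι x w ∧ σ.toFun X (ι x) = t := by
  obtain ⟨Y, hY, hYw⟩ := D.exists_section_eq w
  obtain ⟨X, hX, hX0, hX1⟩ := D.exists_unit_section hσ x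
  have hP := isVFModule_isBkSection (I := I) (ι := ι) (k := k) (f₀ := f₀)
  have hc : SmoothFn I fun _ : M => t - σ.toFun Y (ι x) := contMDiff_const
  refine ⟨_, hP.add hY (hP.smul hc hX), by simp [hX0, hYw], ?_⟩
  rw [(σ.isTensorialAt _).add hY (hP.smul hc hX), (σ.isTensorialAt _).smul hc hX,
    hX1.self_of_nhds]
  ring

/-- The vector `X (ι x)` is detected by the forms `df`, and the remaining direction by `σ`. -/
theorem vanishesAt_iff (hX : IsBkSection I ι k f₀ X) :
    VanishesAt ι k f₀ X (ι x) ↔ X (ι x) = 0 ∧ σ.toFun X (ι x) = 0 := by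
  refine ⟨fun h => ⟨?_, h σ⟩, fun h η =>
    D.tensor_eq_zero_of_isLogForm hσ (η.isTensorialAt _) hX h.1 h.2⟩
  refine tangent_eq_of_forall_mvfderiv fun f hf => ?_
  rw [map_zero]
  exact h (bkDifferential ι k f₀ hf)

/-- The splitting of a form along the hypersurface. -/
theorem exists_isTangentialPart (η : BkForm I ι k f₀) :
    ∃ (c : Z → ℝ) (γ : OneForm J Z), IsTangentialPart J η σ c γ := by
  have hP := isVFModule_isBkSection (I := I) (ι := ι) (k := k) (f₀ := f₀)
  choose L hL hLw hLt using fun x => D.exists_section hσ x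
  -- The value of `η` depends only on the pair `(t, w)`. Hence `c` and `γ` are its values on lifts
  -- of `(1, 0)` and `(0, w)`, and linearity is independent of the choice of lifts.
  have key : ∀ x {X Y}, IsBkSection I ι k f₀ X → IsBkSection I ι k f₀ Y → X (ι x) = Y (ι x) →
      σ.toFun X (ι x) = σ.toFun Y (ι x) → η.toFun X (ι x) = η.toFun Y (ι x) := by
    intro x X Y hX hY h1 h2
    have := D.tensor_eq_zero_of_isLogForm hσ (η.isTensorialAt (ι x)) (hP.sub hX hY)
      (by simp [h1]) (by rw [(σ.isTensorialAt _).sub hP hX hY, h2, sub_self])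
    rw [(η.isTensorialAt _).sub hP hX hY] at this
    linarith
  let γ : ∀ x, TangentSpace J x →ₗ[ℝ] ℝ := fun x =>
    { toFun := fun w => η.toFun (L x 0 w) (ι x)
      map_add' := fun v w => by
        rw [← (η.isTensorialAt _).add (hL x 0 v) (hL x 0 w)]
        refine key x (hL _ _ _) (hP.add (hL _ _ _) (hL _ _ _)) (by simp [hLw]) ?_
        rw [(σ.isTensorialAt _).add (hL x 0 v) (hL x 0 w)]
        simp [hLt]
      map_smul' := fun a w => by
        have ha : SmoothFn I fun _ : M => a := contMDiff_const
        rw [RingHom.id_apply, smul_eq_mul, ← (η.isTensorialAt _).smul ha (hL x 0 w)]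
        refine key x (hL _ _ _) (hP.smul ha (hL _ _ _)) (by simp [hLw]) ?_
        rw [(σ.isTensorialAt _).smul ha (hL x 0 w)]
        simp [hLt] }
  choose γ' hγ' using fun x => exists_continuousLinearMap_eq (γ x)
  refine ⟨fun x => η.toFun (L x 1 0) (ι x), γ', fun X hX x w hw => ?_⟩
  rw [hγ']
  have ha : SmoothFn I fun _ : M => σ.toFun X (ι x) := contMDiff_const
  change _ = _ + η.toFun (L x 0 w) (ι x)
  rw [mul_comm, ← (η.isTensorialAt _).smul ha (hL x 1 0),
    ← (η.isTensorialAt _).add (hP.smul ha (hL x 1 0)) (hL x 0 w)]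
  refine key x hX (hP.add (hP.smul ha (hL _ _ _)) (hL _ _ _)) (by simp [hLw, hw]) ?_
  rw [(σ.isTensorialAt _).add (hP.smul ha (hL x 1 0)) (hL x 0 w),
    (σ.isTensorialAt _).smul ha (hL x 1 0)]
  simp [hLt]

variable {η : BkForm I ι k f₀} {c c' : Z → ℝ} {γ γ' : OneForm J Z}

theorem isTangentialPart_unique (h : IsTangentialPart J η σ c γ)
    (h' : IsTangentialPart J η σ c' γ') : c = c' ∧ γ = γ' := by
  constructor
  · funext x
    obtain ⟨X, hX, hX0, hX1⟩ := D.exists_section hσ x 1 0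
    have h1 := h X hX x 0 hX0.symm
    have h2 := h' X hX x 0 hX0.symm
    rw [hX1, map_zero] at h1 h2
    linarith
  · funext x
    ext w
    obtain ⟨X, hX, hX0, hX1⟩ := D.exists_section hσ x 0 w
    have h1 := h X hX x w hX0.symm
    have h2 := h' X hX x w hX0.symm
    rw [hX1] at h1 h2
    linarith

theorem smooth_residue (h : IsTangentialPart J η σ c γ) : SmoothFn J c := by
  intro x
  obtain ⟨X, hX, hX0, hX1⟩ := D.exists_unit_section hσ x
  refine (((η.smooth X hX).comp D.emb.contMDiff) x).congr_of_eventuallyEq ?_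
  filter_upwards [hX1] with y hy
  have := h X hX y 0 (by rw [map_zero, hX0])
  rw [hy, map_zero] at this
  rw [Function.comp_apply, this]
  ring

/-- Values of `γ` on restrictions of sections are smooth, being `η(X) - c σ(X)`. The restrictions
`X' i` agree with the frame only at `x`, so near `x` the values on the frame are recovered from a
linear system that is the identity at `x`. -/
theorem smooth_tangentialPart [T2Space Z] (h : IsTangentialPart J η σ c γ) :
    SmoothFormOn J γ univ := by
  intro W hW
  rw [contMDiffOn_univ]
  intro x
  obtain ⟨m, V, hV, hVi, hfr⟩ := exists_frame (I := J) x
  choose X hX hXV using fun i => D.exists_section_eq (V i x)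
  choose X' hX' hXX using fun i => D.exists_restriction (hX i)
  choose b hb hb0 hbs using fun i => hfr (X' i)
  obtain ⟨a, ha, -, has⟩ := hfr W
  have hc := D.smooth_residue hσ h
  have hγV : ∀ i, ∀ᶠ y in 𝓝 x, ContMDiffAt J 𝓘(ℝ, ℝ) ∞ (fun y => γ y (V i y)) y := by
    refine fun i => contMDiffAt_of_linear_system (A := b) (c := fun i y => γ y (V i y))
      (b := fun i y => η.toFun (X i) (ι y) - c y * σ.toFun (X i) (ι y))
      (fun i j => hbs i (hX' i) j) (fun i => ?_) ?_ ?_ i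
    · exact ((η.smooth _ (hX i)).comp D.emb.contMDiff).sub
        (hc.mul ((σ.smooth _ (hX i)).comp D.emb.contMDiff))
    · have h1 : (Matrix.of fun i j => b i j x) = 1 := by
        ext i j
        have h2 : X' i x = V i x := D.mfderiv_injective x (by rw [hXX, hXV])
        have h3 := (hb i).self_of_nhds
        rw [h2] at h3
        have h4 : ∑ j, (b i j x - if i = j then 1 else 0) • V j x = 0 := by
          simp only [sub_smul, Finset.sum_sub_distrib, ← h3, ite_smul, one_smul, zero_smul,
            Finset.sum_ite_eq, Finset.mem_univ, if_true, sub_self]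
        have h5 := Fintype.linearIndependent_iff.1 hVi.self_of_nhds _ h4 j
        rw [Matrix.of_apply, Matrix.one_apply]
        linarith
      rw [h1, Matrix.det_one]
      exact one_ne_zero
    · filter_upwards [Filter.eventually_all.2 hb] with y hy i
      have h1 := h (X i) (hX i) y (X' i y) (hXX i y)
      rw [h1, add_sub_cancel_left, hy i, map_sum]
      exact Finset.sum_congr rfl fun j _ => by rw [map_smul, smul_eq_mul]
  have h1 : ContMDiffAt J 𝓘(ℝ, ℝ) ∞ (fun y => ∑ i, a i y * γ y (V i y)) x :=
    contMDiffAt_finsetSum fun i _ => (has hW i x).mul (hγV i).self_of_nhds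
  refine h1.congr_of_eventuallyEq ?_
  filter_upwards [ha] with y hy
  rw [hy, map_sum]
  exact Finset.sum_congr rfl fun j _ => by rw [map_smul, smul_eq_mul]

/-- Log forms are closed along the hypersurface. -/
theorem d_isLogForm (hX : IsBkSection I ι k f₀ X) (hY : IsBkSection I ι k f₀ Y) (x : Z) :
    σ.d X Y (ι x) = 0 := by
  obtain ⟨z, hz, hzd, U, hU, h⟩ := hσ x
  have hXY := hX.mlieBracket hY
  have hsm : ∀ {X Y}, IsBkSection I ι k f₀ X → IsBkSection I ι k f₀ Y →
      SmoothFn I (lieD I X (σ.toFun Y)) := fun hX hY => hX.1.lieD (σ.smooth _ hY)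
  have hzs := smoothFn_coe z
  have hder : ∀ {X Y q}, IsBkSection I ι k f₀ X → IsBkSection I ι k f₀ Y → U ∈ 𝓝 q →
      lieD I X (lieD I Y z) q = z q ^ k * lieD I X (σ.toFun Y) q +
        σ.toFun Y q * (k * z q ^ (k - 1) * (z q ^ k * σ.toFun X q)) := by
    intro X Y q hX hY hq
    have h1 : lieD I X (lieD I Y z) q = lieD I X (fun q => z q ^ k * σ.toFun Y q) q :=
      lieD_congr (Filter.eventually_of_mem hq fun r hr => h Y hY r hr)
    have h2 := lieD_mul (X := X) (SmoothFn.mdiff (hzs.pow k) q) (SmoothFn.mdiff (σ.smooth Y hY) q)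
    rw [h1, h2, lieD_pow (hzs.mdiff q), h X hX q (mem_of_mem_nhds hq)]
  -- Applying `[X, Y] = X Y - Y X` to `z` gives `z^k σ([X, Y]) = z^k (X σ(Y) - Y σ(X))`: the terms
  -- from differentiating `z^k` are symmetric in `X` and `Y`. Then `z^k` is cancelled.
  have := eq_of_pow_mul_eventually_eq (z := z) (p := ι x)
    (a := σ.toFun (VectorField.mlieBracket I X Y))
    (b := fun q => lieD I X (σ.toFun Y) q - lieD I Y (σ.toFun X) q) hzd
    (σ.smooth _ hXY).continuous.continuousAt
    ((hsm hX hY).sub (hsm hY hX)).continuous.continuousAt (m := k) (by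
      filter_upwards [eventually_mem_nhds_iff.2 hU] with q hq
      rw [← h _ hXY q (mem_of_mem_nhds hq), lieD_mlieBracket hX.1 hY.1 hzs, hder hX hY hq,
        hder hY hX hq]
      ring)
  simp only [BkForm.d]
  rw [this]
  ring

/-- The splitting of the differential of a form along the hypersurface. -/
theorem d_eq [T2Space Z] [CompleteSpace E'] (h : IsTangentialPart J η σ c γ)
    (hX : IsBkSection I ι k f₀ X) (hY : IsBkSection I ι k f₀ Y)
    {X' Y' : Π x : Z, TangentSpace J x} (hX' : SmoothVF J X') (hY' : SmoothVF J Y')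
    (hXX : ∀ x, mfderiv J I ι x (X' x) = X (ι x))
    (hYY : ∀ x, mfderiv J I ι x (Y' x) = Y (ι x)) (x : Z) :
    η.d X Y (ι x) = lieD J X' c x * σ.toFun Y (ι x) - lieD J Y' c x * σ.toFun X (ι x) +
      extD J γ X' Y' x := by
  have hc := D.smooth_residue hσ h
  have hγ := D.smooth_tangentialPart hσ h
  have hη : ∀ {Y} {Y' : Π x : Z, TangentSpace J x}, IsBkSection I ι k f₀ Y → (∀ x, mfderiv J I ι x (Y' x) = Y (ι x)) →
      η.toFun Y ∘ ι = fun x => c x * (σ.toFun Y ∘ ι) x + γ x (Y' x) := fun hY hYY =>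
    funext fun y => h _ hY y _ (hYY y)
  have hder : ∀ {X Y} {X' Y' : Π x : Z, TangentSpace J x}, IsBkSection I ι k f₀ X →
      IsBkSection I ι k f₀ Y →
      SmoothVF J X' → SmoothVF J Y' → (∀ x, mfderiv J I ι x (X' x) = X (ι x)) →
      (∀ x, mfderiv J I ι x (Y' x) = Y (ι x)) → lieD I X (η.toFun Y) (ι x) =
        c x * lieD I X (σ.toFun Y) (ι x) + σ.toFun Y (ι x) * lieD J X' c x +
          lieD J X' (fun x => γ x (Y' x)) x := by
    intro X Y X' Y' hX hY hX' hY' hXX hYY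
    have hs := (σ.smooth Y hY).comp D.emb.contMDiff
    rw [D.lieD_comp_emb hXX (η.smooth Y hY), hη hY hYY, D.lieD_comp_emb hXX (σ.smooth Y hY)]
    have h1 := lieD_add (X := X') (SmoothFn.mdiff (hc.mul hs) x) ((hγ.apply hY').mdiff x)
    have h2 := lieD_mul (X := X') (hc.mdiff x) (SmoothFn.mdiff hs x)
    refine h1.trans ?_
    congr 1
  have h1 := h _ (hX.mlieBracket hY) x _
    (D.mfderiv_mlieBracket hX.1 hY.1 hX' hY' hXX hYY x)
  have h2 := D.d_isLogForm hσ hX hY x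
  simp only [BkForm.d, extD] at h2 ⊢
  rw [h1, hder hX hY hX' hY' hXX hYY, hder hY hX hY' hX' hYY hXX]
  -- What is left over from the Leibniz rule is `c dσ`, which vanishes along `Z`.
  linear_combination c x * h2

/-- The pointwise form of the splitting: only the values of `X` and `Y` in the fibre enter, which
reduces the contact, Reeb and Jacobi conditions to linear algebra. -/
theorem d_eq_bilin [T2Space Z] [CompleteSpace E'] (h : IsTangentialPart J η σ c γ)
    {B : TangentSpace J x →ₗ[ℝ] TangentSpace J x →ₗ[ℝ] ℝ}
    (hB : ∀ X Y, SmoothVF J X → SmoothVF J Y → extD J γ X Y x = B (X x) (Y x))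
    (hX : IsBkSection I ι k f₀ X) (hY : IsBkSection I ι k f₀ Y) {v w : TangentSpace J x}
    (hv : mfderiv J I ι x v = X (ι x)) (hw : mfderiv J I ι x w = Y (ι x)) :
    η.d X Y (ι x) = mvfderiv J c x v * σ.toFun Y (ι x) - mvfderiv J c x w * σ.toFun X (ι x) +
      B v w := by
  obtain ⟨X', hX', hXX⟩ := D.exists_restriction hX
  obtain ⟨Y', hY', hYY⟩ := D.exists_restriction hY
  have h1 : v = X' x := D.mfderiv_injective x (by rw [hv, hXX])
  have h2 : w = Y' x := D.mfderiv_injective x (by rw [hw, hYY])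
  rw [D.d_eq hσ h hX hY hX' hY' hXX hYY x, hB _ _ hX' hY', h1, h2]
  rfl

/-- The parts of a closed form are closed. -/
theorem closed_parts [T2Space Z] [CompleteSpace E'] (h : IsTangentialPart J η σ c γ)
    (hη : ∀ X Y, IsBkSection I ι k f₀ X → IsBkSection I ι k f₀ Y → ∀ x : Z, η.d X Y (ι x) = 0)
    (x : Z) : mvfderiv J c x = 0 ∧
      ∀ V W, SmoothVF J V → SmoothVF J W → extD J γ V W x = 0 := by
  obtain ⟨B, hB, hBa⟩ := exists_extD_bilin (D.smooth_tangentialPart hσ h) x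
  have hc : mvfderiv J c x = 0 := by
    ext w
    -- On lifts of `(0, w)` and `(1, 0)` the differential is `dc(w)`. On lifts of `(0, v)` and `(0,
    -- w)` it is `dγ(v, w)`.
    obtain ⟨X, hX, hXw, hXt⟩ := D.exists_section hσ x 0 w
    obtain ⟨Y, hY, hYw, hYt⟩ := D.exists_section hσ x 1 0
    have := D.d_eq_bilin hσ h hB hX hY hXw.symm hYw.symm
    rw [hη X Y hX hY, hXt, hYt] at this
    simpa using this.symm
  refine ⟨hc, fun V W hV hW => ?_⟩
  obtain ⟨X, hX, hXw, hXt⟩ := D.exists_section hσ x 0 (V x)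
  obtain ⟨Y, hY, hYw, hYt⟩ := D.exists_section hσ x 0 (W x)
  have := D.d_eq_bilin hσ h hB hX hY hXw.symm hYw.symm
  rw [hη X Y hX hY, hXt, hYt] at this
  rw [hB _ _ hV hW]
  simpa using this.symm

/-- The contact condition along the hypersurface. -/
theorem isContactPair [T2Space Z] [CompleteSpace E'] (h : IsTangentialPart J η σ c γ)
    (hη : η.IsContact) {B : TangentSpace J x →ₗ[ℝ] TangentSpace J x →ₗ[ℝ] ℝ}
    (hB : ∀ X Y, SmoothVF J X → SmoothVF J Y → extD J γ X Y x = B (X x) (Y x))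
    (hBa : ∀ v w, B v w = - B w v) :
    IsContactPair (c x) (γ x).toLinearMap (mvfderiv J c x).toLinearMap B where
  alt := hBa
  ne_zero hc := by
    obtain ⟨X, hX, hne⟩ := (hη (ι x)).1
    obtain ⟨w, hw⟩ := D.exists_mfderiv_eq hX x
    refine ⟨w, fun h0 => hne ?_⟩
    rw [h X hX x w hw, hc, zero_mul, zero_add]
    exact h0
  nondeg t w ht hw := by
    obtain ⟨X, hX, hXw, hXt⟩ := D.exists_section hσ x t w
    have hv := (hη (ι x)).2 X hX (by rw [h X hX x w hXw.symm, hXt]; exact ht)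
      (fun Y hY hY0 => by
        obtain ⟨w', hw'⟩ := D.exists_mfderiv_eq hY x
        rw [h Y hY x w' hw'] at hY0
        rw [D.d_eq_bilin hσ h hB hX hY hXw.symm hw', hXt]
        exact hw _ w' hY0)
    rw [D.vanishesAt_iff hσ hX, hXw, hXt] at hv
    exact ⟨hv.2, D.mfderiv_injective x (by rw [hv.1, map_zero])⟩

/-- The value of log forms on `z^k ∂_z` does not depend on the local equation `z`. -/
theorem apply_kernel_section {z : C^∞⟮I, M; ℝ⟯} (hz : z ∈ jet I ι k f₀)
    (hzd : mvfderiv I z (ι x) ≠ 0) (hX : IsBkSection I ι k f₀ X) (hX0 : X (ι x) = 0)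
    (hXz : ∀ᶠ p in 𝓝 (ι x), lieD I X z p = z p ^ k) : σ.toFun X (ι x) = 1 := by
  obtain ⟨y, hy, hyd, U, hU, h⟩ := hσ x
  have hyI := D.jet_subset hy
  have hyx : y (ι x) = 0 := hyI x
  -- As `z` and `y` have the same jet, `z = y + y^k g` near `ι x`. Inserting this in `X z = z^k` and
  -- cancelling `y^k` compares `σ(X)` with 1.
  obtain ⟨g, hg, hge⟩ := D.exists_eq_pow_mul hyI hyd k (z - y) (by
    have := Ideal.sub_mem _ hz hy
    simpa using this)
  have hk := D.pos
  obtain ⟨m, rfl⟩ : ∃ m, k = m + 1 := ⟨k - 1, by omega⟩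
  have hys := smoothFn_coe y
  have hge' : ∀ᶠ q in 𝓝 (ι x), z q = y q + y q ^ (m + 1) * g q := by
    filter_upwards [hge] with q hq
    rw [← hq]
    change _ = _ + (z q - y q)
    ring
  have hder : ∀ (W : Π p : M, TangentSpace I p) q, (∀ᶠ q in 𝓝 q, z q = y q + y q ^ (m + 1) * g q) →
      lieD I W z q = lieD I W y q + (y q ^ (m + 1) * lieD I W g q +
        g q * ((m + 1) * y q ^ m * lieD I W y q)) := by
    intro W q hq
    have h1 : lieD I W z q = lieD I W (fun q => y q + y q ^ (m + 1) * g q) q := lieD_congr hq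
    have h2 : lieD I W (fun q => y q + y q ^ (m + 1) * g q) q = _ :=
      lieD_add (X := W) (hys.mdiff q) (SmoothFn.mdiff ((hys.pow (m + 1)).mul hg) q)
    have h3 := lieD_mul (X := W) (SmoothFn.mdiff (hys.pow (m + 1)) q) (hg.mdiff q)
    rw [lieD_pow (hys.mdiff q)] at h3
    refine h1.trans (h2.trans (congrArg _ (h3.trans ?_)))
    push_cast
    simp
  have hcont : Continuous (σ.toFun X) := (σ.smooth X hX).continuous
  have hcg : Continuous (lieD I X g) := (hX.1.lieD hg).continuous
  have hyc : Continuous y := hys.continuous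
  have hgc : Continuous g := hg.continuous
  have := eq_of_pow_mul_eventually_eq (z := y) (p := ι x) (m := m + 1)
    (a := fun q => σ.toFun X q + lieD I X g q + g q * ((m + 1) * y q ^ m * σ.toFun X q))
    (b := fun q => (1 + y q ^ m * g q) ^ (m + 1)) hyd (by fun_prop) (by fun_prop) (by
      filter_upwards [hge'.eventually_nhds, hXz, hU] with q e1 e2 e3
      rw [hder X q e1, e1.self_of_nhds, h X hX q e3] at e2
      calc _ = y q ^ (m + 1) * σ.toFun X q + (y q ^ (m + 1) * lieD I X g q +
          g q * ((m + 1) * y q ^ m * (y q ^ (m + 1) * σ.toFun X q))) := by ring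
        _ = _ := by rw [e2, ← mul_pow]; ring)
  have hXg : lieD I X g (ι x) = 0 := by simp [lieD, hX0]
  simp only [hXg, hyx, add_zero] at this
  -- For `k = 1` the relation at `ι x` is `(1 + g) σ(X) = 1 + g`, where `1 + g ≠ 0` because `dz = (1
  -- + g) dy` there. For `k ≥ 2` the terms with `g` carry a factor `y` and vanish.
  rcases m with _ | m
  · have hne : 1 + g (ι x) ≠ 0 := by
      intro h0
      apply hzd
      ext v
      obtain ⟨V, -, rfl⟩ := exists_smoothVF_apply_eq (I := I) v
      have h1 := hder V (ι x) hge'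
      simp only [lieD, hyx] at h1
      rw [h1]
      simp
      linear_combination (mvfderiv I y (ι x) (V (ι x))) * h0
    simp at this
    apply mul_left_cancel₀ hne
    linarith
  · simpa using this

/-- On `z^k ∂_z` the tangential part drops out and `σ` is 1. The residue is therefore the
coefficient of `σ`, for whichever log form and local equation are used. -/
theorem isResidue_iff {u : Z → ℝ} (h : IsTangentialPart J η σ c γ) :
    IsResidue η u ↔ u = c := by
  constructor
  · intro hu
    funext x
    obtain ⟨z, hz, hzd⟩ := D.exists_adapted x
    obtain ⟨X, hX, hX0, hXz⟩ := D.exists_kernel_section hz hzd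
    rw [hu x z hz hzd X hX (hX0 x) hXz, h X hX x 0 (by rw [map_zero, hX0]),
      D.apply_kernel_section hσ hz hzd hX (hX0 x) hXz, map_zero]
    ring
  · rintro rfl x z hz hzd X hX hX0 hXz
    rw [h X hX x 0 (by rw [map_zero, hX0]),
      D.apply_kernel_section hσ hz hzd hX hX0 hXz, map_zero]
    ring

end IsHypersurfaceWithJet

end Decomposition

/-! ### Ideal Liouville domains and locally conformally symplectic forms from a pair `(u, β)`. -/

section ContactPairOn

variable {E : Type*} [NormedAddCommGroup E] [NormedSpace ℝ E] {H : Type*} [TopologicalSpace H]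
  {I : ModelWithCorners ℝ E H} {M : Type*} [TopologicalSpace M] [ChartedSpace H M]
  [IsManifold I ∞ M] {p : M} {u : M → ℝ} {b : OneForm I M} {X Y W : Π p : M, TangentSpace I p}

variable (I u b) in
/-- The form `u ds + b` satisfies the contact condition. -/
structure IsContactPairOn : Prop where
  smoothFn : SmoothFn I u
  smoothForm : SmoothFormOn I b univ
  exists_pair : ∀ p, ∃ B : TangentSpace I p →ₗ[ℝ] TangentSpace I p →ₗ[ℝ] ℝ,
    (∀ X Y, SmoothVF I X → SmoothVF I Y → extD I b X Y p = B (X p) (Y p)) ∧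
    IsContactPair (u p) (b p).toLinearMap (mvfderiv I u p).toLinearMap B

theorem mvfderiv_eq_zero_of_isLocalMin [I.Boundaryless] {f : M → ℝ} (hf : SmoothFn I f)
    (h : IsLocalMin f p) : mvfderiv I f p = 0 := by
  have h1 : ContinuousAt (extChartAt I p).symm (extChartAt I p p) :=
    continuousAt_extChartAt_symm p
  have h2 : IsLocalMin (f ∘ (extChartAt I p).symm) (extChartAt I p p) := by
    have : Filter.Tendsto (extChartAt I p).symm (𝓝 (extChartAt I p p)) (𝓝 p) := by
      simpa using h1.tendsto
    filter_upwards [this.eventually h] with e he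
    simpa using he
  have h3 : mfderiv I 𝓘(ℝ, ℝ) f p = 0 := by
    rw [(hf.mdiff p).mfderiv, ModelWithCorners.range_eq_univ, fderivWithin_univ]
    exact h2.fderiv_eq_zero
  ext v
  simp only [mvfderiv]
  rw [h3]
  simp

/-- The interior of a domain given by a regular equation. -/
theorem interior_setOf_nonneg [I.Boundaryless] (hu : SmoothFn I u)
    (hreg : ∀ p, u p = 0 → mvfderiv I u p ≠ 0) : interior {p | 0 ≤ u p} = {p | 0 < u p} := by
  apply Subset.antisymm
  · intro p hp
    have h0 : p ∈ {p | 0 ≤ u p} := interior_subset hp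
    rcases lt_or_eq_of_le (show 0 ≤ u p from h0) with h | h
    · exact h
    -- A zero of `u` in the interior would be a local minimum.
    · refine absurd (mvfderiv_eq_zero_of_isLocalMin hu ?_) (hreg p h.symm)
      filter_upwards [mem_interior_iff_mem_nhds.1 hp] with q hq
      rw [← h]
      exact hq
  · exact interior_maximal (fun p (hp : 0 < u p) => hp.le) (isOpen_lt continuous_const hu.continuous)

theorem quotForm_neg : quotForm I (fun p => - u p) (fun p => - b p) = quotForm I u b := by
  funext p
  simp [quotForm, inv_neg]

theorem extD_congr {b' : OneForm I M} (h : ∀ᶠ q in 𝓝 p, b q = b' q) :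
    extD I b X Y p = extD I b' X Y p := by
  simp only [extD]
  rw [h.self_of_nhds]
  congr 2
  · exact lieD_congr (by filter_upwards [h] with q hq; rw [hq])
  · exact lieD_congr (by filter_upwards [h] with q hq; rw [hq])

theorem extD_neg : extD I (fun p => - b p) X Y p = - extD I b X Y p := by
  have h1 := lieD_neg (X := X) (f := fun q => b q (Y q)) (p := p)
  have h2 := lieD_neg (X := Y) (f := fun q => b q (X q)) (p := p)
  simp only [extD, neg_apply]
  rw [h1, h2]
  ring

theorem smoothAt_inv (hu : SmoothFn I u) (hp : u p ≠ 0) :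
    ContMDiffAt I 𝓘(ℝ, ℝ) ∞ (fun q => (u q)⁻¹) p := (hu p).inv₀ hp

theorem lieD_inv (hu : SmoothFn I u) (hp : u p ≠ 0) :
    lieD I X (fun q => (u q)⁻¹) p = - (u p)⁻¹ ^ 2 * lieD I X u p := by
  have h1 := lieD_mul (X := X) (hu.mdiff p) ((smoothAt_inv hu hp).mdifferentiableAt (by simp))
  have h2 : lieD I X (fun q => u q * (u q)⁻¹) p = lieD I X (fun _ => 1) p := by
    refine lieD_congr ?_
    filter_upwards [hu.continuous.continuousAt.eventually_ne hp] with q hq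
    exact mul_inv_cancel₀ hq
  rw [h1, lieD_const] at h2
  apply mul_left_cancel₀ hp
  generalize lieD I X (fun q => (u q)⁻¹) p = a at *
  rw [eq_neg_of_add_eq_zero_left h2]
  field_simp

theorem extD_quotForm (hu : SmoothFn I u) (hb : SmoothFormOn I b univ) (hX : SmoothVF I X)
    (hY : SmoothVF I Y) (hp : u p ≠ 0) :
    extD I (quotForm I u b) X Y p = (u p)⁻¹ * conformalForm I u b X Y p := by
  have h := extD_smul ((smoothAt_inv hu hp).mdifferentiableAt (by simp)) hb hX hY
  refine h.trans ?_
  rw [lieD_inv hu hp, lieD_inv hu hp]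
  simp only [conformalForm]
  ring

/-- The form `d β + u⁻¹ β ∧ du` does not change if `β` is modified by a closed multiple of `u`, and
`u` by a constant factor. -/
theorem conformalForm_change {u' : M → ℝ} {b' γ : OneForm I M} {c : ℝ} (hc : c ≠ 0)
    (hu' : SmoothFn I u') (hb : SmoothFormOn I b univ) (hγ : SmoothFormOn I γ univ)
    (hX : SmoothVF I X) (hY : SmoothVF I Y) (hu : ∀ᶠ q in 𝓝 p, u q = c * u' q)
    (hb' : ∀ᶠ q in 𝓝 p, b' q = b q - u' q • γ q) (hdγ : extD I γ X Y p = 0) (hp : u p ≠ 0) :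
    conformalForm I u' b' X Y p = conformalForm I u b X Y p := by
  have h1 : ∀ X : Π p : M, TangentSpace I p, lieD I X u p = c * lieD I X u' p := by
    intro X
    have h2 : lieD I X u p = lieD I X (fun q => c * u' q) p := lieD_congr hu
    have h3 := lieD_mul (X := X) (f := fun _ => c) (contMDiff_const.mdifferentiableAt
      (by simp : (∞ : ℕ∞ω) ≠ 0)) (hu'.mdiff p)
    rw [h2, h3, lieD_const]
    ring
  have h0 := hu.self_of_nhds
  have hp' : u' p ≠ 0 := by
    rintro h
    rw [h, mul_zero] at h0
    exact hp h0
  have h4 : extD I b' X Y p = extD I b X Y p - extD I (fun q => u' q • γ q) X Y p := by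
    rw [extD_congr hb', extD_sub hb (SmoothFormOn.smul hu'.contMDiffOn hγ) hX hY]
  simp only [conformalForm]
  rw [h4, extD_smul (hu'.mdiff p) hγ hX hY, hdγ, h1, h1, hb'.self_of_nhds, h0]
  simp only [sub_apply, smul_apply, smul_eq_mul]
  field_simp
  ring

namespace IsContactPairOn

variable (h : IsContactPairOn I u b)
include h

theorem neg : IsContactPairOn I (fun p => - u p) (fun p => - b p) where
  smoothFn := h.smoothFn.neg
  smoothForm X hX := (h.smoothForm X hX).neg
  exists_pair p := by
    obtain ⟨B, hB, hB'⟩ := h.exists_pair p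
    have hd : ∀ w, mvfderiv I (fun p => - u p) p w = - mvfderiv I u p w := fun w => by
      have : mvfderiv I (fun p => - u p) p = - mvfderiv I u p := mvfderiv_neg
      rw [this]
      rfl
    refine ⟨- B, fun X Y hX hY => ?_, ⟨fun v w => ?_, fun h0 => ?_, fun t w h1 h2 => ?_⟩⟩
    · rw [extD_neg, hB X Y hX hY]
      rfl
    · change - B v w = - - B w v
      rw [hB'.alt]
    · obtain ⟨w, hw⟩ := hB'.ne_zero (neg_eq_zero.1 h0)
      exact ⟨w, neg_ne_zero.2 hw⟩
    · refine hB'.nondeg t w ?_ fun t' w' h3 => ?_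
      · change - u p * t + - b p w = 0 at h1
        change u p * t + b p w = 0
        linarith
      · have := h2 t' w' (by
          change u p * t' + b p w' = 0 at h3
          change - u p * t' + - b p w' = 0
          linarith)
        change mvfderiv I (fun p => - u p) p w * t' - mvfderiv I (fun p => - u p) p w' * t +
          - B w w' = 0 at this
        rw [hd, hd] at this
        change mvfderiv I u p w * t' - mvfderiv I u p w' * t + B w w' = 0
        linarith

theorem restrictsToContactForm [T2Space M] [FiniteDimensional ℝ E] :
    RestrictsToContactForm I u b := by
  intro p hp
  obtain ⟨B, hB, hB'⟩ := h.exists_pair p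
  refine ⟨fun h0 => ?_, hB'.exists_ne hp, fun X hX h1 h2 h3 => ?_⟩
  · obtain ⟨w, -, hw⟩ := hB'.exists_ker_ne hp
    exact hw (by rw [h0]; rfl)
  · refine hB'.contact hp h1 h2 fun w hw1 hw2 => ?_
    obtain ⟨Y, hY, rfl⟩ := exists_smoothVF_apply_eq (I := I) w
    rw [← hB X Y hX hY]
    exact h3 Y hY hw1 hw2

theorem smoothFormOn_quotForm : SmoothFormOn I (quotForm I u b) {p | u p ≠ 0} :=
  SmoothFormOn.smul (fun _ hp => (smoothAt_inv h.smoothFn hp).contMDiffWithinAt) h.smoothForm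

theorem nondegenerateAt_conformalForm [T2Space M] [FiniteDimensional ℝ E] (hp : u p ≠ 0) :
    NondegenerateAt I (conformalForm I u b) p := by
  obtain ⟨B, hB, hB'⟩ := h.exists_pair p
  intro X hX h0
  refine hB'.symplectic hp fun w => ?_
  obtain ⟨Y, hY, rfl⟩ := exists_smoothVF_apply_eq (I := I) w
  rw [← hB X Y hX hY]
  exact h0 Y hY

theorem nondegenerateAt_extD_quotForm [T2Space M] [FiniteDimensional ℝ E] (hp : u p ≠ 0) :
    NondegenerateAt I (extD I (quotForm I u b)) p := by
  intro X hX h0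
  refine h.nondegenerateAt_conformalForm hp X hX fun Y hY => ?_
  have := h0 Y hY
  rw [extD_quotForm h.smoothFn h.smoothForm hX hY hp] at this
  exact (mul_eq_zero.1 this).resolve_left (inv_ne_zero hp)

/-- The defining function of the boundary is `u` itself, and `u • u⁻¹ β` extends as `β`. -/
theorem isIdealLiouvilleDomain [T2Space M] [FiniteDimensional ℝ E] [I.Boundaryless] :
    IsIdealLiouvilleDomain I {p | 0 ≤ u p} (quotForm I u b) := by
  have hi := interior_setOf_nonneg h.smoothFn fun p hp => (h.restrictsToContactForm p hp).1
  have hne : ∀ p ∈ interior {p | 0 ≤ u p}, u p ≠ 0 := by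
    rw [hi]
    exact fun p hp => ne_of_gt hp
  refine ⟨fun X hX => (h.smoothFormOn_quotForm X hX).mono hne,
    fun p hp => h.nondegenerateAt_extD_quotForm (hne p hp), u, b, h.smoothFn, rfl, hi,
    h.smoothForm, fun p hp => ?_, h.restrictsToContactForm⟩
  simp [quotForm, hne p hp]

/-- The pair `(-u, -β)` satisfies the same conditions and has the same quotient `u⁻¹ β`. -/
theorem isIdealLiouvilleDomain_nonpos [T2Space M] [FiniteDimensional ℝ E] [I.Boundaryless] :
    IsIdealLiouvilleDomain I {p | u p ≤ 0} (quotForm I u b) := by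
  have := h.neg.isIdealLiouvilleDomain
  rw [quotForm_neg] at this
  simpa using this

/-- Since `τ = u d(u⁻¹ β)`, one has `dτ = θ ∧ τ` with the closed form `θ = u⁻¹ du`. -/
theorem isLocallyConformallySymplecticOn [T2Space M] [FiniteDimensional ℝ E] [CompleteSpace E]
    [I.Boundaryless] : IsLocallyConformallySymplecticOn I (conformalForm I u b) {p | u p ≠ 0} := by
  have hu := h.smoothFn
  have hinv : ∀ {p}, u p ≠ 0 → ContMDiffAt I 𝓘(ℝ, ℝ) ∞ (fun q => (u q)⁻¹) p := smoothAt_inv hu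
  have hdu : SmoothFormOn I (mvfderiv I u) univ := smoothFormOn_mvfderiv hu
  have hne : ∀ {p}, u p ≠ 0 → ∀ᶠ q in 𝓝 p, u q ≠ 0 := fun hp =>
    hu.continuous.continuousAt.eventually_ne hp
  refine ⟨fun X Y hX hY p hp => ContMDiffAt.contMDiffWithinAt ?_,
    fun p hp => h.nondegenerateAt_conformalForm hp, fun q => (u q)⁻¹ • mvfderiv I u q,
    SmoothFormOn.smul (fun _ hp => (hinv hp).contMDiffWithinAt) hdu,
    fun X Y hX hY p hp => ?_, fun X Y W hX hY hW p hp => ?_⟩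
  · exact (smoothFn_extD h.smoothForm hX hY p).add ((hinv hp).mul
      (((h.smoothForm.apply hX).mul (hY.lieD hu)).sub
        ((h.smoothForm.apply hY).mul (hX.lieD hu)) p))
  · rw [extD_smul ((hinv hp).mdifferentiableAt (by simp)) hdu hX hY, extD_mvfderiv hu hX hY,
      lieD_inv hu hp, lieD_inv hu hp]
    simp only [lieD]
    ring
  · obtain ⟨F, hF, hFe⟩ := exists_smoothFn_eventuallyEq (I := I) (p := p)
      -- A global smooth function with the germ of `u⁻¹` makes `u⁻¹ β` a smooth form on all of `M`
      -- with the same germ, to which `d² = 0` applies.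
      (f := fun q => (u q)⁻¹) (by filter_upwards [hne hp] with q hq; exact hinv hq)
    set a : OneForm I M := fun q => F q • b q
    have ha : SmoothFormOn I a univ := SmoothFormOn.smul hF.contMDiffOn h.smoothForm
    have hτ : ∀ {X Y}, SmoothVF I X → SmoothVF I Y →
        ∀ᶠ q in 𝓝 p, conformalForm I u b X Y q = u q * extD I a X Y q := by
      intro X Y hX hY
      filter_upwards [hne hp, hFe.eventually_nhds] with q h1 h2
      have h3 : extD I a X Y q = extD I (quotForm I u b) X Y q := extD_congr (by
        filter_upwards [h2] with r hr
        simp only [a, quotForm, hr])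
      rw [h3, extD_quotForm hu h.smoothForm hX hY h1, mul_inv_cancel_left₀ h1]
    have hder : ∀ {X Y W}, SmoothVF I X → SmoothVF I Y → SmoothVF I W →
        lieD I X (conformalForm I u b Y W) p =
          u p * lieD I X (extD I a Y W) p + extD I a Y W p * lieD I X u p := by
      intro X Y W hX hY hW
      have h1 : lieD I X (conformalForm I u b Y W) p =
        lieD I X (fun q => u q * extD I a Y W q) p := lieD_congr (hτ hY hW)
      rw [h1, lieD_mul (hu.mdiff p) ((smoothFn_extD ha hY hW).mdiff p)]
    have h0 := extD₂_extD ha hX hY hW (p := p)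
    simp only [extD₂] at h0 ⊢
    rw [hder hX hY hW, hder hY hX hW, hder hW hX hY,
      (hτ (hX.mlieBracket hY) hW).self_of_nhds, (hτ (hX.mlieBracket hW) hY).self_of_nhds,
      (hτ (hY.mlieBracket hW) hX).self_of_nhds, (hτ hY hW).self_of_nhds,
      (hτ hX hW).self_of_nhds, (hτ hX hY).self_of_nhds]
    simp only [smul_apply, smul_eq_mul, lieD] at h0 ⊢
    have hp' : u p ≠ 0 := hp
    field_simp
    linear_combination u p * h0

end IsContactPairOn

end ContactPairOn

/-! ### Local expressions of 1-forms by differentials of functions. -/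

section Coframe

variable {E : Type*} [NormedAddCommGroup E] [NormedSpace ℝ E] {H : Type*} [TopologicalSpace H]
  {I : ModelWithCorners ℝ E H} {M : Type*} [TopologicalSpace M] [ChartedSpace H M]
  [IsManifold I ∞ M] {p : M} {b : OneForm I M} {X Y : Π p : M, TangentSpace I p}
  {κ : Type*} [Fintype κ] {f g : κ → M → ℝ}

theorem lieD_sum (hf : ∀ i, SmoothFn I (f i)) :
    lieD I X (fun q => ∑ i, f i q) p = ∑ i, lieD I X (f i) p := by
  classical
  have : ∀ s : Finset κ, lieD I X (fun q => ∑ i ∈ s, f i q) p = ∑ i ∈ s, lieD I X (f i) p := by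
    intro s
    induction s using Finset.induction_on with
    | empty => simp [lieD_const]
    | insert i s hi ih =>
      simp only [Finset.sum_insert hi]
      rw [← ih]
      exact lieD_add ((hf i).mdiff p)
        (SmoothFn.mdiff (contMDiff_finsetSum fun i _ => hf i) p)
  exact this _

theorem smoothFormOn_of_eq_sum (hf : ∀ i, SmoothFn I (f i)) (hg : ∀ i, SmoothFn I (g i))
    (h : ∀ᶠ q in 𝓝 p, ∀ v, b q v = ∑ i, g i q * mvfderiv I (f i) q v) (hX : SmoothVF I X) :
    ContMDiffAt I 𝓘(ℝ, ℝ) ∞ (fun q => b q (X q)) p := by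
  have h1 : SmoothFn I fun q => ∑ i, g i q * lieD I X (f i) q :=
    contMDiff_finsetSum fun i _ => (hg i).mul (hX.lieD (hf i))
  refine (h1 p).congr_of_eventuallyEq ?_
  filter_upwards [h] with q hq
  exact hq _

variable [CompleteSpace E] [FiniteDimensional ℝ E] [T2Space M] [I.Boundaryless]

/-- The formula `d(∑ g df) = ∑ dg ∧ df`. It gives access to exterior derivatives on `Z × ℝ`, whose
vector fields are not sums of fields lifted from the factors. -/
theorem extD_of_eq_sum (hf : ∀ i, SmoothFn I (f i)) (hg : ∀ i, SmoothFn I (g i))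
    (h : ∀ᶠ q in 𝓝 p, ∀ v, b q v = ∑ i, g i q * mvfderiv I (f i) q v) (hX : SmoothVF I X)
    (hY : SmoothVF I Y) : extD I b X Y p =
      ∑ i, (lieD I X (g i) p * lieD I Y (f i) p - lieD I Y (g i) p * lieD I X (f i) p) := by
  have key : ∀ {X Y}, SmoothVF I X → SmoothVF I Y → lieD I X (fun q => b q (Y q)) p =
      ∑ i, (g i p * lieD I X (lieD I Y (f i)) p + lieD I Y (f i) p * lieD I X (g i) p) := by
    intro X Y hX hY
    have h1 : lieD I X (fun q => b q (Y q)) p =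
        lieD I X (fun q => ∑ i, g i q * lieD I Y (f i) q) p := lieD_congr (by
      filter_upwards [h] with q hq
      exact hq _)
    refine h1.trans ((lieD_sum fun i => (hg i).mul (hY.lieD (hf i))).trans ?_)
    exact Finset.sum_congr rfl fun i _ => lieD_mul ((hg i).mdiff p) ((hY.lieD (hf i)).mdiff p)
  have hbr : b p (VectorField.mlieBracket I X Y p) =
      ∑ i, g i p * (lieD I X (lieD I Y (f i)) p - lieD I Y (lieD I X (f i)) p) := by
    rw [h.self_of_nhds]
    exact Finset.sum_congr rfl fun i _ => by rw [← lieD_mlieBracket hX hY (hf i)]; rfl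
  simp only [extD]
  rw [key hX hY, key hY hX, hbr, ← Finset.sum_sub_distrib, ← Finset.sum_sub_distrib]
  exact Finset.sum_congr rfl fun i _ => by ring

/-- Every smooth 1-form is locally a combination of differentials of functions. -/
theorem SmoothFormOn.exists_eq_sum (hb : SmoothFormOn I b univ) (p : M) :
    ∃ (m : ℕ) (f g : Fin m → M → ℝ), (∀ i, SmoothFn I (f i)) ∧ (∀ i, SmoothFn I (g i)) ∧
      ∀ᶠ q in 𝓝 p, ∀ v, b q v = ∑ i, g i q * mvfderiv I (f i) q v := by
  classical
  obtain ⟨m, V, hV, hVi, hfr⟩ := exists_frame (I := I) p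
  -- `exists_frame` expands one field at a time, on a neighbourhood that depends on it. Applied to a
  -- field `w` chosen outside of the span wherever this is possible, it shows that the frame spans
  -- at all nearby points.
  have hspan : ∀ᶠ q in 𝓝 p, ∀ v : TangentSpace I q, ∃ c : Fin m → ℝ, ∑ i, c i • V i q = v := by
    have hch : ∀ q, ∃ w : TangentSpace I q, (∃ c : Fin m → ℝ, ∑ i, c i • V i q = w) →
        ∀ v : TangentSpace I q, ∃ c : Fin m → ℝ, ∑ i, c i • V i q = v := by
      intro q
      by_cases hq : ∀ v : TangentSpace I q, ∃ c : Fin m → ℝ, ∑ i, c i • V i q = v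
      · exact ⟨0, fun _ => hq⟩
      · push Not at hq
        obtain ⟨w, hw⟩ := hq
        exact ⟨w, fun ⟨c, hc⟩ => absurd hc (hw c)⟩
    choose w hw using hch
    obtain ⟨c, hc, -⟩ := hfr w
    filter_upwards [hc] with q hq
    exact hw q ⟨fun i => c i q, hq.symm⟩
  obtain ⟨ξ, hξ⟩ := exists_dual_family hVi.self_of_nhds
  choose ξ' hξ' using fun i => exists_continuousLinearMap_eq (I := I) (p := p) (ξ i)
  choose f hf hfξ using fun i => exists_smoothFn_mvfderiv_eq (I := I) (p := p) (ξ' i)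
  let A : Fin m → Fin m → M → ℝ := fun j i => lieD I (V j) (f i)
  have hA : ∀ j i, SmoothFn I (A j i) := fun j i => (hV j).lieD (hf i)
  have hA1 : (Matrix.of fun j i => A j i p) = 1 := by
    ext j i
    rw [Matrix.of_apply, Matrix.one_apply]
    simp only [A, lieD]
    rw [hfξ, hξ', hξ]
    exact if_congr eq_comm rfl rfl
  have hAdet : (Matrix.of fun j i => A j i p).det ≠ 0 := by
    rw [hA1, Matrix.det_one]
    exact one_ne_zero
  have hdet : ∀ᶠ q in 𝓝 p, (Matrix.of fun j i => A j i q).det ≠ 0 := by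
    have hc : Continuous fun q => (Matrix.of fun j i => A j i q).det := by
      refine Continuous.matrix_det (continuous_matrix fun i j => ?_)
      exact (hA i j).continuous
    exact hc.continuousAt.eventually_ne hAdet
  let c : Fin m → M → ℝ := fun i q =>
    ((Matrix.of fun j i => A j i q)⁻¹.mulVec fun j => b q (V j q)) i
  have hsys : ∀ᶠ q in 𝓝 p, ∀ j, ∑ i, A j i q * c i q = b q (V j q) := by
    filter_upwards [hdet] with q hq j
    have : (Matrix.of fun j i => A j i q).mulVec ((Matrix.of fun j i => A j i q)⁻¹.mulVec
        fun j => b q (V j q)) = fun j => b q (V j q) := by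
      rw [Matrix.mulVec_mulVec, Matrix.mul_nonsing_inv _ (isUnit_iff_ne_zero.2 hq),
        Matrix.one_mulVec]
    exact congrFun this j
  choose g hg hge using fun i => exists_smoothFn_eventuallyEq (I := I) (p := p) (f := c i)
    (contMDiffAt_of_linear_system hA (fun j => hb.apply (hV j)) hAdet hsys i)
  refine ⟨m, f, g, hf, hg, ?_⟩
  filter_upwards [hspan, hsys, Filter.eventually_all.2 hge] with q h1 h2 h3 v
  obtain ⟨a, rfl⟩ := h1 v
  simp only [map_sum, map_smul, smul_eq_mul, Finset.mul_sum, ← h2, h3]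
  rw [Finset.sum_comm]
  refine Finset.sum_congr rfl fun i _ => Finset.sum_congr rfl fun j _ => ?_
  simp only [A, lieD]
  ring

end Coframe

/-! ### Invariant contact forms `u ds + b` on the product with `ℝ`. -/

section Product

variable {E : Type*} [NormedAddCommGroup E] [NormedSpace ℝ E] {H : Type*} [TopologicalSpace H]
  {I : ModelWithCorners ℝ E H} {M : Type*} [TopologicalSpace M] [ChartedSpace H M]
  [IsManifold I ∞ M] {r : M × ℝ} {u : M → ℝ} {b : OneForm I M}
  {a : OneForm (I.prod 𝓘(ℝ, ℝ)) (M × ℝ)}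
  {X Y : Π r : M × ℝ, TangentSpace (I.prod 𝓘(ℝ, ℝ)) r}

theorem vertVF_eq (r : M × ℝ) : vertVF I r = ((0, 1) : E × ℝ) := by
  simp only [vertVF]
  rw [mfderiv_prod_right]
  rfl

theorem smoothVF_vertVF : SmoothVF (I.prod 𝓘(ℝ, ℝ)) (vertVF I (M := M)) := by
  have h1 : ContMDiff 𝓘(ℝ, ℝ) 𝓘(ℝ, ℝ).tangent ∞
      (fun s => (⟨s, (1 : ℝ)⟩ : TangentBundle 𝓘(ℝ, ℝ) ℝ)) :=
    contMDiff_vectorSpace_iff_contDiff.2 (contDiff_const (c := (1 : ℝ)))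
  have h2 : ContMDiff I I.tangent ∞ (fun p : M => (⟨p, 0⟩ : TangentBundle I M)) := SmoothVF.zero
  have h3 := (contMDiff_equivTangentBundleProd_symm (n := ∞) (I := I) (M := M) (I' := 𝓘(ℝ, ℝ))
    (M' := ℝ)).comp ((h2.comp contMDiff_fst).prodMk (h1.comp contMDiff_snd))
  have h4 : (fun r : M × ℝ => (⟨r, vertVF I r⟩ : TangentBundle (I.prod 𝓘(ℝ, ℝ)) (M × ℝ))) =
      fun r => (equivTangentBundleProd I M 𝓘(ℝ, ℝ) ℝ).symm (⟨r.1, 0⟩, ⟨r.2, (1 : ℝ)⟩) := by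
    funext r
    rw [vertVF_eq]
    rfl
  rw [SmoothVF, h4]
  exact h3

variable (I) in
/-- The differential of the coordinate on `ℝ`. -/
abbrev dsnd (r : M × ℝ) : TangentSpace (I.prod 𝓘(ℝ, ℝ)) r →L[ℝ] ℝ :=
  mvfderiv (I.prod 𝓘(ℝ, ℝ)) (Prod.snd : M × ℝ → ℝ) r

variable (I) in
/-- The differential of the projection to `M`. -/
abbrev dfst (r : M × ℝ) : TangentSpace (I.prod 𝓘(ℝ, ℝ)) r →L[ℝ] TangentSpace I r.1 :=
  mfderiv (I.prod 𝓘(ℝ, ℝ)) I Prod.fst r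

theorem dsnd_apply (v : TangentSpace (I.prod 𝓘(ℝ, ℝ)) r) : dsnd I r v = (show E × ℝ from v).2 := by
  simp only [dsnd, mvfderiv]
  rw [mfderiv_snd]
  rfl

theorem dfst_apply (v : TangentSpace (I.prod 𝓘(ℝ, ℝ)) r) : dfst I r v = (show E × ℝ from v).1 := by
  simp only [dfst]
  rw [mfderiv_fst]
  rfl

theorem exists_tangent_prod (r : M × ℝ) (w : TangentSpace I r.1) (t : ℝ) :
    ∃ v : TangentSpace (I.prod 𝓘(ℝ, ℝ)) r, dfst I r v = w ∧ dsnd I r v = t := by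
  let v : TangentSpace (I.prod 𝓘(ℝ, ℝ)) r := ((w, t) : E × ℝ)
  exact ⟨v, by rw [dfst_apply], by rw [dsnd_apply]⟩

theorem tangent_prod_ext {v w : TangentSpace (I.prod 𝓘(ℝ, ℝ)) r} (h1 : dfst I r v = dfst I r w)
    (h2 : dsnd I r v = dsnd I r w) : v = w := by
  rw [dfst_apply, dfst_apply] at h1
  rw [dsnd_apply, dsnd_apply] at h2
  exact Prod.ext h1 h2

theorem dfst_vertVF : dfst I r (vertVF I r) = 0 := by
  rw [dfst_apply]
  exact congrArg (fun v : E × ℝ => v.1) (vertVF_eq r)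

theorem dsnd_vertVF : dsnd I r (vertVF I r) = 1 := by
  rw [dsnd_apply]
  exact congrArg (fun v : E × ℝ => v.2) (vertVF_eq r)

theorem mvfderiv_comp_fst {f : M → ℝ} (hf : SmoothFn I f)
    (v : TangentSpace (I.prod 𝓘(ℝ, ℝ)) r) :
    mvfderiv (I.prod 𝓘(ℝ, ℝ)) (fun r => f r.1) r v = mvfderiv I f r.1 (dfst I r v) :=
  mvfderiv_comp_apply r (hf.mdiff _) mdifferentiableAt_fst v

theorem smoothFn_snd : SmoothFn (I.prod 𝓘(ℝ, ℝ)) (Prod.snd : M × ℝ → ℝ) := contMDiff_snd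

theorem smoothFn_comp_fst {f : M → ℝ} (hf : SmoothFn I f) :
    SmoothFn (I.prod 𝓘(ℝ, ℝ)) (fun r : M × ℝ => f r.1) := hf.comp contMDiff_fst

variable [CompleteSpace E] [FiniteDimensional ℝ E] [T2Space M] [I.Boundaryless]

section InvariantForm

variable (hu : SmoothFn I u) (hb : SmoothFormOn I b univ)
  (ha : ∀ (r : M × ℝ) (w : TangentSpace (I.prod 𝓘(ℝ, ℝ)) r),
    a r w = u r.1 * dsnd I r w + b r.1 (dfst I r w))
include hu hb ha

/-- Simultaneous expressions for `b` and `a`: the index `none` carries the term `u ds`, the others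
are pulled back from `M`. -/
theorem exists_eq_sum_prod (r : M × ℝ) : ∃ (m : ℕ) (f g : Fin m → M → ℝ),
    (∀ i, SmoothFn I (f i)) ∧ (∀ i, SmoothFn I (g i)) ∧
    (∀ᶠ q in 𝓝 r.1, ∀ v, b q v = ∑ i, g i q * mvfderiv I (f i) q v) ∧
    ∃ F G : Option (Fin m) → M × ℝ → ℝ, (∀ i, SmoothFn (I.prod 𝓘(ℝ, ℝ)) (F i)) ∧
      (∀ i, SmoothFn (I.prod 𝓘(ℝ, ℝ)) (G i)) ∧ (F none = Prod.snd) ∧ (G none = fun r => u r.1) ∧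
      (∀ i, F (some i) = fun r => f i r.1) ∧ (∀ i, G (some i) = fun r => g i r.1) ∧
      ∀ᶠ q in 𝓝 r, ∀ v, a q v = ∑ i, G i q * mvfderiv (I.prod 𝓘(ℝ, ℝ)) (F i) q v := by
  obtain ⟨m, f, g, hf, hg, h⟩ := hb.exists_eq_sum r.1
  refine ⟨m, f, g, hf, hg, h, fun i => i.elim Prod.snd fun i r => f i r.1,
    fun i => i.elim (fun r => u r.1) fun i r => g i r.1, ?_, ?_, rfl, rfl, fun _ => rfl,
    fun _ => rfl, ?_⟩
  · rintro (_ | i)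
    exacts [smoothFn_snd, smoothFn_comp_fst (hf i)]
  · rintro (_ | i)
    exacts [smoothFn_comp_fst hu, smoothFn_comp_fst (hg i)]
  · filter_upwards [continuous_fst.continuousAt.eventually h] with q hq v
    rw [ha, hq, Fintype.sum_option]
    refine congrArg _ (Finset.sum_congr rfl fun i _ => ?_)
    exact congrArg _ (mvfderiv_comp_fst (hf i) v).symm

theorem smoothFormOn_prod : SmoothFormOn (I.prod 𝓘(ℝ, ℝ)) a univ := by
  intro X hX
  rw [contMDiffOn_univ]
  intro r
  obtain ⟨m, f, g, -, -, -, F, G, hF, hG, -, -, -, -, h⟩ := exists_eq_sum_prod hu hb ha r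
  exact smoothFormOn_of_eq_sum hF hG h hX

/-- This is `da = du ∧ ds + db`, read off from `a = u ds + ∑ g df` and `b = ∑ g df`. -/
theorem extD_prod {B : TangentSpace I r.1 →ₗ[ℝ] TangentSpace I r.1 →ₗ[ℝ] ℝ}
    (hB : ∀ X Y, SmoothVF I X → SmoothVF I Y → extD I b X Y r.1 = B (X r.1) (Y r.1))
    (hX : SmoothVF (I.prod 𝓘(ℝ, ℝ)) X) (hY : SmoothVF (I.prod 𝓘(ℝ, ℝ)) Y) :
    extD (I.prod 𝓘(ℝ, ℝ)) a X Y r =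
      mvfderiv I u r.1 (dfst I r (X r)) * dsnd I r (Y r) -
      mvfderiv I u r.1 (dfst I r (Y r)) * dsnd I r (X r) +
      B (dfst I r (X r)) (dfst I r (Y r)) := by
  obtain ⟨m, f, g, hf, hg, hbe, F, G, hF, hG, hF0, hG0, hF1, hG1, h⟩ :=
    exists_eq_sum_prod hu hb ha r
  have hB' : ∀ v w, B v w =
      ∑ i, (mvfderiv I (g i) r.1 v * mvfderiv I (f i) r.1 w -
        mvfderiv I (g i) r.1 w * mvfderiv I (f i) r.1 v) := by
    intro v w
    obtain ⟨V, hV, rfl⟩ := exists_smoothVF_apply_eq (I := I) v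
    obtain ⟨W, hW, rfl⟩ := exists_smoothVF_apply_eq (I := I) w
    rw [← hB V W hV hW, extD_of_eq_sum hf hg hbe hV hW]
    rfl
  rw [extD_of_eq_sum hF hG h hX hY, Fintype.sum_option, hB', hF0, hG0]
  simp only [hF1, hG1, lieD]
  rw [mvfderiv_comp_fst hu, mvfderiv_comp_fst hu]
  congr 1
  refine Finset.sum_congr rfl fun i _ => ?_
  rw [mvfderiv_comp_fst (hf i), mvfderiv_comp_fst (hf i), mvfderiv_comp_fst (hg i),
    mvfderiv_comp_fst (hg i)]

/-- The Lie derivative of `a` along `∂_s` vanishes by Cartan's formula: the contraction of `da` with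
`∂_s` is `-du`, and `a(∂_s) = u`. -/
theorem isContactVF_vertVF : IsContactVF (I.prod 𝓘(ℝ, ℝ)) a (vertVF I) := by
  refine ⟨smoothVF_vertVF, fun Y hY r _ => ?_⟩
  obtain ⟨B, hB, -⟩ := exists_extD_bilin hb r.1
  have h1 := extD_prod hu hb ha hB smoothVF_vertVF hY
  have h2 : (fun q => a q (vertVF I q)) = fun q => u q.1 := by
    funext q
    rw [ha, dsnd_vertVF, dfst_vertVF, map_zero]
    ring
  rw [dfst_vertVF, dsnd_vertVF, map_zero, map_zero, extD, h2] at h1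
  have h3 : lieD (I.prod 𝓘(ℝ, ℝ)) Y (fun q => u q.1) r = mvfderiv I u r.1 (dfst I r (Y r)) :=
    mvfderiv_comp_fst hu _
  rw [h3] at h1
  simp only [LinearMap.zero_apply] at h1
  linarith

end InvariantForm

/-- The tangent spaces of the product are `ℝ × TM`, where the pair condition is literally the
contact condition. A Reeb vector shows that `a` has no zeros. -/
theorem IsContactPairOn.isContactForm_prod (h : IsContactPairOn I u b)
    (ha : ∀ (r : M × ℝ) (w : TangentSpace (I.prod 𝓘(ℝ, ℝ)) r),
      a r w = u r.1 * dsnd I r w + b r.1 (dfst I r w)) :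
    IsContactForm (I.prod 𝓘(ℝ, ℝ)) a := by
  refine ⟨smoothFormOn_prod h.smoothFn h.smoothForm ha, fun r => ⟨?_, fun X hX hX0 h0 => ?_⟩⟩
  · obtain ⟨B, -, hB⟩ := h.exists_pair r.1
    have : FiniteDimensional ℝ (TangentSpace I r.1) := inferInstanceAs (FiniteDimensional ℝ E)
    obtain ⟨t, w, hw, -⟩ := hB.exists_reeb
    obtain ⟨v, hv1, hv2⟩ := exists_tangent_prod r w t
    refine ⟨v, ?_⟩
    rw [ha, hv1, hv2]
    exact ne_of_eq_of_ne hw one_ne_zero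
  · obtain ⟨B, hB, hB'⟩ := h.exists_pair r.1
    have := hB'.nondeg (dsnd I r (X r)) (dfst I r (X r)) (by rw [← hX0, ha]; rfl)
      (fun t w hw => by
        obtain ⟨v, hv1, hv2⟩ := exists_tangent_prod r w t
        obtain ⟨Y, hY, rfl⟩ := exists_smoothVF_apply_eq (I := I.prod 𝓘(ℝ, ℝ)) v
        have h1 := extD_prod h.smoothFn h.smoothForm ha hB hX hY
        rw [h0 Y hY (by rw [ha, hv1, hv2]; exact hw), hv1, hv2] at h1
        exact h1.symm)
    exact tangent_prod_ext (by rw [this.2, map_zero]) (by rw [this.1, map_zero])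

theorem isTransverseTo_vertVF : IsTransverseTo (I.prod 𝓘(ℝ, ℝ)) I
    (fun x : M => (x, (0 : ℝ))) (vertVF I) := by
  rintro x ⟨w, hw⟩
  have h1 := congrArg (dsnd I (x, (0 : ℝ))) hw
  rw [dsnd_vertVF, mfderiv_prod_left, dsnd_apply] at h1
  exact zero_ne_one (α := ℝ) h1

end Product

/-! ### The Jacobi pair along the hypersurface. -/

section JacobiPair

open Manifold

variable {E : Type*} [NormedAddCommGroup E] [NormedSpace ℝ E] {H : Type*} [TopologicalSpace H]
  {I : ModelWithCorners ℝ E H} {M : Type*} [TopologicalSpace M] [ChartedSpace H M]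
  {E' : Type*} [NormedAddCommGroup E'] [NormedSpace ℝ E'] {H' : Type*} [TopologicalSpace H']
  {J : ModelWithCorners ℝ E' H'} {Z : Type*} [TopologicalSpace Z] [ChartedSpace H' Z]
  {ι : Z → M} {k : ℕ} {f₀ : C^∞⟮I, M; ℝ⟯}
  [IsManifold I ∞ M] [FiniteDimensional ℝ E] [FiniteDimensional ℝ E'] [CompleteSpace E]
  [T2Space M] [I.Boundaryless] [J.Boundaryless] [IsManifold J ∞ Z] [T2Space Z] [CompleteSpace E']

namespace IsHypersurfaceWithJet

variable (D : IsHypersurfaceWithJet I J ι k f₀) {x : Z} {σ α : BkForm I ι k f₀}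
  (hσ : IsLogForm σ) {u : Z → ℝ} {β : OneForm J Z}

include D in
/-- Covectors on the hypersurface extend. -/
theorem exists_extension (l : TangentSpace J x →ₗ[ℝ] ℝ) :
    ∃ ξ : TangentSpace I (ι x) →L[ℝ] ℝ, ∀ w, ξ (mfderiv J I ι x w) = l w := by
  obtain ⟨L, hL⟩ := LinearMap.exists_leftInverse_of_injective (mfderiv J I ι x).toLinearMap
    (LinearMap.ker_eq_bot.2 (D.mfderiv_injective x))
  obtain ⟨ξ, hξ⟩ := exists_continuousLinearMap_eq (I := I) (p := ι x) (l.comp L)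
  refine ⟨ξ, fun w => ?_⟩
  rw [hξ]
  exact congrArg l (LinearMap.congr_fun hL w)

variable (h : IsTangentialPart J α σ u β)
include D hσ h

theorem isContactPairOn (hα : α.IsContact) : IsContactPairOn J u β where
  smoothFn := D.smooth_residue hσ h
  smoothForm := D.smooth_tangentialPart hσ h
  exists_pair x := by
    obtain ⟨B, hB, hBa⟩ := exists_extD_bilin (D.smooth_tangentialPart hσ h) x
    exact ⟨B, hB, D.isContactPair hσ h hα hB hBa⟩

variable {B : TangentSpace J x →ₗ[ℝ] TangentSpace J x →ₗ[ℝ] ℝ}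
  (hB : ∀ X Y, SmoothVF J X → SmoothVF J Y → extD J β X Y x = B (X x) (Y x))
include hB

/-- Sections realise every pair `(t', w')` in the fibre, so the conditions on all sections become
conditions on all such pairs. -/
theorem isReebAt_iff {R : Π p : M, TangentSpace I p} (hR : IsBkSection I ι k f₀ R)
    {r : TangentSpace J x} (hr : mfderiv J I ι x r = R (ι x)) :
    IsReebAt α (ι x) R ↔ u x * σ.toFun R (ι x) + β x r = 1 ∧ ∀ (t' : ℝ) (w' : TangentSpace J x),
      mvfderiv J u x r * t' - mvfderiv J u x w' * σ.toFun R (ι x) + B r w' = 0 := by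
  refine ⟨fun ⟨_, h1, h2⟩ => ⟨by rw [← h R hR x r hr, h1], fun t' w' => ?_⟩,
    fun ⟨h1, h2⟩ => ⟨hR, by rw [h R hR x r hr, h1], fun Y hY => ?_⟩⟩
  · obtain ⟨Y, hY, hYw, hYt⟩ := D.exists_section hσ x t' w'
    rw [← h2 Y hY, D.d_eq_bilin hσ h hB hR hY hr hYw.symm, hYt]
  · obtain ⟨w', hw'⟩ := D.exists_mfderiv_eq hY x
    rw [D.d_eq_bilin hσ h hB hR hY hr hw', h2]

/-- The Jacobi pair along the hypersurface, in terms of the splitting. -/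
theorem isJacobiSharp_iff {ξ : TangentSpace I (ι x) →L[ℝ] ℝ} {v : TangentSpace I (ι x)} :
    IsJacobiSharp α (ι x) ξ v ↔ ∃ (t : ℝ) (r : TangentSpace J x) (s : ℝ) (w : TangentSpace J x),
      u x * t + β x r = 1 ∧
      (∀ (t' : ℝ) (w' : TangentSpace J x),
        mvfderiv J u x r * t' - mvfderiv J u x w' * t + B r w' = 0) ∧
      u x * s + β x w = 0 ∧
      (∀ (t' : ℝ) (w' : TangentSpace J x),
        mvfderiv J u x w * t' - mvfderiv J u x w' * s + B w w' = ξ (mfderiv J I ι x w') -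
          ξ (mfderiv J I ι x r) * (u x * t' + β x w')) ∧
      mfderiv J I ι x w = v := by
  constructor
  · rintro ⟨R, X, hR, hX, hX0, hXY, rfl⟩
    obtain ⟨r, hr⟩ := D.exists_mfderiv_eq hR.1 x
    obtain ⟨w, hw⟩ := D.exists_mfderiv_eq hX x
    obtain ⟨h1, h2⟩ := (D.isReebAt_iff hσ h hB hR.1 hr).1 hR
    refine ⟨_, r, σ.toFun X (ι x), w, h1, h2, by rw [← h X hX x w hw, hX0], fun t' w' => ?_, hw⟩
    obtain ⟨Y, hY, hYw, hYt⟩ := D.exists_section hσ x t' w'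
    have h3 := hXY Y hY
    rw [D.d_eq_bilin hσ h hB hX hY hw hYw.symm, h Y hY x w' hYw.symm, hYt, hYw, ← hr] at h3
    exact h3
  · rintro ⟨t, r, s, w, h1, h2, h3, h4, rfl⟩
    obtain ⟨R, hR, hRr, hRt⟩ := D.exists_section hσ x t r
    obtain ⟨X, hX, hXw, hXs⟩ := D.exists_section hσ x s w
    refine ⟨R, X, (D.isReebAt_iff hσ h hB hR hRr.symm).2 (by rw [hRt]; exact ⟨h1, h2⟩), hX,
      by rw [h X hX x w hXw.symm, hXs, h3], fun Y hY => ?_, hXw⟩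
    obtain ⟨w', hw'⟩ := D.exists_mfderiv_eq hY x
    rw [D.d_eq_bilin hσ h hB hX hY hXw.symm hw', h Y hY x w' hw', hXs, h4, ← hw', hRr]

variable (hp : IsContactPair (u x) (β x).toLinearMap (mvfderiv J u x).toLinearMap B)
include hp

theorem exists_isReebAt : ∃ R, IsReebAt α (ι x) R := by
  have : FiniteDimensional ℝ (TangentSpace J x) := inferInstanceAs (FiniteDimensional ℝ E')
  obtain ⟨t, r, h1, h2⟩ := hp.exists_reeb
  obtain ⟨R, hR, hRr, hRt⟩ := D.exists_section hσ x t r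
  exact ⟨R, (D.isReebAt_iff hσ h hB hR hRr.symm).2 (by rw [hRt]; exact ⟨h1, h2⟩)⟩

theorem exists_isJacobiSharp (ξ : TangentSpace I (ι x) →L[ℝ] ℝ) :
    ∃ v, IsJacobiSharp α (ι x) ξ v := by
  have : FiniteDimensional ℝ (TangentSpace J x) := inferInstanceAs (FiniteDimensional ℝ E')
  obtain ⟨t, r, h1, h2⟩ := hp.exists_reeb
  obtain ⟨s, w, h3, h4⟩ := hp.exists_sharp h1 h2 (ξ.comp (mfderiv J I ι x)).toLinearMap
  exact ⟨_, (D.isJacobiSharp_iff hσ h hB).2 ⟨t, r, s, w, h1, h2, h3, h4, rfl⟩⟩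

omit hB hp

/-- For `u = 0`, testing the defining equations with `(1, 0)` gives `du(R) = 0`, and `du(w) = 0` for
the vectors `w` of `Λ(ξ, ·)`. Conversely, if `du` and `β` vanish on `w`, then `(0, w)` belongs to
any covector `ξ` that restricts to `dβ(w, ·)` on `TZ`; here `ξ(R) = 0`, because `dβ(R, w)` is a
multiple of `du(w)`. -/
theorem inducesJacobiContactForm (hα : α.IsContact) : InducesJacobiContactForm J α u β := by
  intro x hx
  obtain ⟨B, hB, hp⟩ := (D.isContactPairOn hσ h hα).exists_pair x
  refine ⟨D.exists_isReebAt hσ h hB hp, D.exists_isJacobiSharp hσ h hB hp, fun R hR => ?_, ?_⟩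
  · obtain ⟨r, hr⟩ := D.exists_mfderiv_eq hR.1 x
    obtain ⟨h1, h2⟩ := (D.isReebAt_iff hσ h hB hR.1 hr).1 hR
    refine ⟨r, hr, ?_, by simpa [hx] using h1⟩
    simpa using h2 1 0
  · ext v
    constructor
    · rintro ⟨ξ, hξ⟩
      obtain ⟨t, r, s, w, h1, h2, h3, h4, rfl⟩ := (D.isJacobiSharp_iff hσ h hB).1 hξ
      refine ⟨w, ⟨?_, by simpa [hx] using h3⟩, rfl⟩
      simpa [hx] using h4 1 0
    · rintro ⟨w, ⟨hw1, hw2⟩, rfl⟩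
      have : FiniteDimensional ℝ (TangentSpace J x) := inferInstanceAs (FiniteDimensional ℝ E')
      obtain ⟨t, r, h1, h2⟩ := hp.exists_reeb
      obtain ⟨ξ, hξ⟩ := D.exists_extension (x := x) (B w)
      refine ⟨ξ, (D.isJacobiSharp_iff hσ h hB).2 ⟨t, r, 0, w, h1, h2, by simp [hx, hw2],
        fun t' w' => ?_, rfl⟩⟩
      have h5 : B r w = 0 := by
        have := h2 0 w
        change mvfderiv J u x r * 0 - mvfderiv J u x w * t + B r w = 0 at this
        rw [hw1] at this
        linarith
      rw [hξ, hξ, hw1, hp.alt w r, h5]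
      ring

/-- For `u ≠ 0` the kernel of `α` projects isomorphically to `TZ`, with inverse `w ↦ (-u⁻¹ β(w),
w)`, and `dα` becomes `τ`. On the kernel the term `ξ(R) α` drops out. -/
theorem isJacobiConformalForm (hα : α.IsContact) :
    IsJacobiConformalForm J α u (conformalForm J u β) := by
  refine ⟨(D.isContactPairOn hσ h hα).isLocallyConformallySymplecticOn, fun x hx => ?_⟩
  obtain ⟨B, hB, hp⟩ := (D.isContactPairOn hσ h hα).exists_pair x
  refine ⟨D.exists_isReebAt hσ h hB hp, D.exists_isJacobiSharp hσ h hB hp, ?_,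
    fun ξ W Y hW hY hξ => ?_⟩
  · ext v
    constructor
    · rintro ⟨ξ, hξ⟩
      obtain ⟨t, r, s, w, -, -, -, -, rfl⟩ := (D.isJacobiSharp_iff hσ h hB).1 hξ
      exact ⟨w, rfl⟩
    · rintro ⟨w, rfl⟩
      have : FiniteDimensional ℝ (TangentSpace J x) := inferInstanceAs (FiniteDimensional ℝ E')
      obtain ⟨t, r, h1, h2⟩ := hp.exists_reeb
      change u x * t + β x r = 1 at h1
      change ∀ (t' : ℝ) (w' : TangentSpace J x),
        mvfderiv J u x r * t' - mvfderiv J u x w' * t + B r w' = 0 at h2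
      set s := - (u x)⁻¹ * β x w with hs
      have hs' : u x * s + β x w = 0 := by
        rw [hs]
        field_simp
        ring
      -- The covector is forced: testing with `(1, 0)` requires `ξ(R) = -u⁻¹ du(w)`, and testing
      -- with `(0, w')` then gives `ξ(w')`.
      obtain ⟨ξ, hξ⟩ := D.exists_extension (x := x) (B w - s • (mvfderiv J u x).toLinearMap -
        ((u x)⁻¹ * mvfderiv J u x w) • (β x).toLinearMap)
      have hξ' : ∀ w', ξ (mfderiv J I ι x w') = B w w' - s * mvfderiv J u x w' -
        ((u x)⁻¹ * mvfderiv J u x w) * β x w' := hξ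
      refine ⟨ξ, (D.isJacobiSharp_iff hσ h hB).2 ⟨t, r, s, w, h1, h2, hs', fun t' w' => ?_, rfl⟩⟩
      have h3 : ξ (mfderiv J I ι x r) = - (u x)⁻¹ * mvfderiv J u x w := by
        rw [hξ', hp.alt w r]
        have h4 := h2 s w
        field_simp
        linear_combination (- u x) * h4 - mvfderiv J u x w * h1
      rw [h3, hξ']
      field_simp
      ring
  · obtain ⟨t, r, s, w, h1, h2, h3, h4, hw⟩ := (D.isJacobiSharp_iff hσ h hB).1 hξ
    obtain rfl := D.mfderiv_injective x hw
    -- The test vector is the lift of `Y` to the kernel of `α`.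
    have h5 := h4 (- (u x)⁻¹ * β x (Y x)) (Y x)
    have h6 : u x * (- (u x)⁻¹ * β x (Y x)) + β x (Y x) = 0 := by
      field_simp
      ring
    have h7 : s = - (u x)⁻¹ * β x (W x) := by
      field_simp
      linarith
    rw [h6, mul_zero, sub_zero] at h5
    rw [← h5, h7]
    simp only [conformalForm, lieD]
    rw [hB W Y hW hY]
    ring

end IsHypersurfaceWithJet

end JacobiPair

theorem isLocallyConstant_of_mvfderiv_eq_zero {E : Type*} [NormedAddCommGroup E] [NormedSpace ℝ E]
    {H : Type*} [TopologicalSpace H] {I : ModelWithCorners ℝ E H} {M : Type*} [TopologicalSpace M]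
    [ChartedSpace H M] [IsManifold I ∞ M] [I.Boundaryless] {f : M → ℝ} (hf : SmoothFn I f)
    (h : ∀ p, mvfderiv I f p = 0) : IsLocallyConstant f := by
  rw [IsLocallyConstant.iff_eventually_eq]
  intro p
  set φ := extChartAt I p
  have hT : φ.target ∈ 𝓝 (φ p) := extChartAt_target_mem_nhds p
  obtain ⟨ε, hε, hball⟩ := Metric.mem_nhds_iff.1 hT
  have hd : ∀ e ∈ Metric.ball (φ p) ε, HasFDerivAt (f ∘ φ.symm) (0 : E →L[ℝ] ℝ) e := by
    intro e he
    have h1 : MDifferentiableAt 𝓘(ℝ, E) I φ.symm e := by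
      have := (contMDiffOn_extChartAt_symm (n := ∞) (I := I) p).contMDiffAt
        ((isOpen_extChartAt_target p).mem_nhds (hball he))
      exact this.mdifferentiableAt (by simp)
    have h2 : MDifferentiableAt 𝓘(ℝ, E) 𝓘(ℝ, ℝ) (f ∘ φ.symm) e := (hf.mdiff _).comp e h1
    have h3 : fderiv ℝ (f ∘ φ.symm) e = 0 := by
      rw [← mfderiv_eq_fderiv]
      ext v
      have h4 := mvfderiv_comp_apply e (hf.mdiff _) h1 v
      rw [h] at h4
      exact h4
    rw [← h3]
    exact h2.differentiableAt.hasFDerivAt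
  have hconst : ∀ e ∈ Metric.ball (φ p) ε, (f ∘ φ.symm) e = (f ∘ φ.symm) (φ p) := fun e he =>
    (convex_ball (φ p) ε).is_const_of_fderivWithin_eq_zero (𝕜 := ℝ)
      (fun y hy => (hd y hy).differentiableAt.differentiableWithinAt)
      (fun y hy => ((hd y hy).hasFDerivWithinAt).fderivWithin
        (Metric.isOpen_ball.uniqueDiffWithinAt hy)) he (Metric.mem_ball_self hε)
  filter_upwards [(continuousAt_extChartAt (I := I) p).eventually (Metric.ball_mem_nhds _ hε),
    extChartAt_source_mem_nhds (I := I) p] with q h1 h2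
  have := hconst _ h1
  rw [Function.comp_apply, Function.comp_apply, φ.left_inv h2,
    φ.left_inv (mem_extChartAt_source p)] at this
  exact this

/-! ### Change of the log form, and regularisations. -/

section Regularisations

open Manifold

variable {E : Type*} [NormedAddCommGroup E] [NormedSpace ℝ E] {H : Type*} [TopologicalSpace H]
  {I : ModelWithCorners ℝ E H} {M : Type*} [TopologicalSpace M] [ChartedSpace H M]
  {E' : Type*} [NormedAddCommGroup E'] [NormedSpace ℝ E'] {H' : Type*} [TopologicalSpace H']
  {J : ModelWithCorners ℝ E' H'} {Z : Type*} [TopologicalSpace Z] [ChartedSpace H' Z]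
  {ι : Z → M} {k : ℕ} {f₀ : C^∞⟮I, M; ℝ⟯}
  [IsManifold I ∞ M] [FiniteDimensional ℝ E] [FiniteDimensional ℝ E'] [CompleteSpace E]
  [T2Space M] [I.Boundaryless] [J.Boundaryless] [IsManifold J ∞ Z] [T2Space Z] [CompleteSpace E']

namespace IsHypersurfaceWithJet

variable (D : IsHypersurfaceWithJet I J ι k f₀) {x : Z} {σ σ' α : BkForm I ι k f₀}
  (hσ : IsLogForm σ) (hσ' : IsLogForm σ') {u : Z → ℝ} {β β' : OneForm J Z}
include D hσ hσ'

/-- Log forms differ by a closed form on the hypersurface. -/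
theorem exists_closed_difference : ∃ γ : OneForm J Z, SmoothFormOn J γ univ ∧
    (∀ x V W, SmoothVF J V → SmoothVF J W → extD J γ V W x = 0) ∧
    IsTangentialPart J σ' σ (fun _ => 1) γ := by
  obtain ⟨c, γ, h⟩ := D.exists_isTangentialPart hσ σ'
  have hc : c = fun _ => 1 := by
    funext x
    obtain ⟨z, hz, hzd⟩ := D.exists_adapted x
    obtain ⟨X, hX, hX0, hXz⟩ := D.exists_kernel_section hz hzd
    have h1 := h X hX x 0 (by rw [map_zero, hX0])
    rw [D.apply_kernel_section hσ hz hzd hX (hX0 x) hXz,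
      D.apply_kernel_section hσ' hz hzd hX (hX0 x) hXz, map_zero] at h1
    linarith
  rw [hc] at h
  exact ⟨γ, D.smooth_tangentialPart hσ h,
    fun x => (D.closed_parts hσ h (fun X Y hX hY x => D.d_isLogForm hσ' hX hY x) x).2, h⟩

/-- With `σ' = σ + γ` along `Z`, the equation `u σ + β = u σ' + β'` gives `β' = β - u γ`. Hence `β`
does not change on `Γ`, and `u⁻¹ β` changes by a closed form. -/
theorem tangentialPart_change (h : IsTangentialPart J α σ u β)
    (h' : IsTangentialPart J α σ' u β') : ∃ γ : OneForm J Z, SmoothFormOn J γ univ ∧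
      (∀ x V W, SmoothVF J V → SmoothVF J W → extD J γ V W x = 0) ∧
      ∀ x, β' x = β x - u x • γ x := by
  obtain ⟨γ, hγ, hdγ, hc⟩ := D.exists_closed_difference (J := J) hσ hσ'
  refine ⟨γ, hγ, hdγ, fun x => ?_⟩
  ext w
  obtain ⟨X, hX, hXw, hXt⟩ := D.exists_section hσ x 0 w
  have h1 := h X hX x w hXw.symm
  have h2 := h' X hX x w hXw.symm
  have h3 := hc X hX x w hXw.symm
  rw [hXt] at h1 h3
  rw [h3, h1] at h2
  simp only [sub_apply, smul_apply, smul_eq_mul]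
  linarith

end IsHypersurfaceWithJet

section ProductMaps

variable {F : Type*} [NormedAddCommGroup F] [NormedSpace ℝ F] {G : Type*} [TopologicalSpace G]
  {K : ModelWithCorners ℝ F G} {N : Type*} [TopologicalSpace N] [ChartedSpace G N]
  {f : N → M} {g : N → ℝ} {y : N}

theorem mdifferentiableAt_prodMk (hf : MDifferentiableAt K I f y)
    (hg : MDifferentiableAt K 𝓘(ℝ, ℝ) g y) :
    MDifferentiableAt K (I.prod 𝓘(ℝ, ℝ)) (fun y => (f y, g y)) y := hf.prodMk hg

theorem dfst_mfderiv (hf : MDifferentiableAt K I f y) (hg : MDifferentiableAt K 𝓘(ℝ, ℝ) g y)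
    (w : TangentSpace K y) : dfst I (f y, g y)
      (mfderiv K (I.prod 𝓘(ℝ, ℝ)) (fun y => (f y, g y)) y w) = mfderiv K I f y w :=
  (mfderiv_comp_apply y mdifferentiableAt_fst (mdifferentiableAt_prodMk hf hg) w).symm

theorem dsnd_mfderiv (hf : MDifferentiableAt K I f y) (hg : MDifferentiableAt K 𝓘(ℝ, ℝ) g y)
    (w : TangentSpace K y) : dsnd I (f y, g y)
      (mfderiv K (I.prod 𝓘(ℝ, ℝ)) (fun y => (f y, g y)) y w) = mvfderiv K g y w :=
  (mvfderiv_comp_apply y (smoothFn_snd.mdiff _) (mdifferentiableAt_prodMk hf hg) w).symm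

end ProductMaps

namespace Regularisation

variable (Φ : Regularisation I J ι k f₀) {X Y : Π p : M, TangentSpace I p}

theorem dfst_lift (hX : IsBkSection I ι k f₀ X) (q : M × ℝ) :
    dfst I q (Φ.lift X q) = X q.1 := Φ.anchor X hX q

/-- The form on the `b^k`-tangent bundle which corresponds to `ds` on the foliation. -/
def verticalForm : BkForm I ι k f₀ where
  toFun X p := dsnd I (p, 0) (Φ.lift X (p, 0))
  smooth X hX := ((Φ.smooth X hX).lieD smoothFn_snd).comp (contMDiff_id.prodMk contMDiff_const)
  map_add X Y hX hY := by
    funext p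
    rw [Φ.map_add X Y hX hY]
    exact _root_.map_add _ _ _
  map_smul f X hf hX := by
    funext p
    rw [Φ.map_smul f X hf hX]
    exact _root_.map_smul _ _ _

/-- By invariance, the lift of `X` at `(p, 0)` translated to `(p, s)` is again in the foliation. It
has the same projection to `M` as the lift at `(p, s)`. If the vertical components differed, `∂_s`
would be a multiple of the difference and so lie in the foliation, against transversality. -/
theorem dsnd_lift_of_notMem (hX : IsBkSection I ι k f₀ X) {p : M} (hp : p ∉ range ι) (s : ℝ) :
    dsnd I (p, s) (Φ.lift X (p, s)) = Φ.verticalForm.toFun X p := by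
  have hP := isVFModule_isBkSection (I := I) (ι := ι) (k := k) (f₀ := f₀)
  have hf : MDifferentiableAt (I.prod 𝓘(ℝ, ℝ)) I (fun r : M × ℝ => r.1) (p, 0) :=
    mdifferentiableAt_fst
  have hg : MDifferentiableAt (I.prod 𝓘(ℝ, ℝ)) 𝓘(ℝ, ℝ) (fun r : M × ℝ => r.2 + s) (p, 0) :=
    SmoothFn.mdiff (smoothFn_snd.add contMDiff_const) _
  obtain ⟨X', hX', hXX⟩ : ∃ X', IsBkSection I ι k f₀ X' ∧ Φ.lift X' (p, 0 + s) =
      mfderiv (I.prod 𝓘(ℝ, ℝ)) (I.prod 𝓘(ℝ, ℝ)) (fun r : M × ℝ => (r.1, r.2 + s)) (p, 0)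
        (Φ.lift X (p, 0)) := by
    have := (Φ.invariant s (p, 0)).subset (mem_image_of_mem _ ⟨X, hX, rfl⟩)
    exact this
  have h1 := dfst_mfderiv hf hg (Φ.lift X (p, 0))
  have h2 := dsnd_mfderiv hf hg (Φ.lift X (p, 0))
  rw [← hXX] at h1 h2
  have h3 : mvfderiv (I.prod 𝓘(ℝ, ℝ)) (fun r : M × ℝ => r.2 + s) (p, 0) (Φ.lift X (p, 0)) =
      Φ.verticalForm.toFun X p := by
    have h4 := lieD_add (X := Φ.lift X) (smoothFn_snd.mdiff ((p, 0) : M × ℝ))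
      (SmoothFn.mdiff (contMDiff_const (c := s)) (p, 0))
    rw [lieD_const, add_zero] at h4
    exact h4
  rw [h3] at h2
  rw [zero_add] at h1 h2 hXX
  by_contra hne
  set δ := Φ.verticalForm.toFun X p - dsnd I (p, s) (Φ.lift X (p, s)) with hδ
  have hδ0 : δ ≠ 0 := sub_ne_zero.2 (Ne.symm hne)
  have hc : ∀ c : ℝ, SmoothFn I fun _ : M => c := fun c => contMDiff_const
  have hsec := hP.smul (hc δ⁻¹) (hP.add hX' (hP.smul (hc (-1)) hX))
  refine Φ.transverse (p, s) hp ⟨_, hsec, ?_⟩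
  have h5 : X' p = X p := by
    rw [← Φ.dfst_lift hX' (p, s)]
    exact h1.trans (Φ.dfst_lift hX (p, 0))
  apply tangent_prod_ext
  · rw [Φ.dfst_lift hsec, dfst_vertVF]
    simp [h5]
  · have h6 : Φ.lift (fun q => δ⁻¹ • (X' q + (-1 : ℝ) • X q)) (p, s) =
        δ⁻¹ • (Φ.lift X' (p, s) + (-1 : ℝ) • Φ.lift X (p, s)) := by
      rw [Φ.map_smul _ _ (hc _) (hP.add hX' (hP.smul (hc (-1)) hX)),
        Φ.map_add _ _ hX' (hP.smul (hc (-1)) hX), Φ.map_smul _ _ (hc _) hX]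
    rw [dsnd_vertVF, h6, _root_.map_smul, _root_.map_add, _root_.map_smul, h2]
    simp only [smul_eq_mul]
    rw [neg_one_mul, ← sub_eq_add_neg, ← hδ, inv_mul_cancel₀ hδ0]

variable (D : IsHypersurfaceWithJet I J ι k f₀)
include D

/-- The foliation is invariant under translations. -/
theorem dsnd_lift (hX : IsBkSection I ι k f₀ X) (q : M × ℝ) :
    dsnd I q (Φ.lift X q) = Φ.verticalForm.toFun X q.1 := by
  obtain ⟨p, s⟩ := q
  have h1 : SmoothFn I fun p : M => dsnd I (p, s) (Φ.lift X (p, s)) :=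
    ((Φ.smooth X hX).lieD smoothFn_snd).comp (contMDiff_id.prodMk contMDiff_const)
  exact congrFun (Continuous.ext_on D.dense_compl_range h1.continuous
    (Φ.verticalForm.smooth X hX).continuous fun p hp => Φ.dsnd_lift_of_notMem hX hp s) p

/-- Lifting preserves brackets, so that the closedness of `ds` on `M × ℝ` is inherited. -/
theorem d_verticalForm (hX : IsBkSection I ι k f₀ X) (hY : IsBkSection I ι k f₀ Y) (p : M) :
    Φ.verticalForm.d X Y p = 0 := by
  have hl : ∀ {X}, IsBkSection I ι k f₀ X → lieD (I.prod 𝓘(ℝ, ℝ)) (Φ.lift X) Prod.snd =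
      fun q => Φ.verticalForm.toFun X q.1 := fun hX => funext fun q => Φ.dsnd_lift D hX q
  have h2 : ∀ {X Y}, IsBkSection I ι k f₀ X → IsBkSection I ι k f₀ Y →
      lieD (I.prod 𝓘(ℝ, ℝ)) (Φ.lift X) (fun q => Φ.verticalForm.toFun Y q.1) (p, 0) =
        lieD I X (Φ.verticalForm.toFun Y) p := by
    intro X Y hX hY
    have := mvfderiv_comp_fst (r := ((p, 0) : M × ℝ)) (Φ.verticalForm.smooth Y hY)
      (Φ.lift X (p, 0))
    rw [Φ.dfst_lift hX] at this
    exact this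
  have h1 := lieD_mlieBracket (Φ.smooth X hX) (Φ.smooth Y hY) smoothFn_snd ((p, 0) : M × ℝ)
  rw [← Φ.bracket X Y hX hY, hl hX, hl hY, hl (hX.mlieBracket hY), h2 hX hY, h2 hY hX] at h1
  simp only [BkForm.d]
  linarith

variable {σ α : BkForm I ι k f₀} (hσ : IsLogForm σ) {u c : Z → ℝ} {β γ : OneForm J Z} {x : Z}
  (hc : IsTangentialPart J Φ.verticalForm σ c γ)

include hσ hc

/-- If `c x = 0`, the section spanning the kernel of the anchor would lift to zero at `(ι x, 0)`. -/
theorem coefficient_ne_zero (x : Z) : c x ≠ 0 := by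
  intro h0
  obtain ⟨X, hX, hX0, hX1⟩ := D.exists_section hσ x 1 0
  rw [map_zero] at hX0
  have h1 := hc X hX x 0 (by rw [map_zero, hX0])
  rw [h0, map_zero, zero_mul, add_zero] at h1
  have h2 : Φ.lift X (ι x, 0) = 0 := tangent_prod_ext
    (by rw [Φ.dfst_lift hX, hX0, map_zero]) (by rw [Φ.dsnd_lift D hX, h1, map_zero])
  have := Φ.injective X hX (ι x, 0) h2 σ
  rw [hX1] at this
  exact one_ne_zero this

theorem isLocallyConstant_coefficient : IsLocallyConstant c :=
  isLocallyConstant_of_mvfderiv_eq_zero (D.smooth_residue hσ hc) fun x =>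
    (D.closed_parts hσ hc (fun _ _ hX hY _ => Φ.d_verticalForm D hX hY _) x).1

theorem extD_coefficient {V W : Π x : Z, TangentSpace J x} (hV : SmoothVF J V)
    (hW : SmoothVF J W) : extD J γ V W x = 0 :=
  (D.closed_parts hσ hc (fun _ _ hX hY _ => Φ.d_verticalForm D hX hY _) x).2 V W hV hW

/-- The form on the central leaf of the regularisation. -/
theorem isInducedForm_iff (h : IsTangentialPart J α σ u β)
    {a : OneForm (J.prod 𝓘(ℝ, ℝ)) (Z × ℝ)} : Φ.IsInducedForm α a ↔ ∀ r w,
      a r w = u r.1 / c r.1 * dsnd J r w +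
        (β r.1 - (u r.1 / c r.1) • γ r.1) (dfst J r w) := by
  have hι : ∀ r : Z × ℝ, MDifferentiableAt (J.prod 𝓘(ℝ, ℝ)) I (fun r : Z × ℝ => ι r.1) r :=
    fun r => (D.mdiff_emb r.1).comp r mdifferentiableAt_fst
  have hs : ∀ r : Z × ℝ, MDifferentiableAt (J.prod 𝓘(ℝ, ℝ)) 𝓘(ℝ, ℝ) (fun r : Z × ℝ => r.2) r :=
    fun r => smoothFn_snd.mdiff r
  have hd : ∀ (r : Z × ℝ) (w : TangentSpace (J.prod 𝓘(ℝ, ℝ)) r),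
      mfderiv (J.prod 𝓘(ℝ, ℝ)) I (fun r : Z × ℝ => ι r.1) r w =
        mfderiv J I ι r.1 (dfst J r w) := fun r w =>
    mfderiv_comp_apply r (D.mdiff_emb r.1) mdifferentiableAt_fst w
  -- Eliminating `σ` from `α = u σ + β` and `ds = c σ + γ` gives `α = (u / c) ds + β - (u / c) γ`.
  have key : ∀ X, IsBkSection I ι k f₀ X → ∀ (r : Z × ℝ) (w : TangentSpace (J.prod 𝓘(ℝ, ℝ)) r),
      mfderiv (J.prod 𝓘(ℝ, ℝ)) (I.prod 𝓘(ℝ, ℝ)) (fun r : Z × ℝ => (ι r.1, r.2)) r w =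
        Φ.lift X (ι r.1, r.2) → α.toFun X (ι r.1) = u r.1 / c r.1 * dsnd J r w +
        (β r.1 - (u r.1 / c r.1) • γ r.1) (dfst J r w) := by
    intro X hX r w hw
    have h1 := dfst_mfderiv (hι r) (hs r) w
    have h2 : _ = dsnd J r w := dsnd_mfderiv (hι r) (hs r) w
    rw [hw, Φ.dfst_lift hX, hd] at h1
    rw [hw, Φ.dsnd_lift D hX] at h2
    have h3 := hc X hX r.1 _ h1.symm
    rw [h X hX r.1 _ h1.symm, ← h2, h3]
    have := Φ.coefficient_ne_zero D hσ hc r.1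
    simp only [sub_apply, smul_apply, smul_eq_mul]
    field_simp
    ring
  refine ⟨fun ha r w => ?_, fun ha X hX r w hw => ?_⟩
  -- Every tangent vector of the central leaf is a lift, so the form is determined everywhere.
  · obtain ⟨X, hX, hXw⟩ := (Φ.central r.1 r.2).superset (mem_range_self w)
    rw [ha X hX r w hXw.symm, key X hX r w hXw.symm]
  · rw [ha, key X hX r w hw]

theorem exists_unique_isInducedForm (h : IsTangentialPart J α σ u β) :
    ∃! a : OneForm (J.prod 𝓘(ℝ, ℝ)) (Z × ℝ), Φ.IsInducedForm α a := by
  refine ⟨fun r => (u r.1 / c r.1) • dsnd J r +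
    (β r.1 - (u r.1 / c r.1) • γ r.1).comp (dfst J r),
    (Φ.isInducedForm_iff D hσ hc h).2 fun r w => rfl, fun a ha => ?_⟩
  funext r
  ext w
  exact (Φ.isInducedForm_iff D hσ hc h).1 ha r w

/-- The contact condition is satisfied by the splitting that belongs to a regularisation. -/
theorem isContactPairOn_induced (h : IsTangentialPart J α σ u β) (hα : α.IsContact) :
    IsContactPairOn J (fun x => u x / c x) (fun x => β x - (u x / c x) • γ x) := by
  have hcs := D.smooth_residue hσ hc
  have hγ := D.smooth_tangentialPart hσ hc
  have hp := D.isContactPairOn hσ h hα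
  have hne := Φ.coefficient_ne_zero D hσ hc
  have hu' : SmoothFn J fun x => u x / c x := hp.smoothFn.div₀ hcs hne
  have hsm : SmoothFormOn J (fun x => (u x / c x) • γ x) univ :=
    SmoothFormOn.smul hu'.contMDiffOn hγ
  refine ⟨hu', hp.smoothForm.sub hsm, fun x => ?_⟩
  obtain ⟨B, hB, hB'⟩ := hp.exists_pair x
  obtain ⟨B₁, hB₁, -⟩ := exists_extD_bilin (hp.smoothForm.sub hsm) x
  refine ⟨B₁, hB₁, hB'.change_splitting (hne x) (γ x).toLinearMap ?_ (fun w => rfl) ?_ ?_⟩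
  · field_simp [hne x]
  -- As `dc = 0`, differentiating `u = c (u / c)` gives `du = c d(u / c)`.
  · intro w
    obtain ⟨W, hW, rfl⟩ := exists_smoothVF_apply_eq (I := J) w
    have h1 : lieD J W u x = lieD J W (fun x => c x * (u x / c x)) x := by
      congr 1
      funext y
      field_simp [hne y]
    have h2 := lieD_mul (X := W) (hcs.mdiff x) (hu'.mdiff x)
    have h3 : lieD J W c x = 0 := by
      simp only [lieD]
      rw [(D.closed_parts hσ hc (fun _ _ hX hY _ => Φ.d_verticalForm D hX hY _) x).1]
      rfl
    rw [← h1, h3, mul_zero, add_zero] at h2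
    exact h2
  · intro v w
    obtain ⟨V, hV, rfl⟩ := exists_smoothVF_apply_eq (I := J) v
    obtain ⟨W, hW, rfl⟩ := exists_smoothVF_apply_eq (I := J) w
    rw [← hB₁ V W hV hW, ← hB V W hV hW, extD_sub hp.smoothForm hsm hV hW,
      extD_smul (hu'.mdiff x) hγ hV hW, Φ.extD_coefficient D hσ hc hV hW]
    simp only [lieD]
    change _ = extD J β V W x -
      (mvfderiv J (fun x => u x / c x) x (V x) * γ x (W x) -
        mvfderiv J (fun x => u x / c x) x (W x) * γ x (V x))
    ring

theorem conformalForm_induced (h : IsTangentialPart J α σ u β) (hα : α.IsContact)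
    {V W : Π x : Z, TangentSpace J x} (hV : SmoothVF J V) (hW : SmoothVF J W) (hx : u x ≠ 0) :
    conformalForm J (fun x => u x / c x) (fun x => β x - (u x / c x) • γ x) V W x =
      conformalForm J u β V W x := by
  have hp := D.isContactPairOn hσ h hα
  have hne := Φ.coefficient_ne_zero D hσ hc
  have hl := (IsLocallyConstant.iff_eventually_eq c).1
    (Φ.isLocallyConstant_coefficient D hσ hc) x
  refine conformalForm_change (hne x) (Φ.isContactPairOn_induced D hσ hc h hα).smoothFn
    hp.smoothForm (D.smooth_tangentialPart hσ hc) hV hW ?_ (.of_forall fun _ => rfl)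
    (Φ.extD_coefficient D hσ hc hV hW) hx
  filter_upwards [hl] with y hy
  have := hne y
  rw [← hy]
  field_simp

/-- On the foliation `dz + z^k ds = 0`, while `dz = z^k σ`. Cancelling `z^k` gives `ds = -σ` along
`Z`. -/
theorem standard_coefficients (hs : Φ.IsStandard σ) : (∀ x, c x = -1) ∧ ∀ x, γ x = 0 := by
  obtain ⟨z, hz, hzd, U, hU, hZU, hst⟩ := hs
  have h1 : IsTangentialPart J Φ.verticalForm σ (fun _ => -1) (fun _ => 0) := by
    intro X hX x w _
    have := eq_of_pow_mul_eventually_eq (z := z) (p := ι x) (m := k) (hzd x)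
      (Φ.verticalForm.smooth X hX).continuous.continuousAt
      (b := fun q => - σ.toFun X q) (σ.smooth X hX).continuous.continuousAt.neg (by
        filter_upwards [hU.mem_nhds (hZU (mem_range_self x))] with q hq
        obtain ⟨e1, e2⟩ := hst X hX q hq
        have e3 := e2 0
        rw [e1] at e3
        change z q ^ k * σ.toFun X q + z q ^ k * Φ.verticalForm.toFun X q = 0 at e3
        linarith)
    rw [this]
    simp
  obtain ⟨h2, h3⟩ := D.isTangentialPart_unique hσ hc h1
  exact ⟨fun x => congrFun h2 x, fun x => congrFun h3 x⟩

end Regularisation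

end Regularisations

end BContact

end

/-! ### The theorem. -/

open BContact in
theorem mainTheorem10 {n k : ℕ} (hk : 1 ≤ k)
    {M : Type*} [TopologicalSpace M] [T2Space M] [SecondCountableTopology M]
    [ChartedSpace (EuclideanSpace ℝ (Fin (2 * n + 1))) M] [IsManifold (𝓡 (2 * n + 1)) ∞ M]
    {Z : Type*} [TopologicalSpace Z]
    [ChartedSpace (EuclideanSpace ℝ (Fin (2 * n))) Z] [IsManifold (𝓡 (2 * n)) ∞ Z]
    (ι : Z → M) (hι : Manifold.IsSmoothEmbedding (𝓡 (2 * n)) (𝓡 (2 * n + 1)) ∞ ι)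
    (hιc : IsClosed (Set.range ι))
    (f₀ : C^∞⟮𝓡 (2 * n + 1), M; ℝ⟯) (hf₀ : IsJetRepresentative (𝓡 (2 * n + 1)) ι k f₀)
    (α : BkForm (𝓡 (2 * n + 1)) ι k f₀) (hα : α.IsContact) :
    -- the residue of `α` exists, and so does the form `σ = dz / z^k`
    (∃! u : Z → ℝ, IsResidue α u) ∧
    (∃ σ : BkForm (𝓡 (2 * n + 1)) ι k f₀, IsLogForm σ) ∧
    ∀ u : Z → ℝ, IsResidue α u →
    ContMDiff (𝓡 (2 * n)) 𝓘(ℝ, ℝ) ∞ u ∧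
    (∀ σ : BkForm (𝓡 (2 * n + 1)) ι k f₀, IsLogForm σ →
      -- the form `β`
      (∃! β : OneForm (𝓡 (2 * n)) Z, IsTangentialPart (𝓡 (2 * n)) α σ u β) ∧
      ∀ β : OneForm (𝓡 (2 * n)) Z, IsTangentialPart (𝓡 (2 * n)) α σ u β →
      SmoothFormOn (𝓡 (2 * n)) β Set.univ ∧
      -- `u` vanishes transversely, and `β` restricts to a contact form on `Γ`
      RestrictsToContactForm (𝓡 (2 * n)) u β ∧
      -- `d(u⁻¹β)` is symplectic on the complement of `Γ`, and an ideal Liouville structure on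
      -- both of the domains bounded by `Γ`
      SmoothFormOn (𝓡 (2 * n)) (quotForm (𝓡 (2 * n)) u β) {x | u x ≠ 0} ∧
      (∀ x, u x ≠ 0 →
        NondegenerateAt (𝓡 (2 * n)) (extD (𝓡 (2 * n)) (quotForm (𝓡 (2 * n)) u β)) x) ∧
      IsIdealLiouvilleDomain (𝓡 (2 * n)) {x | 0 ≤ u x} (quotForm (𝓡 (2 * n)) u β) ∧
      IsIdealLiouvilleDomain (𝓡 (2 * n)) {x | u x ≤ 0} (quotForm (𝓡 (2 * n)) u β) ∧
      -- comparison with the structures induced by the Jacobi pair of `α`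
      InducesJacobiContactForm (𝓡 (2 * n)) α u β ∧
      IsJacobiConformalForm (𝓡 (2 * n)) α u (conformalForm (𝓡 (2 * n)) u β) ∧
      (∀ X Y, SmoothVF (𝓡 (2 * n)) X → SmoothVF (𝓡 (2 * n)) Y → ∀ x, u x ≠ 0 →
        extD (𝓡 (2 * n)) (quotForm (𝓡 (2 * n)) u β) X Y x =
          (u x)⁻¹ * conformalForm (𝓡 (2 * n)) u β X Y x) ∧
      -- the structures do not depend on the choice of `σ`
      (∀ (σ' : BkForm (𝓡 (2 * n + 1)) ι k f₀) (β' : OneForm (𝓡 (2 * n)) Z), IsLogForm σ' →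
        IsTangentialPart (𝓡 (2 * n)) α σ' u β' →
        (∀ x, u x = 0 → ∀ w, mvfderiv (𝓡 (2 * n)) u x w = 0 → β' x w = β x w) ∧
        (∀ X Y, SmoothVF (𝓡 (2 * n)) X → SmoothVF (𝓡 (2 * n)) Y → ∀ x, u x ≠ 0 →
          extD (𝓡 (2 * n)) (quotForm (𝓡 (2 * n)) u β') X Y x =
            extD (𝓡 (2 * n)) (quotForm (𝓡 (2 * n)) u β) X Y x)) ∧
      -- comparison with the convex hypersurface `Z × {0}` in the central leaf of a regularisation
      (∀ Φ : Regularisation (𝓡 (2 * n + 1)) (𝓡 (2 * n)) ι k f₀,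
        (∃! a : OneForm ((𝓡 (2 * n)).prod 𝓘(ℝ, ℝ)) (Z × ℝ), Φ.IsInducedForm α a) ∧
        ∀ a : OneForm ((𝓡 (2 * n)).prod 𝓘(ℝ, ℝ)) (Z × ℝ), Φ.IsInducedForm α a →
        IsContactForm ((𝓡 (2 * n)).prod 𝓘(ℝ, ℝ)) a ∧
        IsContactVF ((𝓡 (2 * n)).prod 𝓘(ℝ, ℝ)) a (vertVF (𝓡 (2 * n))) ∧
        IsTransverseTo ((𝓡 (2 * n)).prod 𝓘(ℝ, ℝ)) (𝓡 (2 * n))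
          (fun x : Z => (x, (0 : ℝ))) (vertVF (𝓡 (2 * n))) ∧
        ∀ (u' : Z → ℝ) (β' : OneForm (𝓡 (2 * n)) Z),
        u' = convexFunction ((𝓡 (2 * n)).prod 𝓘(ℝ, ℝ)) a (vertVF (𝓡 (2 * n)))
          (fun x : Z => (x, (0 : ℝ))) →
        β' = pullbackForm ((𝓡 (2 * n)).prod 𝓘(ℝ, ℝ)) (𝓡 (2 * n)) a
          (fun x : Z => (x, (0 : ℝ))) →
        -- `α_reg = u' ds + β'` on the central leaf
        (∀ (r : Z × ℝ) (w : TangentSpace ((𝓡 (2 * n)).prod 𝓘(ℝ, ℝ)) r),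
          a r w =
            u' r.1 * mvfderiv ((𝓡 (2 * n)).prod 𝓘(ℝ, ℝ)) (Prod.snd : Z × ℝ → ℝ) r w +
            β' r.1 (mfderiv ((𝓡 (2 * n)).prod 𝓘(ℝ, ℝ)) (𝓡 (2 * n)) Prod.fst r w)) ∧
        -- the dividing sets and the contact structures on them coincide
        convexDividingSet ((𝓡 (2 * n)).prod 𝓘(ℝ, ℝ)) a (vertVF (𝓡 (2 * n)))
          (fun x : Z => (x, (0 : ℝ))) = {x | u x = 0} ∧
        (∀ x, u x = 0 → ∀ w, mvfderiv (𝓡 (2 * n)) u x w = 0 → β' x w = β x w) ∧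
        -- the ideal Liouville structure of the convex hypersurface
        IsIdealLiouvilleDomain (𝓡 (2 * n)) {x | 0 ≤ u' x} (quotForm (𝓡 (2 * n)) u' β') ∧
        IsIdealLiouvilleDomain (𝓡 (2 * n)) {x | u' x ≤ 0} (quotForm (𝓡 (2 * n)) u' β') ∧
        (∀ X Y, SmoothVF (𝓡 (2 * n)) X → SmoothVF (𝓡 (2 * n)) Y → ∀ x, u x ≠ 0 →
          extD (𝓡 (2 * n)) (quotForm (𝓡 (2 * n)) u' β') X Y x =
            (u' x)⁻¹ * conformalForm (𝓡 (2 * n)) u β X Y x) ∧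
        -- it agrees with the one obtained above up to a locally constant factor
        (∃ c : Z → ℝ, IsLocallyConstant c ∧ (∀ x, c x ≠ 0) ∧ (∀ x, u x = c x * u' x) ∧
          ∀ X Y, SmoothVF (𝓡 (2 * n)) X → SmoothVF (𝓡 (2 * n)) Y → ∀ x, u x ≠ 0 →
            extD (𝓡 (2 * n)) (quotForm (𝓡 (2 * n)) u' β') X Y x =
              c x * extD (𝓡 (2 * n)) (quotForm (𝓡 (2 * n)) u β) X Y x) ∧
        -- the standard regularisation
        (Φ.IsStandard σ → (∀ x, u' x = - u x) ∧ β' = β))) := by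
  have D : IsHypersurfaceWithJet (𝓡 (2 * n + 1)) (𝓡 (2 * n)) ι k f₀ :=
    ⟨by simp, hι, hk, hf₀⟩
  have : LocallyCompactSpace M :=
    ChartedSpace.locallyCompactSpace (EuclideanSpace ℝ (Fin (2 * n + 1))) M
  have : T2Space Z := hι.isEmbedding.t2Space
  -- An auxiliary log form yields existence and smoothness of the residue. For any other `σ`,
  -- `isResidue_iff` identifies the coefficient with the same `u`.
  obtain ⟨σ₀, hσ₀⟩ := D.exists_isLogForm hιc
  obtain ⟨u₀, β₀, h₀⟩ := D.exists_isTangentialPart hσ₀ α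
  refine ⟨⟨u₀, (D.isResidue_iff hσ₀ h₀).2 rfl, fun u hu => (D.isResidue_iff hσ₀ h₀).1 hu⟩,
    ⟨σ₀, hσ₀⟩, fun u hu => ?_⟩
  obtain rfl := (D.isResidue_iff hσ₀ h₀).1 hu
  refine ⟨D.smooth_residue hσ₀ h₀, fun σ hσ => ?_⟩
  obtain ⟨u₁, β₁, h₁⟩ := D.exists_isTangentialPart hσ α
  obtain rfl := (D.isResidue_iff hσ h₁).1 hu
  refine ⟨⟨β₁, h₁, fun β hβ => (D.isTangentialPart_unique hσ hβ h₁).2⟩, fun β h => ?_⟩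
  have hp := D.isContactPairOn hσ h hα
  have hquot : ∀ X Y, SmoothVF (𝓡 (2 * n)) X → SmoothVF (𝓡 (2 * n)) Y → ∀ x, u x ≠ 0 →
      extD (𝓡 (2 * n)) (quotForm (𝓡 (2 * n)) u β) X Y x =
        (u x)⁻¹ * conformalForm (𝓡 (2 * n)) u β X Y x := fun X Y hX hY x hx =>
    extD_quotForm hp.smoothFn hp.smoothForm hX hY hx
  refine ⟨hp.smoothForm, hp.restrictsToContactForm, hp.smoothFormOn_quotForm,
    fun x hx => hp.nondegenerateAt_extD_quotForm hx, hp.isIdealLiouvilleDomain,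
    hp.isIdealLiouvilleDomain_nonpos, D.inducesJacobiContactForm hσ h hα,
    D.isJacobiConformalForm hσ h hα, hquot, fun σ' β' hσ' h' => ?_, fun Φ => ?_⟩
  · obtain ⟨γ, hγ, hdγ, hβ'⟩ := D.tangentialPart_change hσ hσ' h h'
    refine ⟨fun x hx w _ => by rw [hβ', hx, zero_smul, sub_zero], fun X Y hX hY x hx => ?_⟩
    rw [hquot X Y hX hY x hx, extD_quotForm hp.smoothFn (D.smooth_tangentialPart hσ' h') hX hY hx,
      conformalForm_change one_ne_zero hp.smoothFn hp.smoothForm hγ hX hY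
        (.of_forall fun y => (one_mul _).symm) (.of_forall hβ') (hdγ x X Y hX hY) hx]
  -- The splitting `ds = c σ + γ` along `Z` contains all that is needed of the regularisation.
  · obtain ⟨c, γ, hc⟩ := D.exists_isTangentialPart hσ Φ.verticalForm
    have hne := Φ.coefficient_ne_zero D hσ hc
    refine ⟨Φ.exists_unique_isInducedForm D hσ hc h, fun a ha => ?_⟩
    rw [Φ.isInducedForm_iff D hσ hc h] at ha
    have hpc := Φ.isContactPairOn_induced D hσ hc h hα
    refine ⟨hpc.isContactForm_prod ha, isContactVF_vertVF hpc.smoothFn hpc.smoothForm ha,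
      isTransverseTo_vertVF, fun u' β' hu' hβ' => ?_⟩
    obtain rfl : u' = fun x => u x / c x := by
      rw [hu']
      funext x
      rw [convexFunction, ha, dsnd_vertVF, dfst_vertVF, map_zero]
      ring
    obtain rfl : β' = fun x => β x - (u x / c x) • γ x := by
      rw [hβ']
      funext x
      ext w
      have h1 : dfst (𝓡 (2 * n)) (x, (0 : ℝ))
          (mfderiv (𝓡 (2 * n)) ((𝓡 (2 * n)).prod 𝓘(ℝ, ℝ)) (fun x : Z => (x, (0 : ℝ))) x w) = w := by
        rw [mfderiv_prod_left, dfst_apply]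
        rfl
      have h2 : dsnd (𝓡 (2 * n)) (x, (0 : ℝ))
          (mfderiv (𝓡 (2 * n)) ((𝓡 (2 * n)).prod 𝓘(ℝ, ℝ)) (fun x : Z => (x, (0 : ℝ))) x w) = 0 := by
        rw [mfderiv_prod_left, dsnd_apply]
        rfl
      have h3 := ha (x, 0) (mfderiv (𝓡 (2 * n)) ((𝓡 (2 * n)).prod 𝓘(ℝ, ℝ))
        (fun x : Z => (x, (0 : ℝ))) x w)
      rw [h2, h1, mul_zero, zero_add] at h3
      exact h3
    clear hu' hβ'
    have hτ : ∀ X Y, SmoothVF (𝓡 (2 * n)) X → SmoothVF (𝓡 (2 * n)) Y → ∀ x, u x ≠ 0 →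
        extD (𝓡 (2 * n)) (quotForm (𝓡 (2 * n)) (fun x => u x / c x)
          fun x => β x - (u x / c x) • γ x) X Y x =
            (u x / c x)⁻¹ * conformalForm (𝓡 (2 * n)) u β X Y x := fun X Y hX hY x hx => by
      rw [extD_quotForm hpc.smoothFn hpc.smoothForm hX hY (div_ne_zero hx (hne x)),
        Φ.conformalForm_induced D hσ hc h hα hX hY hx]
    refine ⟨ha, ?_, fun x hx w _ => by simp [hx], hpc.isIdealLiouvilleDomain,
      hpc.isIdealLiouvilleDomain_nonpos, hτ, ⟨c, Φ.isLocallyConstant_coefficient D hσ hc, hne,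
        fun x => (mul_div_cancel₀ _ (hne x)).symm, fun X Y hX hY x hx => ?_⟩, fun hs => ?_⟩
    · ext x
      simp only [convexDividingSet, mem_ofPred_eq]
      rw [ha, dsnd_vertVF, dfst_vertVF, map_zero, add_zero, mul_one]
      simp [hne x]
    · rw [hτ X Y hX hY x hx, hquot X Y hX hY x hx]
      have := hne x
      field_simp
    · obtain ⟨h1, h2⟩ := Φ.standard_coefficients D hσ hc hs
      refine ⟨fun x => ?_, funext fun x => ?_⟩
      · change u x / c x = -u x
        rw [h1, div_neg, div_one]
      rw [h2, smul_zero, sub_zero]
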